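/- **Setting.** A long virtual diagram is a smooth immersion $f:\mathbb R\to\mathbb R^2$ with $f(t)=(t,0)$ outside some big circle, whose multiple points are transverse double points, each endowed with a classical (over/under) or virtual crossing structure. Two diagrams are equivalent if they are related by a finite sequence of planar isotopies and generalized Reidemeister moves. A long classical knot diagram is one without virtual crossings. $D*K$ is the diagram obtained by placing $K$ to the right of $D$. A diagram is minimal (with respect to the number of virtual crossings) if no equivalent diagram has fewer virtual crossings. Let $T=\mathbb Z[p^{\pm1},q^{\pm1}]/\big((p-1)(p-q),(q-1)(p-q)\big)$. Cutting a diagram $D$ at underpasses and virtual crossings gives its arcs; cutting it at underpasses only gives its long arcs, where the initial and the final long arc are united into one (the initial one continues the final one through infinity). Thus the long arcs are in bijection with the classical crossings $v_1,\dots,v_n$: $\gamma^j$ is the long arc emanating from $v_j$. The first arc of each long arc has degree $0$, and along a long arc the degree changes at every virtual crossing, by $+1$ if one passes from the left to the right of the transversal branch and by $-1$ otherwise (on the united long arc the initial arc of the diagram has the same degree as its final arc). For a classical crossing $v$ and an arc $a$ put $[v:a]=\varepsilon_1+\varepsilon_2(t^{\mathrm{sgn}\,v}-1)-\varepsilon_3t^{\mathrm{sgn}\,v}\in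 T$, where $\mathrm{sgn}\,v$ is the local writhe, $t=p$ if $v$ is first passed on the overpass and $t=q$ if it is first passed on the underpass, and $\varepsilon_1,\varepsilon_2,\varepsilon_3\in\{0,1\}$ equal $1$ exactly when $a$ emanates from $v$, passes over $v$, comes into $v$, respectively. Let $$\zeta(D)=\det\Big(\sum_{a\subset\gamma^j}[v_i:a]\,s^{\deg a}\Big)_{i,j=1}^n\in T[s,s^{-1}]$$ (an empty determinant is $1$), and let $\deg_s$ denote the highest exponent of $s$ that occurs with a non-zero coefficient ($\deg_s 0=-\infty$). **Theorem 4.** Let $D$ be a long virtual diagram such that $\deg_s\zeta(D)$ equals the number of virtual crossings of $D$, and let $K$ be a long classical knot diagram. Then $D*K$ is minimal with respect to the number of virtual crossings. -/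

import Mathlib

open scoped ContDiff

/-! ### Sequences of passages -/

namespace LongVirtual

/-- The role that a branch of a diagram plays at a crossing: it is the overpass or the underpass
of a classical crossing, or one of the two branches of a virtual crossing. -/
inductive Role where
  | over
  | under
  | virt
  deriving DecidableEq

/-- The role of the other branch. -/
def Role.swap : Role → Role
  | .over => .under
  | .under => .over
  | .virt => .virt

/-- One passage of a long curve through a crossing: the label of the crossing, the role of the
branch that is being traversed, and whether this branch passes from the left to the right
(`ltr = true`) or from the right to the left (`ltr = false`) of the transversal branch. -/
structure Passage (α : Type*) where
  label : α
  role : Role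
  ltr : Bool

/-- The other passage through the same crossing. -/
def Passage.partner {α : Type*} (x : Passage α) : Passage α :=
  ⟨x.label, x.role.swap, !x.ltr⟩

def Passage.relabel {α β : Type*} (φ : α → β) (x : Passage α) : Passage β :=
  ⟨φ x.label, x.role, x.ltr⟩

/-! ### Reidemeister moves -/

/-- Two consecutive passages, in one of the two orders. -/
def pair {α : Type*} (inOrder : Bool) (x y : Passage α) : List (Passage α) :=
  if inOrder then [x, y] else [y, x]

/-- The triple point moves that are allowed. Three branches 1, 2, 3 cross pairwise; `a` is the role
of branch 1 at its crossing with 2, `b` the role of branch 1 at its crossing with 3, and `c` the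
role of branch 2 at its crossing with 3. Either one of the branches is virtual at both of its
crossings (purely virtual move and mixed move), or all three crossings are classical and one
of the branches lies over both others (classical third Reidemeister move). -/
def TripleAllowed (a b c : Role) : Prop :=
  (a = .virt ∧ b = .virt) ∨ (a = .virt ∧ c = .virt) ∨ (b = .virt ∧ c = .virt) ∨
  ((a ≠ .virt ∧ b ≠ .virt ∧ c ≠ .virt) ∧
    ((a = .over ∧ b = .over) ∨ (a = .under ∧ c = .over) ∨ (b = .under ∧ c = .under)))

/-- The three branches bound a triangle. Here `a` and `b` are the passages of branch 1 through its
crossings with 2 and 3, `c` is the passage of branch 2 through its crossing with 3, and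
`o₁` says that branch 1 meets 2 before 3, `o₂` that branch 2 meets 1 before 3, `o₃` that
branch 3 meets 1 before 2. If branch `i` meets `j` before `k`, then the crossing `ij` lies to the
left of `k` exactly when `i` passes `k` from the left to the right; for each of the three
crossings, its two branches have to agree on which side of the third branch it lies. -/
def Triangle {α : Type*} (a b c : Passage α) (o₁ o₂ o₃ : Bool) : Prop :=
  ((o₁ = b.ltr) ↔ (o₂ = c.ltr)) ∧
  (((!o₁) = a.ltr) ↔ (o₃ = c.partner.ltr)) ∧
  (((!o₂) = a.partner.ltr) ↔ ((!o₃) = b.partner.ltr))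

/-- The generalized Reidemeister moves, read off from the sequence of passages of a long diagram.
All versions (classical, virtual, mixed; all orientations) are covered. -/
inductive Move {α : Type*} : List (Passage α) → List (Passage α) → Prop
  /-- planar isotopy -/
  | isotopy (w : List (Passage α)) : Move w w
  /-- a classical or virtual curl is removed -/
  | first (A B : List (Passage α)) (x : Passage α) :
      Move (A ++ [x, x.partner] ++ B) (A ++ B)
  /-- a bigon is removed: one branch lies over the other, or both crossings are virtual; the
  branches may be parallel or antiparallel -/
  | second (A B C : List (Passage α)) (x y : Passage α) (o : Bool)
      (hrole : x.role = y.role) (hside : x.ltr = !y.ltr) :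
      Move (A ++ [x, y] ++ B ++ pair o x.partner y.partner ++ C) (A ++ B ++ C)
  /-- a branch is moved across a crossing of two other branches -/
  | third (A B C E : List (Passage α)) (a b c : Passage α) (o₁ o₂ o₃ : Bool)
      (hrole : TripleAllowed a.role b.role c.role) (htri : Triangle a b c o₁ o₂ o₃) :
      Move
        (A ++ pair o₁ a b ++ B ++ pair o₂ a.partner c ++ C ++ pair o₃ b.partner c.partner ++ E)
        (A ++ pair (!o₁) a b ++ B ++ pair (!o₂) a.partner c ++ C
          ++ pair (!o₃) b.partner c.partner ++ E)

/-! ### The coefficient ring -/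

/-- `ℤ[p, p⁻¹, q, q⁻¹]`, with `p` the variable of the inner ring and `q` that of the outer one. -/
abbrev PQRing : Type := LaurentPolynomial (LaurentPolynomial ℤ)

noncomputable def pVar : PQRing := LaurentPolynomial.C (LaurentPolynomial.T 1)

noncomputable def qVar : PQRing := LaurentPolynomial.T 1

noncomputable def relIdeal : Ideal PQRing :=
  Ideal.span {(pVar - 1) * (pVar - qVar), (qVar - 1) * (pVar - qVar)}

/-- `T = ℤ[p, p⁻¹, q, q⁻¹] / ((p - 1)(p - q), (q - 1)(p - q))`. -/
def CoeffRing : Type := PQRing ⧸ relIdeal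

noncomputable instance : CommRing CoeffRing := inferInstanceAs (CommRing (PQRing ⧸ relIdeal))

/-- The quotient map. -/
noncomputable def toCoeffRing : PQRing →+* CoeffRing := Ideal.Quotient.mk relIdeal

/-- `p ^ e` in `T`. -/
noncomputable def pPow (e : ℤ) : CoeffRing :=
  toCoeffRing (LaurentPolynomial.C (LaurentPolynomial.T e))

/-- `q ^ e` in `T`. -/
noncomputable def qPow (e : ℤ) : CoeffRing := toCoeffRing (LaurentPolynomial.T e)

/-! ### The polynomial of a sequence of passages

The passages of `w` are numbered `0, …, n - 1`, and they cut the line into the edges `0, …, n`: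
edge `g` ends at passage `g`, and edge `g + 1` starts there. -/

section Zeta

variable {α : Type*}

/-- The arc that contains an edge; an arc is named by its first edge. Arcs end at underpasses and
at virtual crossings. -/
def arcOf (w : List (Passage α)) : ℕ → ℕ
  | 0 => 0
  | g + 1 => match (w[g]?).map Passage.role with
    | some .over => arcOf w g
    | _ => g + 1

/-- The arcs. -/
def arcs (w : List (Passage α)) : Finset ℕ :=
  (Finset.range (w.length + 1)).image (arcOf w)

/-- The last underpass before edge `g`, or `init` if there is none. -/
def lastUnder (w : List (Passage α)) (init : Option ℕ) : ℕ → Option ℕ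
  | 0 => init
  | g + 1 => match (w[g]?).map Passage.role with
    | some .under => some g
    | _ => lastUnder w init g

/-- The long arc that contains edge `g`, named by the underpass from which it emanates. The initial
and the final long arc are united: the initial one continues the final one. -/
def longArcOf (w : List (Passage α)) (g : ℕ) : Option ℕ :=
  lastUnder w (lastUnder w none w.length) g

/-- The degree of edge `g`, if the degree of edge `0` is `init`: it is `0` behind an underpass, and
changes by `1` at a virtual crossing, where it increases if one passes from the left to
the right of the transversal branch. -/
def degFrom (w : List (Passage α)) (init : ℤ) : ℕ → ℤ
  | 0 => init
  | g + 1 => match w[g]? with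
    | some ⟨_, .under, _⟩ => 0
    | some ⟨_, .virt, true⟩ => degFrom w init g + 1
    | some ⟨_, .virt, false⟩ => degFrom w init g - 1
    | _ => degFrom w init g

/-- The degree of the arc that contains edge `g`. On the united long arc the initial arc of
the diagram has the degree of the final one. -/
def deg (w : List (Passage α)) (g : ℕ) : ℤ :=
  degFrom w (degFrom w 0 w.length) g

/-- The classical crossings, given by the positions of their underpasses. -/
abbrev Crossing (w : List (Passage α)) : Type := {i : Fin w.length // w[i].role = Role.under}

/-- Passage `o` is the overpass of the crossing `v`. -/
def IsOverpassOf (w : List (Passage α)) (v : Crossing w) (o : Fin w.length) : Prop :=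
  w[o].label = w[v.1].label ∧ w[o].role = Role.over

/-- The local writhe number: a crossing is positive if the underpassing branch goes from the
right to the left of the overpassing one. -/
def sgn (w : List (Passage α)) (v : Crossing w) : ℤ := if w[v.1].ltr then -1 else 1

open Classical in
/-- `t ^ sgn v`, where `t = p` if `v` is an early overcrossing, and `t = q` otherwise. -/
noncomputable def tPow (w : List (Passage α)) (v : Crossing w) : CoeffRing :=
  if ∃ o, IsOverpassOf w v o ∧ o < v.1 then pPow (sgn w v) else qPow (sgn w v)

open Classical in
/-- The incidence coefficient `[v : a]` of a classical crossing and an arc: the arc may emanate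
from `v`, pass over `v`, or come into `v`. -/
noncomputable def incidence (w : List (Passage α)) (v : Crossing w) (a : ℕ) : CoeffRing :=
  (if arcOf w (v.1 + 1) = a then 1 else 0)
    + (if ∃ o, IsOverpassOf w v o ∧ arcOf w o = a then tPow w v - 1 else 0)
    + (if arcOf w v.1 = a then -tPow w v else 0)

/-- The matrix `A`; its rows are indexed by the classical crossings, and its columns by the long
arcs, each of which is named by the crossing from which it emanates. -/
noncomputable def zetaMatrix (w : List (Passage α)) :
    Matrix (Crossing w) (Crossing w) (LaurentPolynomial CoeffRing) :=
  fun v j => ∑ a ∈ arcs w with longArcOf w a = some (j.1 : ℕ),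
    LaurentPolynomial.C (incidence w v a) * LaurentPolynomial.T (deg w a)

noncomputable def zetaOf (w : List (Passage α)) : LaurentPolynomial CoeffRing :=
  (zetaMatrix w).det

end Zeta

/-! ### Long virtual knot diagrams -/

/-- The determinant of two vectors of the plane `ℂ = ℝ²`. -/
def cross (u v : ℂ) : ℝ := u.re * v.im - u.im * v.re

end LongVirtual

open LongVirtual in
/-- A long virtual knot diagram: a smooth immersion of the line into the plane `ℂ = ℝ²` which is
standard outside a big circle, and whose multiple points are transverse double points; each of
these is endowed with a classical or virtual crossing structure. Only the values of `role` at
preimages of double points matter. -/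
structure LongVirtualDiagram where
  curve : ℝ → ℂ
  role : ℝ → Role
  smooth : ContDiff ℝ ∞ curve
  immersed : ∀ t, deriv curve t ≠ 0
  standard : ∃ R : ℝ, ∀ t : ℝ, R < |t| ∨ R < ‖curve t‖ → curve t = t
  double : ∀ a b c, curve a = curve b → curve b = curve c → a = b ∨ b = c ∨ a = c
  transverse : ∀ a b, a ≠ b → curve a = curve b → cross (deriv curve a) (deriv curve b) ≠ 0
  role_swap : ∀ a b, a ≠ b → curve a = curve b → role b = (role a).swap

namespace LongVirtualDiagram

open LongVirtual Filter Topology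

/-- The parameters at which the curve passes through a crossing. -/
def passageTimes (D : LongVirtualDiagram) : Set ℝ :=
  {t | ∃ u, u ≠ t ∧ D.curve u = D.curve t}

theorem hasStrictDerivAt (D : LongVirtualDiagram) (t : ℝ) :
    HasStrictDerivAt D.curve (deriv D.curve t) t :=
  D.smooth.contDiffAt.hasStrictDerivAt (by simp)

theorem abs_le_of_crossing {D : LongVirtualDiagram} {R : ℝ}
    (hR : ∀ t : ℝ, R < |t| ∨ R < ‖D.curve t‖ → D.curve t = t) {a b : ℝ} (hab : a ≠ b)
    (h : D.curve a = D.curve b) : |a| ≤ R := by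
  by_contra! ha
  have h1 := hR a (Or.inl ha)
  have h2 : D.curve b = b := by
    refine hR b (Or.inr ?_)
    rw [← h, h1]; simpa using ha
  rw [h1, h2] at h
  exact hab (by exact_mod_cast h)

theorem eventually_ne_diag (D : LongVirtualDiagram) (a : ℝ) :
    ∀ᶠ x : ℝ × ℝ in 𝓝 (a, a), D.curve x.1 = D.curve x.2 → x.1 = x.2 := by
  set u := deriv D.curve a with hu
  let L : ℂ →L[ℝ] ℝ := Complex.reCLM.comp ((ContinuousLinearMap.mul ℝ ℂ) (starRingEnd ℂ u))
  have hL : HasStrictDerivAt (fun t => L (D.curve t)) (L u) a :=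
    L.hasStrictFDerivAt.comp_hasStrictDerivAt a (D.hasStrictDerivAt a)
  have hLu : L u ≠ 0 := by
    have : L u = Complex.normSq u := by
      simp [L, Complex.normSq_apply]
    rw [this]
    simpa [Complex.normSq_eq_zero] using D.immersed a
  have h1 := (hL.hasStrictFDerivAt_equiv hLu).eventually_left_inverse
  have h2 : ∀ᶠ x : ℝ × ℝ in 𝓝 (a, a), _ := (h1.prod_nhds h1)
  filter_upwards [h2] with x hx h
  rw [← hx.1, ← hx.2, h]

theorem eventually_ne_offdiag (D : LongVirtualDiagram) {a b : ℝ} (hab : a ≠ b)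
    (h : D.curve a = D.curve b) :
    ∀ᶠ x : ℝ × ℝ in 𝓝 (a, b), D.curve x.1 = D.curve x.2 → x = (a, b) := by
  let F : ℝ × ℝ → ℂ := fun x => D.curve x.1 - D.curve x.2
  let L : ℝ × ℝ →L[ℝ] ℂ :=
    (ContinuousLinearMap.fst ℝ ℝ ℝ).smulRight (deriv D.curve a) -
      (ContinuousLinearMap.snd ℝ ℝ ℝ).smulRight (deriv D.curve b)
  have hF : HasStrictFDerivAt F L (a, b) := by
    have h1 : HasStrictFDerivAt (fun x : ℝ × ℝ => D.curve x.1) _ (a, b) :=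
      HasStrictFDerivAt.comp (g := D.curve) (a, b) (D.hasStrictDerivAt a).hasStrictFDerivAt
        hasStrictFDerivAt_fst
    have h2 : HasStrictFDerivAt (fun x : ℝ × ℝ => D.curve x.2) _ (a, b) :=
      HasStrictFDerivAt.comp (g := D.curve) (a, b) (D.hasStrictDerivAt b).hasStrictFDerivAt
        hasStrictFDerivAt_snd
    refine (h1.sub h2).congr_fderiv ?_
    ext <;> simp [L]
  have hinj : Function.Injective (L : ℝ × ℝ →ₗ[ℝ] ℂ) := by
    rw [← LinearMap.ker_eq_bot, LinearMap.ker_eq_bot']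
    rintro ⟨x, y⟩ hxy
    have hxy' : (x : ℂ) * deriv D.curve a - (y : ℂ) * deriv D.curve b = 0 := by
      simpa [L] using hxy
    have hc := D.transverse a b hab h
    have hre := congrArg Complex.re hxy'
    have him := congrArg Complex.im hxy'
    simp only [Complex.sub_re, Complex.sub_im, Complex.mul_re, Complex.mul_im, Complex.ofReal_re,
      Complex.ofReal_im, Complex.zero_re, Complex.zero_im, zero_mul, sub_zero, add_zero] at hre him
    unfold cross at hc
    have hx : x = 0 := by
      have : x * ((deriv D.curve a).re * (deriv D.curve b).im
        - (deriv D.curve a).im * (deriv D.curve b).re) = 0 := by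
        linear_combination (deriv D.curve b).im * hre - (deriv D.curve b).re * him
      exact (mul_eq_zero.1 this).resolve_right hc
    have hy : y = 0 := by
      have : y * ((deriv D.curve a).re * (deriv D.curve b).im
        - (deriv D.curve a).im * (deriv D.curve b).re) = 0 := by
        linear_combination (deriv D.curve a).im * hre - (deriv D.curve a).re * him
      exact (mul_eq_zero.1 this).resolve_right hc
    rw [hx, hy]; rfl
  let e := (LinearEquiv.ofInjectiveOfFinrankEq (L : ℝ × ℝ →ₗ[ℝ] ℂ) hinj
    (by simp)).toContinuousLinearEquiv
  have he : HasStrictFDerivAt F (e : ℝ × ℝ →L[ℝ] ℂ) (a, b) := by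
    refine hF.congr_fderiv ?_
    ext <;> rfl
  have h1 := he.eventually_left_inverse
  have h0 := h1.self_of_nhds
  filter_upwards [h1] with x hx hxx
  have hFx : F x = F (a, b) := by simp [F, h, hxx]
  rw [← hx, hFx, h0]

theorem finite_passageTimes (D : LongVirtualDiagram) : D.passageTimes.Finite := by
  obtain ⟨R, hR⟩ := D.standard
  let S : Set (ℝ × ℝ) := {x | x.1 ≠ x.2 ∧ D.curve x.1 = D.curve x.2}
  have hcont := D.smooth.continuous
  have hS : S.Finite := by
    by_contra hinf
    have hsub : S ⊆ Set.Icc (-R) R ×ˢ Set.Icc (-R) R := fun x hx =>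
      ⟨abs_le.1 (abs_le_of_crossing hR hx.1 hx.2),
        abs_le.1 (abs_le_of_crossing hR hx.1.symm hx.2.symm)⟩
    obtain ⟨⟨a, b⟩, -, hacc⟩ := Set.Infinite.exists_accPt_of_subset_isCompact hinf
      (isCompact_Icc.prod isCompact_Icc) hsub
    rw [accPt_iff_frequently] at hacc
    have hcl : IsClosed {x : ℝ × ℝ | D.curve x.1 = D.curve x.2} :=
      isClosed_eq (hcont.comp continuous_fst) (hcont.comp continuous_snd)
    have hab : D.curve a = D.curve b :=
      hcl.mem_of_frequently_of_tendsto (b := 𝓝 (a, b)) (f := id) (x := (a, b))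
        (hacc.mono fun x hx => hx.2.2) tendsto_id
    by_cases h : a = b
    · subst h
      obtain ⟨x, hx, hx'⟩ := (hacc.and_eventually (D.eventually_ne_diag a)).exists
      exact hx.2.1 (hx' hx.2.2)
    · obtain ⟨x, hx, hx'⟩ := (hacc.and_eventually (D.eventually_ne_offdiag h hab)).exists
      exact hx.1 (hx' hx.2.2)
  refine (hS.image Prod.fst).subset ?_
  rintro t ⟨u, hu, h⟩
  exact ⟨(t, u), ⟨hu.symm, h.symm⟩, rfl⟩

/-- The passages in the order in which they are traversed; a crossing is labelled by its position
in the plane. -/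
noncomputable def word (D : LongVirtualDiagram) : List (Passage ℂ) :=
  open Classical in
  (D.finite_passageTimes.toFinset.sort (· ≤ ·)).map fun t =>
    ⟨D.curve t, D.role t,
      decide (∃ u, u ≠ t ∧ D.curve u = D.curve t ∧
        cross (deriv D.curve u) (deriv D.curve t) < 0)⟩

/-- The polynomial `ζ(D)`. -/
noncomputable def zeta (D : LongVirtualDiagram) : LaurentPolynomial CoeffRing := zetaOf D.word

/-- Two diagrams are related by a planar isotopy or by a generalized Reidemeister move. As the curve
passes through the point at infinity of the sphere, a long diagram is determined up to
planar isotopy by its sequence of passages, up to the names of the crossings. -/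
def Step (D D' : LongVirtualDiagram) : Prop :=
  ∃ φ : Equiv.Perm ℂ, Move D.word (D'.word.map (Passage.relabel φ))

/-- `D` and `D'` represent the same long virtual knot. -/
def Equivalent : LongVirtualDiagram → LongVirtualDiagram → Prop := Relation.EqvGen Step

/-- The set of virtual crossings. -/
def virtualCrossings (D : LongVirtualDiagram) : Set ℂ :=
  {z | ∃ a b, a ≠ b ∧ D.curve a = z ∧ D.curve b = z ∧ D.role a = Role.virt}

/-- The number of virtual crossings of a diagram. -/
noncomputable def virtualNumber (D : LongVirtualDiagram) : ℕ := D.virtualCrossings.ncard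

/-- A long classical knot diagram has no virtual crossings. -/
def IsClassical (D : LongVirtualDiagram) : Prop := D.virtualCrossings = ∅

/-- Minimality with respect to the number of virtual crossings. -/
def IsMinimal (D : LongVirtualDiagram) : Prop :=
  ∀ D' : LongVirtualDiagram, Equivalent D D' → D.virtualNumber ≤ D'.virtualNumber

/-! ### The product -/

theorem exists_radius (D : LongVirtualDiagram) :
    ∃ R : ℝ, 0 < R ∧ ∀ t : ℝ, R < |t| ∨ R < ‖D.curve t‖ → D.curve t = t := by
  obtain ⟨R, hR⟩ := D.standard
  exact ⟨max R 1, by positivity, fun t ht => hR t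
    (ht.imp (lt_of_le_of_lt (le_max_left _ _)) (lt_of_le_of_lt (le_max_left _ _)))⟩

/-- A radius outside of which the diagram is standard. -/
noncomputable def radius (D : LongVirtualDiagram) : ℝ := D.exists_radius.choose

theorem radius_pos (D : LongVirtualDiagram) : 0 < D.radius := D.exists_radius.choose_spec.1

theorem curve_eq (D : LongVirtualDiagram) (t : ℝ) (h : D.radius < |t| ∨ D.radius < ‖D.curve t‖) :
    D.curve t = t := D.exists_radius.choose_spec.2 t h

/-- The distance by which the second factor of a product is translated. -/
noncomputable def shift (D K : LongVirtualDiagram) : ℝ := D.radius + K.radius + 2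

/-- `D`, followed by a translate of `K` that is placed to the right of `D`. -/
noncomputable def prodCurve (D K : LongVirtualDiagram) (t : ℝ) : ℂ :=
  if t < D.radius + 1 then D.curve t else K.curve (t - shift D K) + shift D K

noncomputable def prodRole (D K : LongVirtualDiagram) (t : ℝ) : Role :=
  if t < D.radius + 1 then D.role t else K.role (t - shift D K)

theorem prodCurve_left (D K : LongVirtualDiagram) {t : ℝ} (ht : t < D.radius + 2) :
    prodCurve D K t = D.curve t := by
  unfold prodCurve
  split_ifs with h
  · rfl
  · have hD := D.radius_pos
    rw [D.curve_eq t (Or.inl (lt_of_lt_of_le (by linarith) (le_abs_self t))),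
      K.curve_eq _ (Or.inl (lt_of_lt_of_le (by unfold shift; linarith) (neg_le_abs _)))]
    push_cast; ring

theorem prodCurve_right (D K : LongVirtualDiagram) {t : ℝ} (ht : D.radius < t) :
    prodCurve D K t = K.curve (t - shift D K) + shift D K := by
  unfold prodCurve
  split_ifs with h
  · have hD := D.radius_pos
    rw [D.curve_eq t (Or.inl (lt_of_lt_of_le (by linarith) (le_abs_self t))),
      K.curve_eq _ (Or.inl (lt_of_lt_of_le (by unfold shift; linarith) (neg_le_abs _)))]
    push_cast; ring
  · rfl

theorem prodCurve_eventuallyEq_left (D K : LongVirtualDiagram) {t : ℝ} (ht : t < D.radius + 2) :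
    prodCurve D K =ᶠ[𝓝 t] D.curve := by
  filter_upwards [Iio_mem_nhds ht] with x hx using prodCurve_left D K hx

theorem prodCurve_eventuallyEq_right (D K : LongVirtualDiagram) {t : ℝ} (ht : D.radius < t) :
    prodCurve D K =ᶠ[𝓝 t] fun t => K.curve (t - shift D K) + shift D K := by
  filter_upwards [Ioi_mem_nhds ht] with x hx using prodCurve_right D K hx

theorem deriv_prodCurve_left (D K : LongVirtualDiagram) {t : ℝ} (ht : t < D.radius + 2) :
    deriv (prodCurve D K) t = deriv D.curve t :=
  (prodCurve_eventuallyEq_left D K ht).deriv_eq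

theorem deriv_prodCurve_right (D K : LongVirtualDiagram) {t : ℝ} (ht : D.radius < t) :
    deriv (prodCurve D K) t = deriv K.curve (t - shift D K) := by
  rw [(prodCurve_eventuallyEq_right D K ht).deriv_eq, deriv_add_const,
    deriv_comp_sub_const (f := K.curve)]

theorem prodCurve_re_le (D K : LongVirtualDiagram) {t : ℝ} (ht : t ≤ D.radius) :
    (prodCurve D K t).re ≤ D.radius := by
  rw [prodCurve_left D K (by linarith)]
  by_cases h : D.radius < ‖D.curve t‖
  · rw [D.curve_eq t (Or.inr h)]; simpa using ht
  · exact (Complex.re_le_norm _).trans (not_lt.1 h)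

theorem le_prodCurve_re (D K : LongVirtualDiagram) {t : ℝ} (ht : D.radius + 2 ≤ t) :
    D.radius + 2 ≤ (prodCurve D K t).re := by
  rw [prodCurve_right D K (by linarith)]
  by_cases h : K.radius < ‖K.curve (t - shift D K)‖
  · rw [K.curve_eq _ (Or.inr h)]; simpa using ht
  · have := (abs_le.1 ((Complex.abs_re_le_norm _).trans (not_lt.1 h))).1
    simp only [Complex.add_re, Complex.ofReal_re]
    unfold shift at *
    linarith

/-- The crossings of a product are those of its factors. -/
theorem prodCurve_separated (D K : LongVirtualDiagram) {a b : ℝ}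
    (h : prodCurve D K a = prodCurve D K b) :
    (a < D.radius + 2 ∧ b < D.radius + 2) ∨ (D.radius < a ∧ D.radius < b) := by
  have key : ∀ x y, prodCurve D K x = prodCurve D K y → x ≤ D.radius → y < D.radius + 2 := by
    intro x y hxy hx
    by_contra! hy
    have h1 := prodCurve_re_le D K hx
    have h2 := le_prodCurve_re D K hy
    rw [hxy] at h1
    linarith
  by_cases ha : a ≤ D.radius
  · exact Or.inl ⟨by linarith, key a b h ha⟩
  · by_cases hb : b ≤ D.radius
    · exact Or.inl ⟨key b a h.symm hb, by linarith⟩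
    · exact Or.inr ⟨not_le.1 ha, not_le.1 hb⟩

/-- The product of long virtual diagrams: `K` is placed to the right of `D`. -/
noncomputable def prod (D K : LongVirtualDiagram) : LongVirtualDiagram where
  curve := prodCurve D K
  role := prodRole D K
  smooth := by
    refine contDiff_iff_contDiffAt.2 fun t => ?_
    by_cases h : t < D.radius + 2
    · exact D.smooth.contDiffAt.congr_of_eventuallyEq (prodCurve_eventuallyEq_left D K h)
    · refine ContDiffAt.congr_of_eventuallyEq ?_
        (prodCurve_eventuallyEq_right D K (by linarith))
      exact ((K.smooth.comp (contDiff_id.sub contDiff_const)).add contDiff_const).contDiffAt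
  immersed t := by
    by_cases h : t < D.radius + 2
    · rw [deriv_prodCurve_left D K h]; exact D.immersed t
    · rw [deriv_prodCurve_right D K (by linarith)]; exact K.immersed _
  standard := by
    have hD := D.radius_pos
    have hK := K.radius_pos
    have hs : 0 < shift D K := by unfold shift; linarith
    refine ⟨shift D K + K.radius, fun t ht => ?_⟩
    by_cases h : t < D.radius + 2
    · rw [prodCurve_left D K h] at ht ⊢
      refine D.curve_eq t (ht.imp (fun h => ?_) (fun h => ?_)) <;>
      · unfold shift at h; linarith
    · rw [prodCurve_right D K (by linarith)] at ht ⊢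
      rw [K.curve_eq _ (ht.imp (fun h => ?_) (fun h => ?_))]
      · push_cast; ring
      · have := abs_sub_abs_le_abs_sub t (shift D K)
        rw [abs_of_pos hs] at this
        linarith
      · have := norm_add_le (K.curve (t - shift D K)) (shift D K)
        rw [Complex.norm_real, Real.norm_eq_abs, abs_of_pos hs] at this
        linarith
  double a b c hab hbc := by
    have hac := hab.trans hbc
    by_cases hl : a < D.radius + 2 ∧ b < D.radius + 2 ∧ c < D.radius + 2
    · rw [prodCurve_left D K hl.1, prodCurve_left D K hl.2.1] at hab
      rw [prodCurve_left D K hl.2.1, prodCurve_left D K hl.2.2] at hbc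
      exact D.double a b c hab hbc
    · have hr : D.radius < a ∧ D.radius < b ∧ D.radius < c := by
        have h1 := prodCurve_separated D K hab
        have h2 := prodCurve_separated D K hbc
        have h3 := prodCurve_separated D K hac
        tauto
      rw [prodCurve_right D K hr.1, prodCurve_right D K hr.2.1] at hab
      rw [prodCurve_right D K hr.2.1, prodCurve_right D K hr.2.2] at hbc
      have := K.double _ _ _ (add_right_cancel hab) (add_right_cancel hbc)
      simpa using this
  transverse a b hne hab := by
    rcases prodCurve_separated D K hab with h | h
    · rw [deriv_prodCurve_left D K h.1, deriv_prodCurve_left D K h.2]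
      rw [prodCurve_left D K h.1, prodCurve_left D K h.2] at hab
      exact D.transverse a b hne hab
    · rw [deriv_prodCurve_right D K h.1, deriv_prodCurve_right D K h.2]
      rw [prodCurve_right D K h.1, prodCurve_right D K h.2] at hab
      exact K.transverse _ _ (by simpa using hne) (add_right_cancel hab)
  role_swap a b hne hab := by
    rcases prodCurve_separated D K hab with h | h
    · rw [prodCurve_left D K h.1, prodCurve_left D K h.2] at hab
      have h1 := le_of_abs_le (abs_le_of_crossing D.curve_eq hne hab)
      have h2 := le_of_abs_le (abs_le_of_crossing D.curve_eq hne.symm hab.symm)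
      unfold prodRole
      rw [if_pos (by linarith), if_pos (by linarith)]
      exact D.role_swap a b hne hab
    · rw [prodCurve_right D K h.1, prodCurve_right D K h.2] at hab
      have hab' := add_right_cancel hab
      have hne' : a - shift D K ≠ b - shift D K := by simpa using hne
      have h1 := neg_le_of_abs_le (abs_le_of_crossing K.curve_eq hne' hab')
      have h2 := neg_le_of_abs_le (abs_le_of_crossing K.curve_eq hne'.symm hab'.symm)
      unfold prodRole
      have hs : shift D K = D.radius + K.radius + 2 := rfl
      rw [if_neg (by linarith), if_neg (by linarith)]
      exact K.role_swap _ _ hne' hab'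

noncomputable instance : Mul LongVirtualDiagram := ⟨prod⟩

end LongVirtualDiagram

/-! Let a value run along the line. A virtual crossing multiplies it by `s` or `s⁻¹`, the overpass
of a crossing `l` records it as an unknown `x_l`, and the underpass of `l`, of weight `t`, turns a
value `v` into `t v + (1 - t) x_l`. Demanding that every recorded value equal its unknown, and that
the final value equal the initial one, gives a square linear system. Its determinant (`wordDet`,
`lineDet`, `zdet`) is `ζ` as soon as there is an underpass: a larger system also contains the values
behind the underpasses, and eliminating either family of unknowns leaves one of the two matrices
(`det_mul_eq_of_eliminate`, `lineDet_eq_zetaOf`). The new system is local: a word acts by a product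
in the monoid `Block`, a move alters a few factors, and the determinants are compared by rank-one
updates or changes of unknowns.

Invariance (`lineDet_move`). A second move cancels because its two weights are mutually inverse. A
mixed third move rescales one unknown by `s` or `s⁻¹`. A classical third move substitutes one
unknown and needs `(1 - z)(x - y) = 0` or `(1 - z)(x y - 1) = 0` for the three weights; this follows
from the relations of `T`, by which `p - 1` and `q - 1` kill `p - q`. Only a curl may contribute a
factor, and this is a unit of `T`. Hence the vanishing of each coefficient in `s` depends only on
the equivalence class (`Equivalent.coeff_ne_zero_iff`).

Upper bound (`degree_lineDet_le`). The entries in the column of a long arc have degree at most the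
number of left-to-right virtual passages on it. Each virtual crossing is passed once from left to
right, so the degree is at most the number of virtual crossings.

Product (`lineDet_append`). Adding a constant to all values preserves the equations of a classical
`K`. Measuring the unknowns of `K` relative to the value that enters `K` decouples the two systems,
and the determinant of `D * K` is that of `D` times some `d` in `T`. At `p = q = 1` the factor `d`
becomes `1`, and such an element is not a zero divisor (`eq_zero_of_mul_eq_zero`): modulo `p - q`
the ring is a domain, and on the ideal of `p - q` it acts through its value at `p = q = 1`.

Hence the coefficient of `ζ(D)` at the number of virtual crossings survives in `D * K` and in every
equivalent diagram, which must then have at least as many virtual crossings. -/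

set_option linter.unusedSectionVars false

/-! ### Affine blocks -/

namespace LongVirtual

open Matrix

/-- The effect of a piece of a curve on a running value, which is a linear form in the unknowns
`ι`: the value `v` becomes `k • v + d`, and meanwhile multiples of the value are recorded in the
rows of a matrix, to which `r ⊗ v + c` is added. -/
@[ext]
structure Block (ι R : Type*) where
  k : R
  d : ι → R
  r : ι → R
  c : Matrix ι ι R

namespace Block

variable {ι R : Type*} [CommRing R]

/-- The product of `a` and `b` is the effect of `a`, followed by `b`. -/
instance : Mul (Block ι R) :=
  ⟨fun a b => ⟨b.k * a.k, b.k • a.d + b.d, a.r + a.k • b.r, a.c + vecMulVec b.r a.d + b.c⟩⟩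

instance : One (Block ι R) := ⟨⟨1, 0, 0, 0⟩⟩

@[simp] theorem mul_k (a b : Block ι R) : (a * b).k = b.k * a.k := rfl
@[simp] theorem mul_d (a b : Block ι R) : (a * b).d = b.k • a.d + b.d := rfl
@[simp] theorem mul_r (a b : Block ι R) : (a * b).r = a.r + a.k • b.r := rfl
@[simp] theorem mul_c (a b : Block ι R) : (a * b).c = a.c + vecMulVec b.r a.d + b.c := rfl
@[simp] theorem one_k : (1 : Block ι R).k = 1 := rfl
@[simp] theorem one_d : (1 : Block ι R).d = 0 := rfl
@[simp] theorem one_r : (1 : Block ι R).r = 0 := rfl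
@[simp] theorem one_c : (1 : Block ι R).c = 0 := rfl

instance : Monoid (Block ι R) where
  mul_assoc a b c := by
    ext <;> simp [vecMulVec_apply] <;> ring
  one_mul a := by ext <;> simp
  mul_one a := by ext <;> simp

variable [DecidableEq ι]

/-- The value behind the block, if the value in front of it is the unknown `o`. -/
def out (a : Block ι R) (o : ι) : ι → R := a.k • Pi.single o 1 + a.d

/-- How the final matrix depends on the value in front of the block. -/
def inn (a : Block ι R) (o : ι) : ι → R := a.r + a.k • Pi.single o 1

/-- The recorded matrix, if the value in front of the block is the unknown `o`; the value
behind the block is recorded in the row `o`. -/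
def obs (a : Block ι R) (o : ι) : Matrix ι ι R :=
  vecMulVec a.r (Pi.single o 1) + a.c + vecMulVec (Pi.single o 1) (a.out o)

/-- Apart from what `b` itself records, its insertion is felt only through the change `(k - 1) v +
d` of the passing value `v`, which everything behind it reads with the coefficients `c.inn o`. This
turns local moves into rank-one updates. -/
theorem obs_mul_mul (a b c : Block ι R) (o : ι) :
    (a * b * c).obs o = (a * c).obs o + vecMulVec b.r (a.out o) + b.c
      + vecMulVec (c.inn o) ((b.k - 1) • a.out o + b.d) := by
  ext i j
  simp [obs, out, inn, vecMulVec_apply]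
  ring

variable [Fintype ι]

/-- Change of coordinates. -/
def conj (U P : Matrix ι ι R) (a : Block ι R) : Block ι R :=
  ⟨a.k, a.d ᵥ* P, U *ᵥ a.r, U * a.c * P⟩

theorem conj_mul (U P : Matrix ι ι R) (a b : Block ι R) :
    conj U P (a * b) = conj U P a * conj U P b := by
  ext1
  · rfl
  · simp [conj, add_vecMul, smul_vecMul]
  · simp [conj, mulVec_add, mulVec_smul]
  · simp [conj, mul_add, add_mul, mul_vecMulVec, vecMulVec_mul]

/-- The unknown `o` has to stay fixed because the initial value is fed in through it and the final
value is recorded in its row. -/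
theorem obs_conj {U P : Matrix ι ι R} {o : ι} (hP : Pi.single o 1 ᵥ* P = Pi.single o 1)
    (hU : U *ᵥ Pi.single o 1 = Pi.single o 1) (a : Block ι R) :
    (conj U P a).obs o = U * a.obs o * P := by
  simp [obs, out, conj, mul_add, add_mul, mul_vecMulVec, vecMulVec_mul, hP, hU, vecMulVec_add,
    vecMulVec_smul]

end Block

/-! ### Determinants of rank-one updates -/

section Rank

variable {ι R : Type*} [CommRing R] [DecidableEq ι] [Fintype ι]

theorem det_one_sub_vecMulVec (u v : ι → R) : (1 - vecMulVec u v).det = 1 - v ⬝ᵥ u := by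
  have h := det_one_add_replicateCol_mul_replicateRow (ι := Unit) (-u) v
  rw [← vecMulVec_eq, neg_vecMulVec, ← sub_eq_add_neg] at h
  rw [h]; simp [sub_eq_add_neg]

/-- Here `N - u ⊗ (w N)` factors as `(1 - u ⊗ w) N`, so no inverse of `N` is needed and `N` may be
singular. -/
theorem det_sub_vecMulVec_left {N : Matrix ι ι R} {u v w : ι → R} (hN : w ᵥ* N = v) :
    (N - vecMulVec u v).det = (1 - w ⬝ᵥ u) * N.det := by
  rw [← det_one_sub_vecMulVec, ← det_mul, sub_mul, one_mul, vecMulVec_mul, hN]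

theorem det_sub_vecMulVec_right {N : Matrix ι ι R} {u v w : ι → R} (hN : N *ᵥ w = u) :
    (N - vecMulVec u v).det = (1 - v ⬝ᵥ w) * N.det := by
  rw [← det_one_sub_vecMulVec, mul_comm, ← det_mul, mul_sub, mul_one, mul_vecMulVec, hN]

end Rank

/-! ### The block of a sequence of passages -/

section Word

variable {α R : Type*} [CommRing R] [DecidableEq α]

/-- The unknown `none` is the initial value, and the unknown `some l` is the value on the overpass
of `l`. Behind an underpass of `l`, the value `v` becomes `τ l * v + (1 - τ l) * l`, and behind
a virtual crossing it becomes `s * v` or `s⁻¹ * v`. -/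
def passageBlock (τ : α → Rˣ) (s : Rˣ) (x : Passage α) : Block (Option α) R :=
  match x.role with
  | .over => ⟨1, 0, Pi.single (some x.label) 1, 0⟩
  | .under => ⟨τ x.label, (1 - (τ x.label : R)) • Pi.single (some x.label) 1, 0, 0⟩
  | .virt => ⟨if x.ltr then (s : R) else (s⁻¹ : Rˣ), 0, 0, 0⟩

def wordBlock (τ : α → Rˣ) (s : Rˣ) (w : List (Passage α)) : Block (Option α) R :=
  (w.map (passageBlock τ s)).prod

variable (τ : α → Rˣ) (s : Rˣ)

@[simp] theorem wordBlock_nil : wordBlock τ s [] = 1 := rfl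

@[simp] theorem wordBlock_cons (x : Passage α) (w : List (Passage α)) :
    wordBlock τ s (x :: w) = passageBlock τ s x * wordBlock τ s w := by
  simp [wordBlock]

@[simp] theorem wordBlock_append (v w : List (Passage α)) :
    wordBlock τ s (v ++ w) = wordBlock τ s v * wordBlock τ s w := by
  simp [wordBlock]

/-- The label `l` does not occur. -/
def Avoids (w : List (Passage α)) (l : α) : Prop := ∀ x ∈ w, x.label ≠ l

/-- The unknown `i` does not occur. -/
structure Block.Free {ι R : Type*} [CommRing R] (b : Block ι R) (i : ι) : Prop where
  d : b.d i = 0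
  r : b.r i = 0
  c_left : ∀ j, b.c i j = 0
  c_right : ∀ j, b.c j i = 0

theorem Block.Free.mul {ι R : Type*} [CommRing R] {a b : Block ι R} {i : ι} (ha : a.Free i)
    (hb : b.Free i) : (a * b).Free i :=
  ⟨by simp [ha.d, hb.d], by simp [ha.r, hb.r],
    fun j => by simp [ha.c_left, hb.c_left, hb.r, vecMulVec_apply],
    fun j => by simp [ha.c_right, hb.c_right, ha.d, vecMulVec_apply]⟩

theorem free_passageBlock {x : Passage α} {l : α} (h : x.label ≠ l) :
    (passageBlock τ s x).Free (some l) := by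
  unfold passageBlock
  split <;> constructor <;> simp [h.symm]

theorem free_wordBlock {w : List (Passage α)} {l : α} (h : Avoids w l) :
    (wordBlock τ s w).Free (some l) := by
  induction w with
  | nil => constructor <;> simp
  | cons x w ih =>
    rw [wordBlock_cons]
    exact (free_passageBlock τ s (h x (by simp))).mul
      (ih fun y hy => h y (List.mem_cons_of_mem _ hy))

/-- A passage through a virtual crossing only scales the value. -/
theorem passageBlock_virt {x : Passage α} (h : x.role = .virt) :
    passageBlock τ s x = ⟨if x.ltr then (s : R) else (s⁻¹ : Rˣ), 0, 0, 0⟩ := by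
  simp [passageBlock, h]

theorem passageBlock_over {x : Passage α} (h : x.role = .over) :
    passageBlock τ s x = ⟨1, 0, Pi.single (some x.label) 1, 0⟩ := by
  simp [passageBlock, h]

theorem passageBlock_under {x : Passage α} (h : x.role = .under) :
    passageBlock τ s x
      = ⟨τ x.label, (1 - (τ x.label : R)) • Pi.single (some x.label) 1, 0, 0⟩ := by
  simp [passageBlock, h]

end Word

end LongVirtual

/-! ### Invariance under the moves -/

namespace LongVirtual

open Matrix

namespace Block

variable {ι R : Type*} [CommRing R] [DecidableEq ι]

theorem Free.out_eq {b : Block ι R} {i o : ι} (h : b.Free i) (hi : i ≠ o) : b.out o i = 0 := by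
  simp [out, h.d, hi]

theorem Free.inn_eq {b : Block ι R} {i o : ι} (h : b.Free i) (hi : i ≠ o) : b.inn o i = 0 := by
  simp [inn, h.r, hi]

theorem Free.obs_left {b : Block ι R} {i o : ι} (h : b.Free i) (hi : i ≠ o) (j : ι) :
    b.obs o i j = 0 := by
  simp [obs, vecMulVec_apply, h.r, h.c_left, hi]

theorem Free.obs_right {b : Block ι R} {i o : ι} (h : b.Free i) (hi : i ≠ o) (j : ι) :
    b.obs o j i = 0 := by
  simp [obs, vecMulVec_apply, h.out_eq hi, h.c_right, hi]

variable [Fintype ι]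

/-- The matrix of the linear system. -/
def mat (b : Block ι R) (o : ι) : Matrix ι ι R := 1 - b.obs o

theorem Free.single_vecMul {b : Block ι R} {i o : ι} (h : b.Free i) (hi : i ≠ o) :
    Pi.single i 1 ᵥ* b.mat o = Pi.single i 1 := by
  ext j
  simp [mat, h.obs_left hi, one_apply, Pi.single_apply, eq_comm]

theorem Free.mulVec_single {b : Block ι R} {i o : ι} (h : b.Free i) (hi : i ≠ o) :
    b.mat o *ᵥ Pi.single i 1 = Pi.single i 1 := by
  ext j
  simp [mat, h.obs_right hi, one_apply, Pi.single_apply]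

/-- The determinant behind the removal of a classical curl. -/
theorem det_curl {N : Matrix ι ι R} {i : ι} {v c : ι → R}
    (h₁ : Pi.single i 1 ᵥ* N = Pi.single i 1) (h₂ : N *ᵥ Pi.single i 1 = Pi.single i 1)
    (hv : v i = 0) :
    (N - vecMulVec (Pi.single i 1) v - vecMulVec c (Pi.single i 1 - v)).det
      = (1 - c i) * N.det := by
  -- After the update by `v`, row `i` is `e_i - v`, so the other update subtracts a multiple of this
  -- row and gives `1 - c i`. The update by `v` itself gives `1`, since `v i = 0`.
  rw [det_sub_vecMulVec_left (w := Pi.single i 1), det_sub_vecMulVec_right h₂]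
  · simp [hv]
  · rw [vecMul_sub, h₁, vecMul_vecMulVec]; simp

/-- The overpass records `x_i = v`, and the underpass behind it returns `t v + (1 - t) x_i = v`; the
curl has no effect. -/
theorem det_curl_over {a b : Block ι R} {i o : ι} (ha : a.Free i) (hb : b.Free i) (hi : i ≠ o)
    (t : R) :
    ((a * ⟨t, (1 - t) • Pi.single i 1, Pi.single i 1, 0⟩ * b).mat o).det
      = ((a * b).mat o).det := by
  have h := ha.mul hb
  have := det_curl (c := (1 - t) • b.inn o) (h.single_vecMul hi) (h.mulVec_single hi)
    (ha.out_eq hi)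
  simp only [Pi.smul_apply, hb.inn_eq hi, smul_zero, sub_zero, one_mul] at this
  rw [← this, mat, obs_mul_mul]
  congr 1
  ext j k
  simp [mat, vecMulVec_apply]
  ring

/-- The recorded value is already `t v + (1 - t) x_i`. The equation of the row `i` is therefore `t
(x_i - v) = 0`, which explains the factor `t`. -/
theorem det_curl_under {a b : Block ι R} {i o : ι} (ha : a.Free i) (hb : b.Free i) (hi : i ≠ o)
    (t : R) :
    ((a * ⟨t, (1 - t) • Pi.single i 1, t • Pi.single i 1,
      (1 - t) • vecMulVec (Pi.single i 1) (Pi.single i 1)⟩ * b).mat o).det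
      = t * ((a * b).mat o).det := by
  have h := ha.mul hb
  have := det_curl (c := (1 - t) • (b.inn o + Pi.single i 1)) (h.single_vecMul hi)
    (h.mulVec_single hi) (ha.out_eq hi)
  simp only [Pi.smul_apply, Pi.add_apply, hb.inn_eq hi, Pi.single_eq_same, zero_add, smul_eq_mul,
    mul_one, sub_sub_cancel] at this
  rw [← this, mat, obs_mul_mul]
  congr 1
  ext j k
  simp [mat, vecMulVec_apply]
  ring

/-- Two overpasses may be inserted one behind the other. -/
theorem det_over_over {a b : Block ι R} {i j o : ι} (hai : a.Free i) (hbi : b.Free i)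
    (haj : a.Free j) (hbj : b.Free j) (hi : i ≠ o) (hj : j ≠ o) :
    ((a * ⟨1, 0, Pi.single i 1 + Pi.single j 1, 0⟩ * b).mat o).det = ((a * b).mat o).det := by
  have := det_sub_vecMulVec_right (N := (a * b).mat o) (w := Pi.single i 1 + Pi.single j 1)
    (u := Pi.single i 1 + Pi.single j 1) (v := a.out o)
    (by rw [mulVec_add, (hai.mul hbi).mulVec_single hi, (haj.mul hbj).mulVec_single hj])
  simp only [dotProduct_add, dotProduct_single, hai.out_eq hi, haj.out_eq hj, zero_mul, add_zero,
    sub_zero, one_mul] at this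
  rw [← this, mat, obs_mul_mul]
  congr 1
  ext k l
  simp [mat, vecMulVec_apply]
  ring

/-- Both overpasses record the same value, so the rows `i` and `j` of the recorded matrix agree.
This is the hypothesis under which `det_shift` removes the opposite underpasses. -/
theorem obs_over_over {a b : Block ι R} {i j o : ι} (hai : a.Free i) (hbi : b.Free i)
    (haj : a.Free j) (hbj : b.Free j) (hi : i ≠ o) (hj : j ≠ o) (hij : i ≠ j) :
    (Pi.single j 1 - Pi.single i 1) ᵥ* (a * ⟨1, 0, Pi.single i 1 + Pi.single j 1, 0⟩ * b).mat o
      = Pi.single j 1 - Pi.single i 1 := by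
  have h₁ := (hai.mul hbi).single_vecMul hi
  have h₂ := (haj.mul hbj).single_vecMul hj
  have : (a * ⟨1, 0, Pi.single i 1 + Pi.single j 1, 0⟩ * b).mat o
      = (a * b).mat o - vecMulVec (Pi.single i 1 + Pi.single j 1) (a.out o) := by
    rw [mat, obs_mul_mul]
    ext k l
    simp [mat, vecMulVec_apply]
    ring
  rw [this, vecMul_sub, sub_vecMul, h₁, h₂, vecMul_vecMulVec]
  simp [hij, hij.symm]

/-- Two opposite underpasses may be inserted, where the rows of the two overpasses agree. -/
theorem det_shift {a b : Block ι R} {i j o : ι} (t : R)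
    (h : (Pi.single j 1 - Pi.single i 1) ᵥ* (a * b).mat o = Pi.single j 1 - Pi.single i 1)
    (hb : b.inn o i = b.inn o j) :
    ((a * ⟨1, t • (Pi.single j 1 - Pi.single i 1), 0, 0⟩ * b).mat o).det
      = ((a * b).mat o).det := by
  have := det_sub_vecMulVec_left (u := t • b.inn o) h
  simp only [dotProduct_smul, sub_dotProduct, single_dotProduct, hb, sub_self, smul_zero, sub_zero,
    one_mul] at this
  rw [← this, mat, obs_mul_mul]
  congr 1
  ext k l
  simp [mat, vecMulVec_apply]
  ring

/-- Blocks that agree after a change of coordinates define the same determinant. -/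
theorem det_eq_of_conj {a b : Block ι R} {i o : ι} (hi : i ≠ o) {t : R} (ht : IsUnit t)
    (h : conj 1 (diagonal (Function.update 1 i t)) a
      = conj (diagonal (Function.update 1 i t)) 1 b) :
    (a.mat o).det = (b.mat o).det := by
  set P : Matrix ι ι R := diagonal (Function.update 1 i t) with hP
  have hP₁ : Pi.single o 1 ᵥ* P = Pi.single o 1 := by
    ext j; simp only [single_one_vecMul, row_apply, P, diagonal_apply]
    by_cases hj : o = j
    · subst hj; simp [hi.symm]
    · simp [hj, Ne.symm hj]
  have hP₂ : P *ᵥ Pi.single o 1 = Pi.single o 1 := by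
    ext j; simp only [mulVec_single_one, col_apply, P, diagonal_apply]
    by_cases hj : j = o
    · subst hj; simp [hi.symm]
    · simp [hj]
  have h1 := obs_conj (U := 1) hP₁ (by rw [one_mulVec]) a
  have h2 := obs_conj (P := 1) (by rw [vecMul_one]) hP₂ b
  rw [h, h2, one_mul, mul_one] at h1
  -- The diagonal matrix intertwines the two systems. Its determinant `t` appears on both sides and
  -- cancels because it is a unit.
  have h3 : a.mat o * P = P * b.mat o := by
    simp [mat, sub_mul, mul_sub, h1]
  have h4 : P.det = t := by
    rw [hP, det_diagonal, Finset.prod_update_of_mem (Finset.mem_univ _)]; simp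
  have h5 := congrArg det h3
  rw [det_mul, det_mul, h4, mul_comm] at h5
  exact ht.mul_left_cancel h5

end Block

/-! #### The third classical move -/

section Third

variable {ι R : Type*} [CommRing R] [DecidableEq ι]

/-- How the blocks in front of and behind a third move are related: `tm`, `tb` and `mb` are
the crossings of the top, the middle and the bottom branch, and `t` is the weight of `tm`. -/
structure ThirdRel (tm tb mb : ι) (t n : R) (b b' : Block ι R) : Prop where
  k : b.k = b'.k
  r : b.r = b'.r + ((t - 1) * b'.r mb) • Pi.single mb 1
  d : ∃ y : R, b.d + b.d mb • ((t - 1) • Pi.single mb 1 + (1 - t) • Pi.single tm 1)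
    = b'.d + y • (Pi.single tm 1 - Pi.single tb 1)
  c : ∃ x : ι → R, x tm = x tb ∧
    b.c + vecMulVec (fun i => b.c i mb) ((t - 1) • Pi.single mb 1 + (1 - t) • Pi.single tm 1)
      = b'.c + vecMulVec ((t - 1) • Pi.single mb 1) (b'.c mb)
        + (n * (1 - t)) • vecMulVec (Pi.single mb 1) (Pi.single tm 1)
        + vecMulVec x (Pi.single tm 1 - Pi.single tb 1)
  r_eq : b'.r tm = b'.r tb
  c_eq : b'.c tm = b'.c tb

variable {tm tb mb : ι} {t n n' : R}

/-- The relation passes to products and `n` is additive, so it has to be verified only on the three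
pairs of a third move; the unchanged pieces between them count `0`. -/
theorem ThirdRel.mul {a a' b b' : Block ι R} (hm : tm ≠ mb) (hb : tb ≠ mb)
    (ha : ThirdRel tm tb mb t n a a') (h : ThirdRel tm tb mb t n' b b') :
    ThirdRel tm tb mb t (n + n') (a * b) (a' * b') := by
  obtain ⟨ya, hya⟩ := ha.d
  obtain ⟨yb, hyb⟩ := h.d
  obtain ⟨xa, hxa, hxa'⟩ := ha.c
  obtain ⟨xb, hxb, hxb'⟩ := h.c
  have hbr : b.r tm = b.r tb := by simp [h.r, h.r_eq, hm, hb]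
  refine ⟨by simp [ha.k, h.k], ?_, ⟨b'.k * ya + yb, ?_⟩, ⟨xa + ya • b.r + xb, ?_, ?_⟩, ?_, ?_⟩
  · ext i
    simp [ha.r, h.r, ha.k]
    ring
  · ext i
    have h1 := congrFun hya i
    have h2 := congrFun hyb i
    simp only [Block.mul_d, Pi.add_apply, Pi.smul_apply, Pi.sub_apply, smul_eq_mul, h.k] at *
    linear_combination b'.k * h1 + h2
  · simp [hxa, hxb, hbr]
  · ext i j
    have h1 := congrFun hya j
    have h2 := congrFun (congrFun hxa' i) j
    have h3 := congrFun (congrFun hxb' i) j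
    have h4 := congrFun h.r i
    simp only [Block.mul_c, Matrix.add_apply, vecMulVec_apply, Pi.add_apply, Pi.smul_apply,
      Pi.sub_apply, smul_eq_mul, Matrix.smul_apply] at *
    linear_combination b.r i * h1 + h2 + h3 + a'.d j * h4
  · simp [ha.r_eq, h.r_eq]
  · ext j
    simp [congrFun ha.c_eq j, congrFun h.c_eq j, vecMulVec_apply, h.r_eq]

theorem ThirdRel.of_free {b : Block ι R} (hm : b.Free tm) (hb : b.Free tb) (h : b.Free mb) :
    ThirdRel tm tb mb t 0 b b := by
  refine ⟨rfl, by simp [h.r], ⟨0, by simp [h.d]⟩, ⟨0, rfl, ?_⟩, by rw [hm.r, hb.r], ?_⟩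
  · ext i j; simp [h.c_left, h.c_right, vecMulVec_apply]
  · ext j; rw [hm.c_left, hb.c_left]

/-- If the middle branch meets the top one before the bottom one, the value recorded at `mb` is `t
x_mb + (1 - t) x_tm` in terms of the unknowns after the move. This substitution and a scaling of the
row `mb` by `t` match the two systems up to multiples of `x_tm - x_tb`, which vanish because the top
branch records the same value at both crossings. -/
theorem ThirdRel.det_eq [Fintype ι] {b b' : Block ι R} {o : ι} (hmo : tm ≠ o) (hbo : tb ≠ o)
    (ho : mb ≠ o) (hm : tm ≠ mb) (hb : tb ≠ mb) (ht : IsUnit t)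
    (h : ThirdRel tm tb mb t 1 b b') : (b.mat o).det = (b'.mat o).det := by
  obtain ⟨y, hy⟩ := h.d
  obtain ⟨x, hx, hx'⟩ := h.c
  -- `P` substitutes `t x_mb + (1 - t) x_tm` for `x_mb`, and `U` multiplies the row `mb` by `t`.
  -- Both have determinant `t`, which cancels at the end.
  set P : Matrix ι ι R := 1 - vecMulVec (Pi.single mb 1)
    (-((t - 1) • Pi.single mb 1 + (1 - t) • Pi.single tm 1)) with hP
  set U : Matrix ι ι R := 1 - vecMulVec ((1 - t) • Pi.single mb 1) (Pi.single mb 1) with hU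
  have hPd : P.det = t := by
    rw [det_one_sub_vecMulVec]
    simp [hm.symm]
  have hUd : U.det = t := by
    rw [det_one_sub_vecMulVec]
    simp
  have key : b.mat o * P = U * b'.mat o
      - vecMulVec (x + y • Pi.single o 1) (Pi.single tm 1 - Pi.single tb 1) := by
    rw [hP, hU, mul_sub, mul_vecMulVec, sub_mul, vecMulVec_mul]
    ext i j
    have h1 := congrFun hy j
    have h2 := congrFun (congrFun hx' i) j
    have h4 := congrFun h.r i
    simp only [Block.mat, Block.obs, Block.out, Matrix.add_apply, Matrix.sub_apply,
      vecMulVec_apply, Pi.add_apply, Pi.smul_apply, Pi.neg_apply, mulVec_single_one, col_apply,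
      single_one_vecMul, row_apply,
      Pi.sub_apply, smul_eq_mul, Matrix.smul_apply, mul_one, one_mul, h.k, one_apply,
      Pi.single_eq_of_ne ho, mul_zero, add_zero, zero_mul, zero_add] at *
    have e1 : (if i = mb then (1 : R) else 0) = (Pi.single mb 1 : ι → R) i := by
      simp [Pi.single_apply]
    have e2 : (if mb = j then (1 : R) else 0) = (Pi.single mb 1 : ι → R) j := by
      simp [Pi.single_apply, eq_comm]
    rw [e1, e2]
    linear_combination -(Pi.single o 1 : ι → R) i * h1 - h2 - (Pi.single o 1 : ι → R) j * h4
  have h5 := congrArg det key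
  -- Rows `tm` and `tb` of the recorded matrix agree, so `e_tm - e_tb` is fixed under multiplication
  -- from the left. It pairs to zero with `x + y e_o`, and the rank-one error does not change the
  -- determinant.
  have hrow : (Pi.single tm 1 - Pi.single tb 1) ᵥ* (U * b'.mat o)
      = Pi.single tm 1 - Pi.single tb 1 := by
    rw [hU, sub_mul, vecMulVec_mul, vecMul_sub, vecMul_vecMulVec]
    ext j
    simp [sub_vecMul, Block.mat, Block.obs, vecMulVec_apply, hm, hb, hmo, hbo, h.r_eq,
      congrFun h.c_eq j, one_apply, Pi.single_apply, eq_comm]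
  rw [det_sub_vecMulVec_left hrow, det_mul, det_mul, hPd, hUd] at h5
  simp only [sub_dotProduct, single_dotProduct, Pi.add_apply, Pi.smul_apply,
    Pi.single_eq_of_ne hmo, Pi.single_eq_of_ne hbo, hx, sub_self, sub_zero, one_mul] at h5
  rw [mul_comm] at h5
  exact ht.mul_left_cancel h5

theorem ThirdRel.top (hm : tm ≠ mb) (hb : tb ≠ mb) (hmb : tm ≠ tb) :
    ThirdRel tm tb mb t 0 ⟨1, 0, Pi.single tm 1 + Pi.single tb 1, 0⟩
      ⟨1, 0, Pi.single tm 1 + Pi.single tb 1, 0⟩ := by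
  refine ⟨rfl, by simp [hm.symm, hb.symm], ⟨0, by simp⟩, ⟨0, rfl, ?_⟩, ?_, rfl⟩
  · ext i j; simp [vecMulVec_apply]
  · simp [hmb, hmb.symm]

/-- This is the only branch with `n = 1`: the value recorded at `mb` changes from `t v + (1 - t)
x_tm` to `v`, and the extra term `(1 - t) x_tm` in the row `mb` is balanced by the identity part of
the substitution. -/
theorem ThirdRel.mid (hm : tm ≠ mb) (hb : tb ≠ mb) :
    ThirdRel tm tb mb t 1
      (⟨t, (1 - t) • Pi.single tm 1, 0, 0⟩ * ⟨1, 0, Pi.single mb 1, 0⟩)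
      (⟨1, 0, Pi.single mb 1, 0⟩ * ⟨t, (1 - t) • Pi.single tm 1, 0, 0⟩) := by
  refine ⟨by simp, ?_, ⟨0, by simp [hm.symm]⟩, ⟨0, rfl, ?_⟩, by simp [hm, hb], rfl⟩
  · ext i; simp; ring
  · ext i j; simp [vecMulVec_apply, hm.symm]

/-- Exchanging the underpasses of the bottom branch changes the outgoing value by a combination of
`x_tb`, `x_mb` and, through the substitution, `x_tm`. The relation between the weights reduces it to
a multiple of `x_tm - x_tb`. -/
theorem ThirdRel.bot (hb : tb ≠ mb) {t₂ t₃ : R} (h : (1 - t₃) * (t - t₂) = 0) :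
    ThirdRel tm tb mb t 0
      (⟨t₂, (1 - t₂) • Pi.single tb 1, 0, 0⟩ * ⟨t₃, (1 - t₃) • Pi.single mb 1, 0, 0⟩)
      (⟨t₃, (1 - t₃) • Pi.single mb 1, 0, 0⟩ * ⟨t₂, (1 - t₂) • Pi.single tb 1, 0, 0⟩) := by
  refine ⟨by simp [mul_comm], by simp, ⟨(1 - t₃) * (1 - t), ?_⟩, ⟨0, rfl, ?_⟩, rfl, by simp; rfl⟩
  · ext i; simp [hb.symm]
    linear_combination (Pi.single mb 1 : ι → R) i * h - (Pi.single tb 1 : ι → R) i * h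
  · ext i j; simp [vecMulVec_apply]

theorem ThirdRel.bot' (hb : tb ≠ mb) {t₂ t₃ : R} (h : (1 - t₃) * (t * t₂ - 1) = 0) :
    ThirdRel tm tb mb t 0
      (⟨t₃, (1 - t₃) • Pi.single mb 1, 0, 0⟩ * ⟨t₂, (1 - t₂) • Pi.single tb 1, 0, 0⟩)
      (⟨t₂, (1 - t₂) • Pi.single tb 1, 0, 0⟩ * ⟨t₃, (1 - t₃) • Pi.single mb 1, 0, 0⟩) := by
  refine ⟨by simp [mul_comm], by simp, ⟨t₂ * (1 - t₃) * (1 - t), ?_⟩, ⟨0, rfl, ?_⟩, rfl,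
    by simp; rfl⟩
  · ext i; simp [hb.symm]
    linear_combination (Pi.single mb 1 : ι → R) i * h - (Pi.single tb 1 : ι → R) i * h
  · ext i j; simp [vecMulVec_apply]

end Third

end LongVirtual

namespace LongVirtual

open Matrix

@[simp] theorem Passage.partner_label {α : Type*} (x : Passage α) : x.partner.label = x.label := rfl
@[simp] theorem Passage.partner_role {α : Type*} (x : Passage α) : x.partner.role = x.role.swap := rfl
@[simp] theorem Passage.partner_ltr {α : Type*} (x : Passage α) : x.partner.ltr = !x.ltr := rfl

/-- The sign of the crossing. -/
def Passage.pos {α : Type*} (x : Passage α) : Bool :=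
  match x.role with
  | .over => x.ltr
  | _ => !x.ltr

/-! ### First and second moves, and virtual branches -/

section Moves

variable {α R : Type*} [CommRing R] [DecidableEq α] [Fintype α] (τ : α → Rˣ) (s : Rˣ)

/-- The determinant of the linear system that is defined by a sequence of passages. -/
def wordDet (w : List (Passage α)) : R := ((wordBlock τ s w).mat none).det

theorem wordDet_first (A B : List (Passage α)) (x : Passage α) (hA : Avoids A x.label)
    (hB : Avoids B x.label) :
    wordDet τ s (A ++ [x, x.partner] ++ B) = wordDet τ s (A ++ B) ∨
      wordDet τ s (A ++ [x, x.partner] ++ B) = τ x.label * wordDet τ s (A ++ B) := by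
  have hA := free_wordBlock τ s hA
  have hB := free_wordBlock τ s hB
  simp only [wordDet, wordBlock_append, wordBlock_cons, wordBlock_nil, mul_one]
  rcases hx : x.role with _ | _ | _
  · left
    rw [passageBlock_over τ s hx, passageBlock_under τ s (by simp [hx, Role.swap]),
      ← Block.det_curl_over hA hB (by simp) (τ x.label : R)]
    congr 4
    ext <;> simp
  · right
    rw [passageBlock_under τ s hx, passageBlock_over τ s (by simp [hx, Role.swap]),
      ← Block.det_curl_under hA hB (by simp) (τ x.label : R)]
    congr 4
    ext <;> simp [vecMulVec_apply]
  · left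
    rw [passageBlock_virt τ s hx, passageBlock_virt τ s (by simp [hx, Role.swap])]
    congr 3
    convert mul_one _ using 2
    cases hl : x.ltr <;> ext <;> simp [hl]

theorem wordBlock_pair_over {x y : Passage α} (o : Bool) (hx : x.role = .over)
    (hy : y.role = .over) :
    wordBlock τ s (pair o x y)
      = ⟨1, 0, Pi.single (some x.label) 1 + Pi.single (some y.label) 1, 0⟩ := by
  cases o <;> simp [pair, passageBlock_over τ s, hx, hy] <;>
    ext <;> simp [add_comm]

/-- Each underpass forms a combination whose coefficients have sum `1`. As the inverse weights give
the incoming value the total coefficient `1`, the coefficients of the two unknowns are opposite. -/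
theorem wordBlock_pair_under {x y : Passage α} (o : Bool) (hx : x.role = .under)
    (hy : y.role = .under) (hτ : τ x.label * τ y.label = 1) :
    ∃ t : R, wordBlock τ s (pair o x y)
      = ⟨1, t • (Pi.single (some y.label) 1 - Pi.single (some x.label) 1), 0, 0⟩ := by
  have hτ' : (τ x.label : R) * τ y.label = 1 := by rw [← Units.val_mul, hτ, Units.val_one]
  have hx' := passageBlock_under τ s hx
  have hy' := passageBlock_under τ s hy
  cases o
  · refine ⟨τ x.label - 1, ?_⟩
    apply Block.ext
    · simp [pair, hx', hy', hτ']
    · ext i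
      simp [pair, hx', hy']
      linear_combination -(Pi.single (some y.label) 1 : Option α → R) i * hτ'
    · simp [pair, hx', hy']
    · simp [pair, hx', hy']
  · refine ⟨1 - τ y.label, ?_⟩
    apply Block.ext
    · simp [pair, hx', hy', mul_comm, hτ']
    · ext i
      simp [pair, hx', hy']
      linear_combination -(Pi.single (some x.label) 1 : Option α → R) i * hτ'
    · simp [pair, hx', hy']
    · simp [pair, hx', hy']

/-- In the classical cases the overpasses force the two unknowns to agree, and the underpasses
change the value only by a multiple of their difference. In the virtual case the factors `s` and
`s⁻¹` cancel on each branch. -/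
theorem wordDet_second (A B C : List (Passage α)) (x y : Passage α) (o : Bool)
    (hrole : x.role = y.role) (hside : x.ltr = !y.ltr) (hxy : x.label ≠ y.label)
    (hτ : x.role ≠ .virt → τ x.label * τ y.label = 1)
    (hAx : Avoids A x.label) (hBx : Avoids B x.label) (hCx : Avoids C x.label)
    (hAy : Avoids A y.label) (hBy : Avoids B y.label) (hCy : Avoids C y.label) :
    wordDet τ s (A ++ [x, y] ++ B ++ pair o x.partner y.partner ++ C)
      = wordDet τ s (A ++ B ++ C) := by
  have hAx := free_wordBlock τ s hAx
  have hBx := free_wordBlock τ s hBx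
  have hCx := free_wordBlock τ s hCx
  have hAy := free_wordBlock τ s hAy
  have hBy := free_wordBlock τ s hBy
  have hCy := free_wordBlock τ s hCy
  have hxy' : (some x.label : Option α) ≠ some y.label := by simpa using hxy
  have hpair : ([x, y] : List (Passage α)) = pair true x y := rfl
  simp only [wordDet, wordBlock_append]
  rcases hx : x.role with _ | _ | _
  · obtain ⟨t, ht⟩ := wordBlock_pair_under τ s o (x := x.partner) (y := y.partner)
      (by simp [hx, Role.swap]) (by simp [← hrole, hx, Role.swap]) (hτ (by simp [hx]))
    simp only [Passage.partner_label] at ht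
    -- The underpasses are removed first, while the overpasses still make the two rows agree; after
    -- that the overpasses can go.
    rw [hpair, wordBlock_pair_over τ s true hx (hrole ▸ hx), ht, Block.det_shift,
      mul_assoc (_ * _), Block.det_over_over hAx (hBx.mul hCx) hAy (hBy.mul hCy) (by simp)
      (by simp), mul_assoc]
    · rw [mul_assoc (_ * _)]
      exact Block.obs_over_over hAx (hBx.mul hCx) hAy (hBy.mul hCy) (by simp) (by simp) hxy'
    · rw [hCx.inn_eq (by simp), hCy.inn_eq (by simp)]
  · obtain ⟨t, ht⟩ := wordBlock_pair_under τ s true (x := x) (y := y)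
      hx (hrole ▸ hx) (hτ (by simp [hx]))
    have h := wordBlock_pair_over τ s o (x := x.partner) (y := y.partner)
      (by simp [hx, Role.swap]) (by simp [← hrole, hx, Role.swap])
    simp only [Passage.partner_label] at h
    rw [hpair, ht, h, mul_assoc, mul_assoc, Block.det_shift, ← mul_assoc, ← mul_assoc,
      Block.det_over_over (hAx.mul hBx) hCx (hAy.mul hBy) hCy (by simp) (by simp)]
    · rw [← mul_assoc, ← mul_assoc]
      exact Block.obs_over_over (hAx.mul hBx) hCx (hAy.mul hBy) hCy (by simp) (by simp) hxy'
    · simp [Block.inn, hBx.r, hBy.r, hCx.r, hCy.r, hxy, hxy.symm]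
  · have hy : y.role = .virt := hrole ▸ hx
    have h1 : wordBlock τ s [x, y] = 1 := by
      simp only [wordBlock_cons, wordBlock_nil, passageBlock_virt τ s hx, passageBlock_virt τ s hy,
        hside]
      cases y.ltr <;> ext <;> simp
    have h2 : wordBlock τ s (pair o x.partner y.partner) = 1 := by
      have hx' : x.partner.role = .virt := by simp [hx, Role.swap]
      have hy' : y.partner.role = .virt := by simp [hy, Role.swap]
      cases o <;> cases hl : y.ltr <;> ext <;>
        simp [pair, passageBlock_virt τ s hx', passageBlock_virt τ s hy', hside, hl]
    rw [h1, h2, mul_one, mul_one]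

/-! #### The mixed third move -/

theorem conj_free {b : Block (Option α) R} {l : α} {t : R} (h : b.Free (some l)) :
    Block.conj 1 (diagonal (Function.update 1 (some l) t)) b
      = Block.conj (diagonal (Function.update 1 (some l) t)) 1 b := by
  ext i j
  · rfl
  · by_cases hi : i = some l
    · subst hi; simp [Block.conj, vecMul_diagonal, h.d]
    · simp [Block.conj, vecMul_diagonal, hi]
  · by_cases hi : i = some l
    · subst hi; simp [Block.conj, mulVec_diagonal, h.r]
    · simp [Block.conj, mulVec_diagonal, hi]
  · simp only [Block.conj, one_mul, mul_one, mul_diagonal, diagonal_mul]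
    by_cases hi : i = some l
    · subst hi; simp [h.c_left]
    · by_cases hj : j = some l
      · subst hj; simp [h.c_right]
      · simp [hi, hj]

/-- The weight of a virtual passage. -/
def virtWeight (x : Passage α) : R := if x.ltr then (s : R) else (s⁻¹ : Rˣ)

/-- Pulling a virtual branch across a passage of `y` rescales the value seen there. For an overpass
this rescales a row, for an underpass the unknown that is read; one diagonal change of coordinates
handles both. The scale is the weight of the virtual passage if that comes first, and its inverse
otherwise. -/
theorem conj_virt_pair {x y : Passage α} (o : Bool) {t : R} (hx : x.role = .virt)
    (ht : if o then t = virtWeight s x else virtWeight s x * t = 1) :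
    Block.conj 1 (diagonal (Function.update 1 (some y.label) t))
        (wordBlock τ s (pair o x y))
      = Block.conj (diagonal (Function.update 1 (some y.label) t)) 1
        (wordBlock τ s (pair (!o) x y)) := by
  have hx' : passageBlock τ s x = ⟨virtWeight s x, 0, 0, 0⟩ := passageBlock_virt τ s hx
  generalize virtWeight s x = u at *
  set P : Matrix (Option α) (Option α) R := diagonal (Function.update 1 (some y.label) t) with hP
  have h₁ : Pi.single (some y.label) 1 ᵥ* P = t • Pi.single (some y.label) 1 := by
    ext i
    by_cases hi : i = some y.label
    · subst hi; simp only [hP, vecMul_diagonal]; simp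
    · simp only [hP, vecMul_diagonal]; simp [hi]
  have h₂ : P *ᵥ Pi.single (some y.label) 1 = t • Pi.single (some y.label) 1 := by
    ext i
    by_cases hi : i = some y.label
    · subst hi; simp only [hP, mulVec_diagonal]; simp
    · simp only [hP, mulVec_diagonal]; simp [hi]
  rcases hy : y.role with _ | _ | _
  · have hy' := passageBlock_over τ s hy
    cases o <;> simp at ht <;> apply Block.ext <;>
      simp only [pair, Bool.not_true, Bool.not_false, Bool.false_eq_true, if_true, if_false,
        Block.conj, wordBlock_cons, wordBlock_nil, mul_one, one_mul, hx', hy', Block.mul_k,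
        Block.mul_d, Block.mul_r, Block.mul_c, smul_zero, add_zero, zero_add, mulVec_smul, h₂,
        one_mulVec, vecMulVec_zero, mul_zero, zero_mul, zero_vecMul, one_smul, smul_smul, ht]
  · have hy' := passageBlock_under τ s hy
    cases o <;> simp at ht <;> apply Block.ext <;>
      simp only [pair, Bool.not_true, Bool.not_false, Bool.false_eq_true, if_true, if_false,
        Block.conj, wordBlock_cons, wordBlock_nil, mul_one, hx', hy', Block.mul_k,
        Block.mul_d, Block.mul_r, Block.mul_c, smul_zero, add_zero, zero_add, smul_vecMul, h₁,
        vecMul_one, mulVec_zero, zero_vecMulVec, vecMulVec_zero, mul_zero, zero_mul,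
        smul_smul]
    · exact mul_comm _ _
    · rw [mul_right_comm, ht, one_mul]
    · exact mul_comm _ _
    · rw [ht, mul_comm]
  · have hy' := passageBlock_virt τ s hy
    cases o <;> apply Block.ext <;>
      simp [pair, hx', hy', Block.conj, mul_comm]

theorem wordBlock_virt_pair {x y : Passage α} (o : Bool) (hx : x.role = .virt)
    (hy : y.role = .virt) :
    wordBlock τ s (pair o x y) = wordBlock τ s (pair (!o) x y) := by
  have hx' := passageBlock_virt τ s hx
  have hy' := passageBlock_virt τ s hy
  cases o <;> ext <;> simp [pair, hx', hy', mul_comm]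

theorem free_virt_pair {x y : Passage α} (o : Bool) (hx : x.role = .virt)
    (hy : y.role = .virt) (l : α) : (wordBlock τ s (pair o x y)).Free (some l) := by
  have hx' := passageBlock_virt τ s hx
  have hy' := passageBlock_virt τ s hy
  cases o <;> constructor <;> simp [pair, hx', hy']

end Moves

end LongVirtual

namespace LongVirtual

open Matrix

/-! ### The third moves, mixed and classical -/

section Moves

variable {α R : Type*} [CommRing R] [DecidableEq α] [Fintype α] (τ : α → Rˣ) (s : Rˣ)

theorem conj_virt_pair' {x y : Passage α} (o : Bool) {t : R} (hx : x.role = .virt)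
    (ht : if !o then t = virtWeight s x else virtWeight s x * t = 1) :
    Block.conj 1 (diagonal (Function.update 1 (some y.label) t))
        (wordBlock τ s (pair o y x))
      = Block.conj (diagonal (Function.update 1 (some y.label) t)) 1
        (wordBlock τ s (pair (!o) y x)) := by
  cases o
  · exact conj_virt_pair τ s true hx ht
  · exact conj_virt_pair τ s false hx ht

theorem det_of_conj_pairs {b₀ b₁ b₂ b₃ x₁ x₂ x₃ y₁ y₂ y₃ : Block (Option α) R} {l : α} {t : R}
    (ht : IsUnit t) (h₀ : b₀.Free (some l)) (h₁ : b₁.Free (some l)) (h₂ : b₂.Free (some l))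
    (h₃ : b₃.Free (some l))
    (hx₁ : Block.conj 1 (diagonal (Function.update 1 (some l) t)) x₁
      = Block.conj (diagonal (Function.update 1 (some l) t)) 1 y₁)
    (hx₂ : Block.conj 1 (diagonal (Function.update 1 (some l) t)) x₂
      = Block.conj (diagonal (Function.update 1 (some l) t)) 1 y₂)
    (hx₃ : Block.conj 1 (diagonal (Function.update 1 (some l) t)) x₃
      = Block.conj (diagonal (Function.update 1 (some l) t)) 1 y₃) :
    ((b₀ * x₁ * b₁ * x₂ * b₂ * x₃ * b₃).mat none).det
      = ((b₀ * y₁ * b₁ * y₂ * b₂ * y₃ * b₃).mat none).det := by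
  refine Block.det_eq_of_conj (i := some l) (by simp) ht ?_
  simp only [Block.conj_mul, conj_free h₀, conj_free h₁, conj_free h₂, conj_free h₃, hx₁, hx₂, hx₃]

theorem det_of_thirdRel {b₀ b₁ b₂ b₃ x₁ x₂ x₃ y₁ y₂ y₃ : Block (Option α) R} {tm tb mb : α}
    {t n₁ n₂ n₃ : R} (ht : IsUnit t) (hm : tm ≠ mb) (hb : tb ≠ mb)
    (h₀ : ∀ l ∈ [tm, tb, mb], b₀.Free (some l)) (h₁ : ∀ l ∈ [tm, tb, mb], b₁.Free (some l))
    (h₂ : ∀ l ∈ [tm, tb, mb], b₂.Free (some l)) (h₃ : ∀ l ∈ [tm, tb, mb], b₃.Free (some l))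
    (hx₁ : ThirdRel (some tm) (some tb) (some mb) t n₁ x₁ y₁)
    (hx₂ : ThirdRel (some tm) (some tb) (some mb) t n₂ x₂ y₂)
    (hx₃ : ThirdRel (some tm) (some tb) (some mb) t n₃ x₃ y₃) (hn : n₁ + n₂ + n₃ = 1) :
    ((b₀ * x₁ * b₁ * x₂ * b₂ * x₃ * b₃).mat none).det
      = ((b₀ * y₁ * b₁ * y₂ * b₂ * y₃ * b₃).mat none).det := by
  have hm' : (some tm : Option α) ≠ some mb := by simpa using hm
  have hb' : (some tb : Option α) ≠ some mb := by simpa using hb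
  have free : ∀ {b : Block (Option α) R}, (∀ l ∈ [tm, tb, mb], b.Free (some l)) →
      ThirdRel (some tm) (some tb) (some mb) t 0 b b := fun h =>
    .of_free (h _ (by simp)) (h _ (by simp)) (h _ (by simp))
  have h := ((((((free h₀).mul hm' hb' hx₁).mul hm' hb' (free h₁)).mul hm' hb' hx₂).mul hm' hb'
    (free h₂)).mul hm' hb' hx₃).mul hm' hb' (free h₃)
  have hn' : 0 + n₁ + 0 + n₂ + 0 + n₃ + 0 = 1 := by linear_combination hn
  rw [hn'] at h
  exact h.det_eq (by simp) (by simp) (by simp) hm' hb' ht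

theorem ThirdRel.pair_over {x y : Passage α} {mb : α} {t : R} (o o' : Bool)
    (hx : x.role = .over) (hy : y.role = .over) (hm : x.label ≠ mb) (hb : y.label ≠ mb)
    (hxy : x.label ≠ y.label) :
    ThirdRel (some x.label) (some y.label) (some mb) t 0 (wordBlock τ s (pair o x y))
      (wordBlock τ s (pair o' x y)) := by
  rw [wordBlock_pair_over τ s o hx hy, wordBlock_pair_over τ s o' hx hy]
  exact ThirdRel.top (by simpa using hm) (by simpa using hb) (by simpa using hxy)

theorem ThirdRel.pair_over' {x y : Passage α} {mb : α} {t : R} (o o' : Bool)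
    (hx : x.role = .over) (hy : y.role = .over) (hm : x.label ≠ mb) (hb : y.label ≠ mb)
    (hxy : x.label ≠ y.label) :
    ThirdRel (some y.label) (some x.label) (some mb) t 0 (wordBlock τ s (pair o x y))
      (wordBlock τ s (pair o' x y)) := by
  rw [wordBlock_pair_over τ s o hx hy, wordBlock_pair_over τ s o' hx hy, add_comm]
  exact ThirdRel.top (by simpa using hb) (by simpa using hm) (by simpa using hxy.symm)

theorem ThirdRel.pair_mid {x y : Passage α} {tb : α}
    (hx : x.role = .under) (hy : y.role = .over) (hxy : x.label ≠ y.label)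
    (hb : tb ≠ y.label) :
    ThirdRel (some x.label) (some tb) (some y.label) (τ x.label : R) 1 (wordBlock τ s [x, y])
      (wordBlock τ s [y, x]) := by
  have := ThirdRel.mid (t := (τ x.label : R)) (tm := some x.label) (tb := some tb)
    (mb := some y.label) (by simpa using hxy) (by simpa using hb)
  simpa [passageBlock_under τ s hx, passageBlock_over τ s hy] using this

theorem ThirdRel.pair_bot {x y : Passage α} {tm : α} {t : R} (o : Bool)
    (hx : x.role = .under) (hy : y.role = .under) (hxy : x.label ≠ y.label)
    (h : if o then (1 - (τ y.label : R)) * (t - τ x.label) = 0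
      else (1 - (τ y.label : R)) * (t * τ x.label - 1) = 0) :
    ThirdRel (some tm) (some x.label) (some y.label) t 0 (wordBlock τ s (pair o x y))
      (wordBlock τ s (pair (!o) x y)) := by
  have hxy' : (some x.label : Option α) ≠ some y.label := by simpa using hxy
  cases o
  · have := ThirdRel.bot' (tm := some tm) hxy' (by simpa using h)
    simpa [pair, passageBlock_under τ s hx, passageBlock_under τ s hy] using this
  · have := ThirdRel.bot (tm := some tm) hxy' (by simpa using h)
    simpa [pair, passageBlock_under τ s hx, passageBlock_under τ s hy] using this

theorem ThirdRel.pair_bot' {x y : Passage α} {tm : α} {t : R} (o : Bool)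
    (hx : x.role = .under) (hy : y.role = .under) (hxy : x.label ≠ y.label)
    (h : if !o then (1 - (τ y.label : R)) * (t - τ x.label) = 0
      else (1 - (τ y.label : R)) * (t * τ x.label - 1) = 0) :
    ThirdRel (some tm) (some x.label) (some y.label) t 0 (wordBlock τ s (pair o y x))
      (wordBlock τ s (pair (!o) y x)) := by
  cases o
  · exact ThirdRel.pair_bot τ s true hx hy hxy h
  · exact ThirdRel.pair_bot τ s false hx hy hxy h

/-- The relations between the weights that the third move needs. -/
def WeightRel (x y z : Passage α) : Prop :=
  if x.pos = y.pos then (1 - (τ z.label : R)) * (τ x.label - τ y.label) = 0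
  else (1 - (τ z.label : R)) * (τ x.label * τ y.label - 1) = 0

theorem WeightRel.ite {τ : α → Rˣ} {x y z : Passage α} {o : Bool} (h : WeightRel τ x y z)
    (ho : o = true ↔ x.pos = y.pos) :
    if o then (1 - (τ z.label : R)) * (τ x.label - τ y.label) = 0
      else (1 - (τ z.label : R)) * (τ x.label * τ y.label - 1) = 0 := by
  simpa only [WeightRel, ho] using h

/-- Whether the middle branch passes the top branch before it passes the bottom branch. -/
def midOrder : Role → Role → Role → Bool → Bool → Bool → Bool
  | .over, .over, .over, _, o₂, _ => o₂
  | .over, .over, _, _, _, o₃ => o₃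
  | .over, _, _, o₁, _, _ => !o₁
  | _, .over, _, o₁, _, _ => o₁
  | _, _, .over, _, _, o₃ => !o₃
  | _, _, _, _, o₂, _ => !o₂

/-- A third move reverses the order on each branch, so one side of it always has the order that
`ThirdRel` requires. -/
theorem midOrder_not (a b c : Role) (o₁ o₂ o₃ : Bool) :
    midOrder a b c (!o₁) (!o₂) (!o₃) = !midOrder a b c o₁ o₂ o₃ := by
  cases a <;> cases b <;> cases c <;> simp [midOrder]

theorem wordDet_third_of_midOrder (A B C E : List (Passage α)) (a b c : Passage α)
    (o₁ o₂ o₃ : Bool) (ha : a.role ≠ .virt) (hb : b.role ≠ .virt) (hc : c.role ≠ .virt)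
    (hrole : (a.role = .over ∧ b.role = .over) ∨ (a.role = .under ∧ c.role = .over) ∨
      (b.role = .under ∧ c.role = .under))
    (htri : Triangle a b c o₁ o₂ o₃) (hab : a.label ≠ b.label)
    (hac : a.label ≠ c.label) (hbc : b.label ≠ c.label)
    (hA : ∀ l ∈ [a.label, b.label, c.label], (wordBlock τ s A).Free (some l))
    (hB : ∀ l ∈ [a.label, b.label, c.label], (wordBlock τ s B).Free (some l))
    (hC : ∀ l ∈ [a.label, b.label, c.label], (wordBlock τ s C).Free (some l))
    (hE : ∀ l ∈ [a.label, b.label, c.label], (wordBlock τ s E).Free (some l))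
    (hw : ∀ x ∈ [a, b, c], ∀ y ∈ [a, b, c], ∀ z ∈ [a, b, c], WeightRel τ x y z)
    (hmid : midOrder a.role b.role c.role o₁ o₂ o₃ = true) :
    wordDet τ s
        (A ++ pair o₁ a b ++ B ++ pair o₂ a.partner c ++ C ++ pair o₃ b.partner c.partner ++ E)
      = wordDet τ s
        (A ++ pair (!o₁) a b ++ B ++ pair (!o₂) a.partner c ++ C
          ++ pair (!o₃) b.partner c.partner ++ E) := by
  simp only [wordDet, wordBlock_append]
  have perm : ∀ {W : List (Passage α)} {l₁ l₂ l₃ : α},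
      (∀ l ∈ [a.label, b.label, c.label], (wordBlock τ s W).Free (some l)) →
      l₁ ∈ [a.label, b.label, c.label] → l₂ ∈ [a.label, b.label, c.label] →
      l₃ ∈ [a.label, b.label, c.label] →
      ∀ l ∈ [l₁, l₂, l₃], (wordBlock τ s W).Free (some l) := by
    intro W l₁ l₂ l₃ h h₁ h₂ h₃ l hl
    simp only [List.mem_cons, List.not_mem_nil, or_false] at hl
    rcases hl with rfl | rfl | rfl
    exacts [h _ h₁, h _ h₂, h _ h₃]
  have key : ∀ {tm tb mb : α} {x₁ x₂ x₃ y₁ y₂ y₃ : Block (Option α) R} {n₁ n₂ n₃ : R},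
      tm ∈ [a.label, b.label, c.label] → tb ∈ [a.label, b.label, c.label] →
      mb ∈ [a.label, b.label, c.label] → tm ≠ mb → tb ≠ mb →
      ThirdRel (some tm) (some tb) (some mb) (τ tm : R) n₁ x₁ y₁ →
      ThirdRel (some tm) (some tb) (some mb) (τ tm : R) n₂ x₂ y₂ →
      ThirdRel (some tm) (some tb) (some mb) (τ tm : R) n₃ x₃ y₃ → n₁ + n₂ + n₃ = 1 →
      ((wordBlock τ s A * x₁ * wordBlock τ s B * x₂ * wordBlock τ s C * x₃
        * wordBlock τ s E).mat none).det
      = ((wordBlock τ s A * y₁ * wordBlock τ s B * y₂ * wordBlock τ s C * y₃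
        * wordBlock τ s E).mat none).det := by
    intro tm tb mb x₁ x₂ x₃ y₁ y₂ y₃ n₁ n₂ n₃ htm htb hmb h₁ h₂ r₁ r₂ r₃ hn
    exact det_of_thirdRel (τ tm).isUnit h₁ h₂ (perm hA htm htb hmb) (perm hB htm htb hmb)
      (perm hC htm htb hmb) (perm hE htm htb hmb) r₁ r₂ r₃ hn
  rcases a with ⟨la, ra, sa⟩
  rcases b with ⟨lb, rb, sb⟩
  rcases c with ⟨lc, rc, sc⟩
  simp only at ha hb hc hrole hmid hab hac hbc
  simp only [Triangle, Passage.partner] at htri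
  -- Six cases survive, one for each way of arranging the three branches by height.
  rcases ra with _ | _ | _ <;> rcases rb with _ | _ | _ <;> rcases rc with _ | _ | _ <;>
    simp only [reduceCtorEq, ne_eq, not_true_eq_false, and_self, and_false, false_and, or_false,
      or_self] at ha hb hc hrole <;>
    simp only [midOrder, Bool.not_eq_true'] at hmid
  · subst hmid
    refine key (tm := la) (tb := lb) (mb := lc) (by simp) (by simp) (by simp) hac
      hbc
      (ThirdRel.pair_over τ s _ _ (x := ⟨la, .over, sa⟩) (y := ⟨lb, .over, sb⟩) rfl rfl
        hac hbc hab)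
      (ThirdRel.pair_mid τ s (x := ⟨la, .under, !sa⟩) (y := ⟨lc, .over, sc⟩) rfl rfl
        hac hbc)
      (ThirdRel.pair_bot τ s (x := ⟨lb, .under, !sb⟩) (y := ⟨lc, .under, !sc⟩) o₃ rfl rfl hbc
        (WeightRel.ite (x := ⟨la, .over, sa⟩) (y := ⟨lb, .over, sb⟩) (z := ⟨lc, .over, sc⟩)
          (hw _ (by simp) _ (by simp) _ (by simp)) ?_)) (by simp)
    -- The middle branch meets the top one first. The triangle condition then says that the bottom
    -- branch meets the top one before the middle one precisely if the two crossings with the top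
    -- branch have equal signs; this selects the relation between the weights.
    simp only [Passage.pos]; clear * - htri; revert o₁ o₃ sa sb sc; decide
  · subst hmid
    refine key (tm := lb) (tb := la) (mb := lc) (by simp) (by simp) (by simp) hbc
      hac
      (ThirdRel.pair_over' τ s _ _ (x := ⟨la, .over, sa⟩) (y := ⟨lb, .over, sb⟩) rfl rfl
        hac hbc hab)
      (ThirdRel.pair_bot τ s (x := ⟨la, .under, !sa⟩) (y := ⟨lc, .under, sc⟩) o₂ rfl rfl hac
        (WeightRel.ite (x := ⟨lb, .over, sb⟩) (y := ⟨la, .over, sa⟩) (z := ⟨lc, .under, sc⟩)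
          (hw _ (by simp) _ (by simp) _ (by simp)) ?_))
      (ThirdRel.pair_mid τ s (x := ⟨lb, .under, !sb⟩) (y := ⟨lc, .over, !sc⟩) rfl rfl
        hbc hac) (by simp)
    simp only [Passage.pos]; clear * - htri; revert o₁ o₂ sa sb sc; decide
  · subst hmid
    refine key (tm := lb) (tb := lc) (mb := la) (by simp) (by simp) (by simp) hab.symm
      hac.symm
      (ThirdRel.pair_mid τ s (x := ⟨lb, .under, sb⟩) (y := ⟨la, .over, sa⟩) rfl rfl
        hab.symm hac.symm)
      (ThirdRel.pair_bot' τ s (x := ⟨lc, .under, sc⟩) (y := ⟨la, .under, !sa⟩) o₂ rfl rfl hac.symm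
        (WeightRel.ite (x := ⟨lb, .under, sb⟩) (y := ⟨lc, .under, sc⟩) (z := ⟨la, .over, sa⟩)
          (hw _ (by simp) _ (by simp) _ (by simp)) ?_))
      (ThirdRel.pair_over τ s _ _ (x := ⟨lb, .over, !sb⟩) (y := ⟨lc, .over, !sc⟩) rfl rfl
        hab.symm hac.symm hbc) (by simp)
    simp only [Passage.pos]; clear * - htri; revert o₂ o₃ sa sb sc; decide
  · subst hmid
    refine key (tm := la) (tb := lc) (mb := lb) (by simp) (by simp) (by simp) hab
      hbc.symm
      (ThirdRel.pair_mid τ s (x := ⟨la, .under, sa⟩) (y := ⟨lb, .over, sb⟩) rfl rfl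
        hab hbc.symm)
      (ThirdRel.pair_over τ s _ _ (x := ⟨la, .over, !sa⟩) (y := ⟨lc, .over, sc⟩) rfl rfl
        hab hbc.symm hac)
      (ThirdRel.pair_bot' τ s (x := ⟨lc, .under, !sc⟩) (y := ⟨lb, .under, !sb⟩) o₃ rfl rfl hbc.symm
        (WeightRel.ite (x := ⟨la, .under, sa⟩) (y := ⟨lc, .over, sc⟩) (z := ⟨lb, .over, sb⟩)
          (hw _ (by simp) _ (by simp) _ (by simp)) ?_)) (by simp)
    simp only [Passage.pos]; clear * - htri; revert o₂ o₃ sa sb sc; decide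
  · subst hmid
    refine key (tm := lc) (tb := la) (mb := lb) (by simp) (by simp) (by simp) hbc.symm
      hab
      (ThirdRel.pair_bot τ s (x := ⟨la, .under, sa⟩) (y := ⟨lb, .under, sb⟩) o₁ rfl rfl hab
        (WeightRel.ite (x := ⟨lc, .over, sc⟩) (y := ⟨la, .under, sa⟩) (z := ⟨lb, .under, sb⟩)
          (hw _ (by simp) _ (by simp) _ (by simp)) ?_))
      (ThirdRel.pair_over' τ s _ _ (x := ⟨la, .over, !sa⟩) (y := ⟨lc, .over, sc⟩) rfl rfl
        hab hbc.symm hac)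
      (ThirdRel.pair_mid τ s (x := ⟨lc, .under, !sc⟩) (y := ⟨lb, .over, !sb⟩) rfl rfl
        hbc.symm hab) (by simp)
    simp only [Passage.pos]; clear * - htri; revert o₁ o₂ sa sb sc; decide
  · subst hmid
    refine key (tm := lc) (tb := lb) (mb := la) (by simp) (by simp) (by simp) hac.symm
      hab.symm
      (ThirdRel.pair_bot' τ s (x := ⟨lb, .under, sb⟩) (y := ⟨la, .under, sa⟩) o₁ rfl rfl hab.symm
        (WeightRel.ite (x := ⟨lc, .under, sc⟩) (y := ⟨lb, .under, sb⟩) (z := ⟨la, .under, sa⟩)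
          (hw _ (by simp) _ (by simp) _ (by simp)) ?_))
      (ThirdRel.pair_mid τ s (x := ⟨lc, .under, sc⟩) (y := ⟨la, .over, !sa⟩) rfl rfl
        hac.symm hab.symm)
      (ThirdRel.pair_over' τ s _ _ (x := ⟨lb, .over, !sb⟩) (y := ⟨lc, .over, !sc⟩) rfl rfl
        hab.symm hac.symm hbc) (by simp)
    simp only [Passage.pos]; clear * - htri; revert o₁ o₃ sa sb sc; decide

theorem wordDet_third_classical (A B C E : List (Passage α)) (a b c : Passage α)
    (o₁ o₂ o₃ : Bool) (ha : a.role ≠ .virt) (hb : b.role ≠ .virt) (hc : c.role ≠ .virt)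
    (hrole : (a.role = .over ∧ b.role = .over) ∨ (a.role = .under ∧ c.role = .over) ∨
      (b.role = .under ∧ c.role = .under))
    (htri : Triangle a b c o₁ o₂ o₃) (hab : a.label ≠ b.label)
    (hac : a.label ≠ c.label) (hbc : b.label ≠ c.label)
    (hA : ∀ l ∈ [a.label, b.label, c.label], (wordBlock τ s A).Free (some l))
    (hB : ∀ l ∈ [a.label, b.label, c.label], (wordBlock τ s B).Free (some l))
    (hC : ∀ l ∈ [a.label, b.label, c.label], (wordBlock τ s C).Free (some l))
    (hE : ∀ l ∈ [a.label, b.label, c.label], (wordBlock τ s E).Free (some l))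
    (hw : ∀ x ∈ [a, b, c], ∀ y ∈ [a, b, c], ∀ z ∈ [a, b, c], WeightRel τ x y z) :
    wordDet τ s
        (A ++ pair o₁ a b ++ B ++ pair o₂ a.partner c ++ C ++ pair o₃ b.partner c.partner ++ E)
      = wordDet τ s
        (A ++ pair (!o₁) a b ++ B ++ pair (!o₂) a.partner c ++ C
          ++ pair (!o₃) b.partner c.partner ++ E) := by
  cases hmid : midOrder a.role b.role c.role o₁ o₂ o₃
  · have htri' : Triangle a b c (!o₁) (!o₂) (!o₃) := by
      clear hmid
      revert htri
      simp only [Triangle]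
      generalize a.ltr = x, b.ltr = y, c.ltr = z, a.partner.ltr = x', b.partner.ltr = y',
        c.partner.ltr = z'
      revert o₁ o₂ o₃ x y z x' y' z'
      decide
    have := wordDet_third_of_midOrder τ s A B C E a b c (!o₁) (!o₂) (!o₃) ha hb hc hrole htri'
      hab hac hbc hA hB hC hE hw (by rw [midOrder_not, hmid]; rfl)
    simpa using this.symm
  · exact wordDet_third_of_midOrder τ s A B C E a b c o₁ o₂ o₃ ha hb hc hrole htri
      hab hac hbc hA hB hC hE hw hmid

theorem wordDet_third (A B C E : List (Passage α)) (a b c : Passage α) (o₁ o₂ o₃ : Bool)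
    (hrole : TripleAllowed a.role b.role c.role)
    (htri : Triangle a b c o₁ o₂ o₃) (hab : a.label ≠ b.label)
    (hac : a.label ≠ c.label) (hbc : b.label ≠ c.label)
    (hA : ∀ l ∈ [a.label, b.label, c.label], Avoids A l)
    (hB : ∀ l ∈ [a.label, b.label, c.label], Avoids B l)
    (hC : ∀ l ∈ [a.label, b.label, c.label], Avoids C l)
    (hE : ∀ l ∈ [a.label, b.label, c.label], Avoids E l)
    (hw : ∀ x ∈ [a, b, c], ∀ y ∈ [a, b, c], ∀ z ∈ [a, b, c], x.role ≠ .virt → y.role ≠ .virt →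
      z.role ≠ .virt → WeightRel τ x y z) :
    wordDet τ s
        (A ++ pair o₁ a b ++ B ++ pair o₂ a.partner c ++ C ++ pair o₃ b.partner c.partner ++ E)
      = wordDet τ s
        (A ++ pair (!o₁) a b ++ B ++ pair (!o₂) a.partner c ++ C
          ++ pair (!o₃) b.partner c.partner ++ E) := by
  have hA := fun l hl => free_wordBlock τ s (hA l hl)
  have hB := fun l hl => free_wordBlock τ s (hB l hl)
  have hC := fun l hl => free_wordBlock τ s (hC l hl)
  have hE := fun l hl => free_wordBlock τ s (hE l hl)
  have unit : ∀ x : Passage α, IsUnit (virtWeight s x) := by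
    intro x
    unfold virtWeight
    split_ifs
    exacts [s.isUnit, (s⁻¹).isUnit]
  -- The scale `t` by which the crossing of the two other branches is rescaled, as seen from one of
  -- them.
  have weight : ∀ (o : Bool) (x : Passage α), ∃ t : R, IsUnit t ∧
      (if o then t = virtWeight s x else virtWeight s x * t = 1) := by
    intro o x
    cases o
    · obtain ⟨u, hu⟩ := unit x
      exact ⟨(u⁻¹ : Rˣ), (u⁻¹).isUnit, by simp [← hu]⟩
    · exact ⟨_, unit x, by simp⟩
  -- The crossing of the two other branches lies on one side of the virtual branch, so both passages
  -- through it see the same scale.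
  have transfer : ∀ {o o' : Bool} {x y : Passage α} {t : R}, (o = o' ↔ x.ltr = y.ltr) →
      (if o then t = virtWeight s x else virtWeight s x * t = 1) →
      (if o' then t = virtWeight s y else virtWeight s y * t = 1) := by
    intro o o' x y t h
    unfold virtWeight
    revert h
    cases o <;> cases o' <;> cases x.ltr <;> cases y.ltr <;> simp <;> intro ht
    all_goals first
      | exact ht
      | exact ht.symm
      | exact Units.eq_inv_of_mul_eq_one_left ht
      | exact (Units.eq_inv_of_mul_eq_one_left ht).symm
      | (rw [ht]; simp)
  simp only [Triangle] at htri
  obtain ⟨htri₁, htri₂, htri₃⟩ := htri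
  have free : ∀ {x y : Passage α} (o : Bool) (l : α) (t : R), x.role = .virt → y.role = .virt →
      Block.conj 1 (diagonal (Function.update 1 (some l) t)) (wordBlock τ s (pair o x y))
        = Block.conj (diagonal (Function.update 1 (some l) t)) 1
          (wordBlock τ s (pair (!o) x y)) := by
    intro x y o l t hx hy
    rw [conj_free (free_virt_pair τ s o hx hy l), wordBlock_virt_pair τ s o hx hy]
  rcases hrole with ⟨ha, hb⟩ | ⟨ha, hc⟩ | ⟨hb, hc⟩ | ⟨⟨ha, hb, hc⟩, h⟩
  · obtain ⟨t, ht, hta⟩ := weight o₂ a.partner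
    have hap : a.partner.role = .virt := by simp [ha, Role.swap]
    have hbp : b.partner.role = .virt := by simp [hb, Role.swap]
    have htb : (if o₃ then t = virtWeight s b.partner else virtWeight s b.partner * t = 1) := by
      refine transfer (x := a.partner) ?_ hta
      clear * - htri₃
      revert htri₃
      generalize a.partner.ltr = x, b.partner.ltr = y
      revert o₂ o₃ x y
      decide
    simp only [wordDet, wordBlock_append]
    exact det_of_conj_pairs (l := c.label) ht (hA _ (by simp)) (hB _ (by simp)) (hC _ (by simp))
      (hE _ (by simp)) (free _ _ _ ha hb) (conj_virt_pair τ s o₂ hap hta)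
      (conj_virt_pair τ s (y := c.partner) o₃ hbp htb)
  · obtain ⟨t, ht, hta⟩ := weight o₁ a
    have hap : a.partner.role = .virt := by simp [ha, Role.swap]
    have hcp : c.partner.role = .virt := by simp [hc, Role.swap]
    have htb : (if !o₃ then t = virtWeight s c.partner else virtWeight s c.partner * t = 1) := by
      refine transfer (x := a) ?_ hta
      clear * - htri₂
      revert htri₂
      generalize a.ltr = x, c.partner.ltr = y
      revert o₁ o₃ x y
      decide
    simp only [wordDet, wordBlock_append]
    exact det_of_conj_pairs (l := b.label) ht (hA _ (by simp)) (hB _ (by simp)) (hC _ (by simp))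
      (hE _ (by simp)) (conj_virt_pair τ s o₁ ha hta) (free _ _ _ hap hc)
      (conj_virt_pair' τ s (y := b.partner) o₃ hcp htb)
  · obtain ⟨t, ht, hta⟩ := weight (!o₁) b
    have hbp : b.partner.role = .virt := by simp [hb, Role.swap]
    have hcp : c.partner.role = .virt := by simp [hc, Role.swap]
    have htb : (if !o₂ then t = virtWeight s c else virtWeight s c * t = 1) := by
      refine transfer (x := b) ?_ hta
      clear * - htri₁
      revert htri₁
      generalize b.ltr = x, c.ltr = y
      revert o₁ o₂ x y
      decide
    simp only [wordDet, wordBlock_append]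
    exact det_of_conj_pairs (l := a.label) ht (hA _ (by simp)) (hB _ (by simp)) (hC _ (by simp))
      (hE _ (by simp)) (conj_virt_pair' τ s o₁ hb hta)
      (conj_virt_pair' τ s (y := a.partner) o₂ hc htb) (free _ _ _ hbp hcp)
  · refine wordDet_third_classical τ s A B C E a b c o₁ o₂ o₃ ha hb hc h
      ⟨htri₁, htri₂, htri₃⟩ hab hac hbc hA hB hC hE fun x hx y hy z hz => hw x hx y hy z hz ?_ ?_ ?_
    all_goals
      simp only [List.mem_cons, List.not_mem_nil, or_false] at hx hy hz
      rcases hx with rfl | rfl | rfl <;> rcases hy with rfl | rfl | rfl <;>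
        rcases hz with rfl | rfl | rfl <;> assumption

end Moves

end LongVirtual

namespace LongVirtual

open Matrix LaurentPolynomial

/-! ### The weights of the crossings -/

theorem pPow_mul (a b : ℤ) : pPow a * pPow b = pPow (a + b) := by
  simp only [pPow, ← map_mul, ← T_add]

theorem qPow_mul (a b : ℤ) : qPow a * qPow b = qPow (a + b) := by
  simp only [qPow, ← map_mul, ← T_add]

theorem pPow_zero : pPow 0 = 1 := by simp [pPow]

theorem qPow_zero : qPow 0 = 1 := by simp [qPow]

noncomputable def pUnit (e : ℤ) : CoeffRingˣ :=
  ⟨pPow e, pPow (-e), by rw [pPow_mul, add_neg_cancel, pPow_zero],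
    by rw [pPow_mul, neg_add_cancel, pPow_zero]⟩

noncomputable def qUnit (e : ℤ) : CoeffRingˣ :=
  ⟨qPow e, qPow (-e), by rw [qPow_mul, add_neg_cancel, qPow_zero],
    by rw [qPow_mul, neg_add_cancel, qPow_zero]⟩

theorem p_relation : (pPow 1 - 1) * (pPow 1 - qPow 1) = 0 := by
  have : toCoeffRing ((pVar - 1) * (pVar - qVar)) = 0 :=
    Ideal.Quotient.eq_zero_iff_mem.2 (Ideal.subset_span (by simp))
  simpa [pVar, qVar, pPow, qPow] using this

theorem q_relation : (qPow 1 - 1) * (pPow 1 - qPow 1) = 0 := by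
  have : toCoeffRing ((qVar - 1) * (pVar - qVar)) = 0 :=
    Ideal.Quotient.eq_zero_iff_mem.2 (Ideal.subset_span (by simp))
  simpa [pVar, qVar, pPow, qPow] using this

/-- `t` is `p ^ e` or `q ^ e`, where `e` is `1` or `-1`. -/
def IsWeight (t : CoeffRing) (pos : Bool) : Prop :=
  t = pPow (if pos then 1 else -1) ∨ t = qPow (if pos then 1 else -1)

/-- The relations of `T` say that `p` and `q`, and hence their inverses, act as the identity on
multiples of `p - q`. -/
theorem IsWeight.one_sub_mul {t : CoeffRing} {b : Bool} (h : IsWeight t b) :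
    (1 - t) * (pPow 1 - qPow 1) = 0 := by
  have hp : pPow (-1) * pPow 1 = 1 := by rw [pPow_mul]; exact pPow_zero
  have hq : qPow (-1) * qPow 1 = 1 := by rw [qPow_mul]; exact qPow_zero
  have h1 := p_relation
  have h2 := q_relation
  rcases h with rfl | rfl <;> cases b <;> simp only [if_true, if_false, Bool.false_eq_true]
  · linear_combination pPow (-1) * h1 - (pPow 1 - qPow 1) * hp
  · linear_combination -h1
  · linear_combination qPow (-1) * h2 - (pPow 1 - qPow 1) * hq
  · linear_combination -h2

/-- The relations between the weights hold in the coefficient ring. -/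
theorem IsWeight.relation {x y z : CoeffRing} {a b c : Bool} (hx : IsWeight x a)
    (hy : IsWeight y b) (hz : IsWeight z c) :
    if a = b then (1 - z) * (x - y) = 0 else (1 - z) * (x * y - 1) = 0 := by
  have hp : pPow (-1) * pPow 1 = 1 := by rw [pPow_mul]; exact pPow_zero
  have hq : qPow (-1) * qPow 1 = 1 := by rw [qPow_mul]; exact qPow_zero
  have h := hz.one_sub_mul
  -- In each case `x - y`, respectively `x y - 1`, is zero or a unit times `p - q`, and `1 - z`
  -- kills `p - q`.
  rcases hx with rfl | rfl <;> rcases hy with rfl | rfl <;> cases a <;> cases b <;>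
    simp only [if_true, if_false, Bool.false_eq_true, reduceCtorEq]
  · ring
  · linear_combination (1 - z) * hp
  · linear_combination (1 - z) * hp
  · ring
  · linear_combination -pPow (-1) * qPow (-1) * h + (1 - z) * qPow (-1) * hp
      - (1 - z) * pPow (-1) * hq
  · linear_combination -pPow (-1) * h + (1 - z) * hp
  · linear_combination qPow (-1) * h + (1 - z) * hq
  · linear_combination h
  · linear_combination pPow (-1) * qPow (-1) * h - (1 - z) * qPow (-1) * hp
      + (1 - z) * pPow (-1) * hq
  · linear_combination qPow (-1) * h + (1 - z) * hq
  · linear_combination -pPow (-1) * h + (1 - z) * hp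
  · linear_combination -h
  · ring
  · linear_combination (1 - z) * hq
  · linear_combination (1 - z) * hq
  · ring

/-- The weight of a crossing that is passed for the first time. -/
noncomputable def Passage.weight {α : Type*} (x : Passage α) : CoeffRingˣ :=
  if x.role = .over then pUnit (if x.pos then 1 else -1) else qUnit (if x.pos then 1 else -1)

theorem Passage.isWeight {α : Type*} (x : Passage α) : IsWeight x.weight x.pos := by
  unfold Passage.weight IsWeight
  by_cases h : x.role = .over
  · rw [if_pos h]; exact Or.inl rfl
  · rw [if_neg h]; exact Or.inr rfl

/-- The crossings of a bigon have opposite signs, and one branch passes both in the same role, so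
the weights are inverse powers of the same variable. -/
theorem Passage.weight_mul {α : Type*} {x y : Passage α} (h : x.role = y.role)
    (h' : x.ltr = !y.ltr) : x.weight * y.weight = 1 := by
  have hpos : x.pos = !y.pos := by
    simp only [Passage.pos, h, h']
    cases y.role <;> simp
  unfold Passage.weight
  rw [h, hpos]
  ext
  cases y.pos <;> split_ifs <;>
    simp_all [pUnit, qUnit, pPow_mul, qPow_mul, pPow_zero, qPow_zero]

/-! ### Weights in a word and invariance up to units -/

section Word

variable {α : Type*} [DecidableEq α]

/-- The passages through a crossing. -/
def passagesAt (w : List (Passage α)) (l : α) : List (Passage α) := w.filter (·.label = l)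

/-- The weight of a crossing in a sequence of passages. -/
noncomputable def weight (w : List (Passage α)) (l : α) : CoeffRingˣ :=
  ((passagesAt w l).head?.map Passage.weight).getD 1

/-- Every label occurs at most twice. -/
def AtMostTwice (w : List (Passage α)) : Prop := ∀ l, (passagesAt w l).length ≤ 2

theorem passagesAt_append (v w : List (Passage α)) (l : α) :
    passagesAt (v ++ w) l = passagesAt v l ++ passagesAt w l := by
  simp [passagesAt]

theorem passagesAt_cons (x : Passage α) (w : List (Passage α)) (l : α) :
    passagesAt (x :: w) l = if x.label = l then x :: passagesAt w l else passagesAt w l := by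
  simp [passagesAt, List.filter_cons]

@[simp] theorem passagesAt_nil (l : α) : passagesAt ([] : List (Passage α)) l = [] := rfl

theorem length_passagesAt_pair (o : Bool) (x y : Passage α) (l : α) :
    (passagesAt (pair o x y) l).length
      = (if x.label = l then 1 else 0) + (if y.label = l then 1 else 0) := by
  cases o <;> simp only [pair, passagesAt_cons, if_true, if_false, Bool.false_eq_true] <;>
    split_ifs <;> simp

theorem passagesAt_pair_not {o : Bool} {x y : Passage α} (h : x.label ≠ y.label) (l : α) :
    passagesAt (pair (!o) x y) l = passagesAt (pair o x y) l := by
  cases o <;> simp only [pair, passagesAt_cons, if_true, if_false, Bool.false_eq_true,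
    Bool.not_true, Bool.not_false] <;> split_ifs <;> simp_all

theorem avoids_iff {w : List (Passage α)} {l : α} :
    Avoids w l ↔ (passagesAt w l).length = 0 := by
  simp [Avoids, passagesAt, List.filter_eq_nil_iff]

theorem weight_append {v w : List (Passage α)} {l : α} (h : Avoids v l) :
    weight (v ++ w) l = weight w l := by
  rw [avoids_iff, List.length_eq_zero_iff] at h
  simp [weight, passagesAt_append, h]

theorem weight_cons_self (x : Passage α) (w : List (Passage α)) :
    weight (x :: w) x.label = x.weight := by
  simp [weight, passagesAt_cons]

theorem weight_cons_of_ne {x : Passage α} {l : α} (w : List (Passage α)) (h : x.label ≠ l) :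
    weight (x :: w) l = weight w l := by
  simp [weight, passagesAt_cons, h]

theorem weight_pair_append {x y : Passage α} (o : Bool) (w : List (Passage α))
    (h : x.label ≠ y.label) :
    weight (pair o x y ++ w) x.label = x.weight ∧
      weight (pair o x y ++ w) y.label = y.weight := by
  cases o <;> simp [pair, weight_cons_self, weight_cons_of_ne, h, h.symm]

theorem wordBlock_congr {R : Type*} [CommRing R] {τ τ' : α → Rˣ} {s : Rˣ} {w : List (Passage α)}
    (h : ∀ x ∈ w, τ x.label = τ' x.label) : wordBlock τ s w = wordBlock τ' s w := by
  induction w with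
  | nil => rfl
  | cons x w ih =>
    rw [wordBlock_cons, wordBlock_cons, ih fun y hy => h y (List.mem_cons_of_mem _ hy)]
    congr 1
    simp [passageBlock, h x (by simp)]

/-- The variable `s` as a unit. -/
noncomputable def sUnit (R : Type*) [CommRing R] : (LaurentPolynomial R)ˣ :=
  ⟨T 1, T (-1), by rw [← T_add]; exact T_zero, by rw [← T_add]; exact T_zero⟩

/-- The weights as Laurent polynomials. -/
noncomputable def weightC (w : List (Passage α)) (l : α) : (LaurentPolynomial CoeffRing)ˣ :=
  Units.map (C : CoeffRing →+* LaurentPolynomial CoeffRing) (weight w l)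

variable [Fintype α]

/-- The determinant of a sequence of passages with its own weights. -/
noncomputable def lineDet (w : List (Passage α)) : LaurentPolynomial CoeffRing :=
  wordDet (weightC w) (sUnit CoeffRing) w

theorem lineDet_eq {w : List (Passage α)} {τ : α → (LaurentPolynomial CoeffRing)ˣ}
    (h : ∀ x ∈ w, weightC w x.label = τ x.label) :
    lineDet w = wordDet τ (sUnit CoeffRing) w := by
  rw [lineDet, wordDet, wordDet, wordBlock_congr h]

theorem weightRel_weightC {w : List (Passage α)} {x y z : Passage α}
    (hx : weight w x.label = x.weight) (hy : weight w y.label = y.weight)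
    (hz : weight w z.label = z.weight) : WeightRel (weightC w) x y z := by
  have h := IsWeight.relation x.isWeight y.isWeight z.isWeight
  unfold WeightRel weightC
  rw [hx, hy, hz]
  split_ifs at h ⊢
  · simpa using congrArg (C : CoeffRing →+* LaurentPolynomial CoeffRing) h
  · simpa using congrArg (C : CoeffRing →+* LaurentPolynomial CoeffRing) h

/-- As each label occurs at most twice, the labels of a move do not occur outside it. The remaining
labels keep their first passage, so both words can be evaluated with the weights of the larger one.
The factor lies in `T`: no power of `s` appears. -/
theorem lineDet_move {w w' : List (Passage α)} (h : Move w w') (hw : AtMostTwice w) :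
    ∃ u : CoeffRingˣ, lineDet w = C (u : CoeffRing) * lineDet w' := by
  cases h with
  | isotopy => exact ⟨1, by simp⟩
  | first A B x =>
    have hl := hw x.label
    simp [passagesAt_append, passagesAt_cons] at hl
    have hA : Avoids A x.label := avoids_iff.2 (by omega)
    have hB : Avoids B x.label := avoids_iff.2 (by omega)
    rw [lineDet_eq (w := A ++ B) (τ := weightC (A ++ [x, x.partner] ++ B))]
    · rcases wordDet_first (weightC (A ++ [x, x.partner] ++ B)) (sUnit CoeffRing) A B x hA hB
        with h | h
      · exact ⟨1, by rw [lineDet, h]; simp⟩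
      · exact ⟨weight (A ++ [x, x.partner] ++ B) x.label, by rw [lineDet, h]; rfl⟩
    · intro y hy
      have hyx : x.label ≠ y.label := by
        intro h
        rcases List.mem_append.1 hy with hy | hy
        exacts [hA y hy h.symm, hB y hy h.symm]
      simp [weightC, weight, passagesAt_append, passagesAt_cons, hyx]
  | second A B C x y o hrole hside =>
    have hlx := hw x.label
    have hly := hw y.label
    simp only [passagesAt_append, passagesAt_cons, List.length_append, length_passagesAt_pair,
      Passage.partner_label, if_true, passagesAt_nil] at hlx hly
    have hxy : x.label ≠ y.label := by
      intro h
      simp [h] at hlx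
      omega
    simp [hxy, hxy.symm] at hlx hly
    have hAx : Avoids A x.label := avoids_iff.2 (by omega)
    have hAy : Avoids A y.label := avoids_iff.2 (by omega)
    have hBx : Avoids B x.label := avoids_iff.2 (by omega)
    have hBy : Avoids B y.label := avoids_iff.2 (by omega)
    have hCx : Avoids C x.label := avoids_iff.2 (by omega)
    have hCy : Avoids C y.label := avoids_iff.2 (by omega)
    refine ⟨1, ?_⟩
    rw [lineDet_eq (w := A ++ B ++ C)
      (τ := weightC (A ++ [x, y] ++ B ++ pair o x.partner y.partner ++ C)), Units.val_one, map_one,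
      one_mul]
    · refine wordDet_second _ _ A B C x y o hrole hside hxy (fun _ => ?_) hAx hBx hCx hAy hBy hCy
      have h1 : weight (A ++ [x, y] ++ B ++ pair o x.partner y.partner ++ C) x.label = x.weight := by
        simp only [List.append_assoc, weight_append hAx]
        simp [weight_cons_self]
      have h2 : weight (A ++ [x, y] ++ B ++ pair o x.partner y.partner ++ C) y.label = y.weight := by
        simp only [List.append_assoc, weight_append hAy]
        simp [weight_cons_of_ne _ hxy, weight_cons_self]
      unfold weightC
      rw [h1, h2, ← map_mul, Passage.weight_mul hrole hside, map_one]
    · intro z hz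
      have hzx : x.label ≠ z.label := by
        intro h
        rcases List.mem_append.1 hz with hz | hz
        · rcases List.mem_append.1 hz with hz | hz
          exacts [hAx z hz h.symm, hBx z hz h.symm]
        · exact hCx z hz h.symm
      have hzy : y.label ≠ z.label := by
        intro h
        rcases List.mem_append.1 hz with hz | hz
        · rcases List.mem_append.1 hz with hz | hz
          exacts [hAy z hz h.symm, hBy z hz h.symm]
        · exact hCy z hz h.symm
      have : passagesAt (pair o x.partner y.partner) z.label = [] := by
        rw [← List.length_eq_zero_iff, length_passagesAt_pair]
        simp [hzx, hzy]
      simp [weightC, weight, passagesAt_append, passagesAt_cons, hzx, hzy, this]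
  | third A B C E a b c o₁ o₂ o₃ hrole htri =>
    have hla := hw a.label
    have hlb := hw b.label
    have hlc := hw c.label
    simp only [passagesAt_append, List.length_append, length_passagesAt_pair,
      Passage.partner_label, if_true] at hla hlb hlc
    have hab : a.label ≠ b.label := by
      intro h; simp [h] at hla; omega
    have hac : a.label ≠ c.label := by
      intro h; simp [h] at hla; omega
    have hbc : b.label ≠ c.label := by
      intro h; simp [h] at hlb; omega
    simp [hab, hac, hbc, hab.symm, hac.symm, hbc.symm] at hla hlb hlc
    have avoid : ∀ W ∈ [A, B, C, E], ∀ l ∈ [a.label, b.label, c.label], Avoids W l := by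
      intro W hW l hl
      rw [avoids_iff]
      simp only [List.mem_cons, List.not_mem_nil, or_false] at hW hl
      rcases hW with rfl | rfl | rfl | rfl <;> rcases hl with rfl | rfl | rfl <;> omega
    have hp : ∀ l, passagesAt (A ++ pair (!o₁) a b ++ B ++ pair (!o₂) a.partner c ++ C
        ++ pair (!o₃) b.partner c.partner ++ E) l = passagesAt (A ++ pair o₁ a b ++ B
          ++ pair o₂ a.partner c ++ C ++ pair o₃ b.partner c.partner ++ E) l := by
      -- A third move keeps the order of the two passages of each crossing, and therefore the early
      -- or late type of the overpass.
      intro l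
      simp only [passagesAt_append]
      rw [passagesAt_pair_not hab, passagesAt_pair_not (by simpa using hac),
        passagesAt_pair_not (by simpa using hbc)]
    refine ⟨1, ?_⟩
    rw [lineDet_eq (w := A ++ pair (!o₁) a b ++ B ++ pair (!o₂) a.partner c ++ C
        ++ pair (!o₃) b.partner c.partner ++ E) (τ := weightC (A ++ pair o₁ a b ++ B
          ++ pair o₂ a.partner c ++ C ++ pair o₃ b.partner c.partner ++ E))
          (fun x _ => by simp only [weightC, weight, hp]), Units.val_one, map_one, one_mul]
    refine wordDet_third _ _ A B C E a b c o₁ o₂ o₃ hrole htri hab hac hbc (avoid _ (by simp))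
      (avoid _ (by simp)) (avoid _ (by simp)) (avoid _ (by simp)) ?_
    have hwt : ∀ x ∈ [a, b, c], weight (A ++ pair o₁ a b ++ B
          ++ pair o₂ a.partner c ++ C ++ pair o₃ b.partner c.partner ++ E) x.label = x.weight := by
      intro x hx
      simp only [List.mem_cons, List.not_mem_nil, or_false] at hx
      simp only [List.append_assoc]
      rcases hx with rfl | rfl | rfl
      · rw [weight_append (avoid A (by simp) _ (by simp))]
        exact (weight_pair_append _ _ hab).1
      · rw [weight_append (avoid A (by simp) _ (by simp))]
        exact (weight_pair_append _ _ hab).2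
      · rw [weight_append (avoid A (by simp) _ (by simp)), weight_append,
          weight_append (avoid B (by simp) _ (by simp))]
        · exact (weight_pair_append o₂ _ (x := a.partner) hac).2
        · rw [avoids_iff, length_passagesAt_pair]
          simp [hac, hbc]
    exact fun x hx y hy z hz _ _ _ => weightRel_weightC (hwt x hx) (hwt y hy) (hwt z hz)

end Word

end LongVirtual

namespace LongVirtual

open Matrix LaurentPolynomial

/-! ### Change of labels -/

/-- The block `b'` is obtained from `b` by an inclusion `g` of the unknowns. -/
structure Block.Extends {ι κ R : Type*} [CommRing R] (g : ι → κ) (b : Block ι R)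
    (b' : Block κ R) : Prop where
  k : b'.k = b.k
  d : ∀ i, b'.d (g i) = b.d i
  r : ∀ i, b'.r (g i) = b.r i
  c : ∀ i j, b'.c (g i) (g j) = b.c i j
  r_zero : ∀ i, i ∉ Set.range g → b'.r i = 0
  c_zero : ∀ i, i ∉ Set.range g → ∀ j, b'.c i j = 0

theorem Block.Extends.mul {ι κ R : Type*} [CommRing R] {g : ι → κ} {a b : Block ι R}
    {a' b' : Block κ R} (ha : a.Extends g a') (hb : b.Extends g b') :
    (a * b).Extends g (a' * b') := by
  constructor <;> intros <;> simp_all [ha.k, hb.k, ha.d, hb.d, ha.r, hb.r, ha.c, hb.c,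
    vecMulVec_apply, ha.r_zero, hb.r_zero, ha.c_zero, hb.c_zero]

/-- Rows outside the range of `g` are rows of the identity matrix, so the larger matrix is block
triangular with an identity block. -/
theorem det_eq_of_injective {ι κ R : Type*} [CommRing R] [DecidableEq ι] [Fintype ι]
    [DecidableEq κ] [Fintype κ] {g : ι → κ} (hg : Function.Injective g) {M : Matrix ι ι R}
    {N : Matrix κ κ R} (h : ∀ i j, N (g i) (g j) = M i j)
    (h' : ∀ i, i ∉ Set.range g → ∀ j, N i j = (1 : Matrix κ κ R) i j) : N.det = M.det := by
  classical
  rw [twoBlockTriangular_det N (· ∈ Set.range g)]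
  · have h1 : (N.toSquareBlockProp fun i => ¬ i ∈ Set.range g) = 1 := by
      ext i j
      rw [toSquareBlockProp_def, of_apply, h' i i.2, one_apply, one_apply]
      simp [Subtype.ext_iff]
    have h2 : M = (N.toSquareBlockProp (· ∈ Set.range g)).submatrix (Equiv.ofInjective g hg)
        (Equiv.ofInjective g hg) := by
      ext i j
      exact (h i j).symm
    rw [h1, det_one, mul_one, h2, det_submatrix_equiv_self]
    congr!
  · intro i hi j hj
    rw [h' i hi, one_apply_ne]
    rintro rfl
    exact hi hj

theorem Block.Extends.det_mat {ι κ R : Type*} [CommRing R] [DecidableEq ι] [Fintype ι]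
    [DecidableEq κ] [Fintype κ] {g : ι → κ} (hg : Function.Injective g) {b : Block ι R}
    {b' : Block κ R} (h : b.Extends g b') (o : ι) : (b'.mat (g o)).det = (b.mat o).det := by
  have hs : ∀ i, (Pi.single (g o) 1 : κ → R) (g i) = (Pi.single o 1 : ι → R) i := by
    intro i; simp [Pi.single_apply, hg.eq_iff]
  apply det_eq_of_injective hg
  · intro i j
    simp [Block.mat, Block.obs, Block.out, vecMulVec_apply, h.k, h.d, h.r, h.c, hs, one_apply,
      hg.eq_iff]
  · intro i hi j
    have : i ≠ g o := by rintro rfl; exact hi ⟨o, rfl⟩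
    simp [Block.mat, Block.obs, vecMulVec_apply, h.r_zero i hi, h.c_zero i hi, this]

/-! ### Independence of the names of the crossings -/

section Relabel

variable {α β : Type*} [DecidableEq α] [DecidableEq β] {R : Type*} [CommRing R]

theorem extends_passageBlock {f : α → β} (hf : Function.Injective f) {τ : α → Rˣ} {τ' : β → Rˣ}
    {s : Rˣ} {x : Passage α} (h : τ' (f x.label) = τ x.label) :
    (passageBlock τ s x).Extends (Option.map f) (passageBlock τ' s (x.relabel f)) := by
  have hs : ∀ i, (Pi.single (some (f x.label)) 1 : Option β → R) (Option.map f i)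
      = (Pi.single (some x.label) 1 : Option α → R) i := by
    intro i
    cases i <;> simp [Pi.single_apply, hf.eq_iff]
  have hr : ∀ i, i ∉ Set.range (Option.map f) →
      (Pi.single (some (f x.label)) 1 : Option β → R) i = 0 := by
    intro i hi
    rw [Pi.single_apply, if_neg]
    rintro rfl
    exact hi ⟨some x.label, rfl⟩
  rcases x with ⟨l, r, b⟩
  simp only at hs hr h
  rcases r with _ | _ | _ <;> constructor <;> intros <;>
    simp_all [passageBlock, Passage.relabel]
  rfl

theorem extends_wordBlock {f : α → β} (hf : Function.Injective f) {τ : α → Rˣ} {τ' : β → Rˣ}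
    {s : Rˣ} {w : List (Passage α)} (h : ∀ x ∈ w, τ' (f x.label) = τ x.label) :
    (wordBlock τ s w).Extends (Option.map f) (wordBlock τ' s (w.map (Passage.relabel f))) := by
  induction w with
  | nil => constructor <;> intros <;> simp
  | cons x w ih =>
    rw [List.map_cons, wordBlock_cons, wordBlock_cons]
    exact (extends_passageBlock hf (h x (by simp))).mul
      (ih fun y hy => h y (List.mem_cons_of_mem _ hy))

theorem passagesAt_relabel {f : α → β} {w : List (Passage α)} {l : α}
    (hf : ∀ x ∈ w, f x.label = f l → x.label = l) :
    passagesAt (w.map (Passage.relabel f)) (f l) = (passagesAt w l).map (Passage.relabel f) := by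
  rw [passagesAt, passagesAt, List.filter_map]
  congr 1
  apply List.filter_congr
  intro x hx
  change decide (f x.label = f l) = decide (x.label = l)
  exact decide_eq_decide.2 ⟨hf x hx, fun h => by rw [h]⟩

theorem weight_relabel {f : α → β} {w : List (Passage α)} {l : α}
    (hf : ∀ x ∈ w, f x.label = f l → x.label = l) :
    weight (w.map (Passage.relabel f)) (f l) = weight w l := by
  rw [weight, passagesAt_relabel hf, weight]
  cases passagesAt w l <;> rfl

theorem lineDet_relabel [Fintype α] [Fintype β] {f : α → β} (hf : Function.Injective f)
    (w : List (Passage α)) : lineDet (w.map (Passage.relabel f)) = lineDet w := by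
  have h := extends_wordBlock hf (τ := weightC w) (τ' := weightC (w.map (Passage.relabel f)))
    (s := sUnit CoeffRing) (w := w) (fun x _ => by
      rw [weightC, weight_relabel fun y _ h => hf h, weightC])
  exact h.det_mat (Option.map_injective hf) none

/-- The sequence of passages with labels in the set of labels that occur. -/
def restrictLabels (w : List (Passage α)) :
    List (Passage {l // l ∈ (w.map Passage.label).toFinset}) :=
  w.attach.map fun x =>
    ⟨⟨x.1.label, List.mem_toFinset.2 (List.mem_map_of_mem x.2)⟩, x.1.role, x.1.ltr⟩

theorem map_restrictLabels (w : List (Passage α)) (f : α → β) :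
    (restrictLabels w).map (Passage.relabel fun l => f l.1) = w.map (Passage.relabel f) := by
  rw [restrictLabels, List.map_map]
  conv_rhs => rw [← List.attach_map_subtype_val w, List.map_map]
  rfl

/-- The determinant of a sequence of passages. -/
noncomputable def zdet (w : List (Passage α)) : LaurentPolynomial CoeffRing :=
  lineDet (restrictLabels w)

theorem lineDet_map [Fintype β] {w : List (Passage α)} {f : α → β}
    (hf : ∀ x ∈ w, ∀ y ∈ w, f x.label = f y.label → x.label = y.label) :
    lineDet (w.map (Passage.relabel f)) = zdet w := by
  rw [← map_restrictLabels, lineDet_relabel, zdet]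
  rintro ⟨l, hl⟩ ⟨l', hl'⟩ h
  simp only [List.mem_toFinset, List.mem_map] at hl hl'
  obtain ⟨x, hx, rfl⟩ := hl
  obtain ⟨y, hy, rfl⟩ := hl'
  exact Subtype.ext (hf x hx y hy h)

theorem map_relabel_pair (f : α → β) (o : Bool) (x y : Passage α) :
    (pair o x y).map (Passage.relabel f) = pair o (x.relabel f) (y.relabel f) := by
  cases o <;> rfl

theorem Move.map (f : α → β) {w w' : List (Passage α)} (h : Move w w') :
    Move (w.map (Passage.relabel f)) (w'.map (Passage.relabel f)) := by
  cases h with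
  | isotopy => exact .isotopy _
  | first A B x =>
    simp only [List.map_append]
    exact .first _ _ (x.relabel f)
  | second A B C x y o hrole hside =>
    simp only [List.map_append, map_relabel_pair]
    exact .second _ _ _ (x.relabel f) (y.relabel f) o hrole hside
  | third A B C E a b c o₁ o₂ o₃ hrole htri =>
    simp only [List.map_append, map_relabel_pair]
    exact .third _ _ _ _ (a.relabel f) (b.relabel f) (c.relabel f) o₁ o₂ o₃ hrole htri

/-- Determinants need finitely many labels, while a diagram has its labels in `ℂ`. Both words are
carried over to one finite label type, where `lineDet_move` applies. -/
theorem zdet_move {w w' : List (Passage α)} {φ : Equiv.Perm α}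
    (h : Move w (w'.map (Passage.relabel φ))) (hw : AtMostTwice w) :
    ∃ u : CoeffRingˣ, zdet w = C (u : CoeffRing) * zdet w' := by
  let S : Finset α := (w.map Passage.label).toFinset ∪
    (w'.map fun x => φ x.label).toFinset
  -- Labels outside `S` all go to `none`. This does no harm, because `S` contains every label of the
  -- two words after the permutation.
  let f : α → Option S := fun l => if h : l ∈ S then some ⟨l, h⟩ else none
  have hf : ∀ l ∈ S, ∀ l', f l' = f l → l' = l := by
    intro l hl l' h
    simp only [f, dif_pos hl] at h
    split_ifs at h
    simpa using h
  have hS : ∀ x ∈ w, x.label ∈ S := fun x hx =>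
    Finset.mem_union_left _ (List.mem_toFinset.2 (List.mem_map_of_mem hx))
  have hS' : ∀ x ∈ w', φ x.label ∈ S := fun x hx =>
    Finset.mem_union_right _ (List.mem_toFinset.2 (List.mem_map.2 ⟨x, hx, rfl⟩))
  have h1 : lineDet (w.map (Passage.relabel f)) = zdet w :=
    lineDet_map fun x _ y hy h => hf _ (hS y hy) _ h
  have h2 : lineDet ((w'.map (Passage.relabel φ)).map (Passage.relabel f)) = zdet w' := by
    rw [List.map_map]
    exact lineDet_map (f := f ∘ φ) fun x _ y hy h => φ.injective (hf _ (hS' y hy) _ h)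
  have h3 : AtMostTwice (w.map (Passage.relabel f)) := by
    intro l
    by_cases hl : ∃ x ∈ w, f x.label = l
    · obtain ⟨x, hx, rfl⟩ := hl
      rw [passagesAt_relabel fun y _ h => hf _ (hS x hx) _ h, List.length_map]
      exact hw _
    · have : Avoids (w.map (Passage.relabel f)) l := by
        intro x hx
        obtain ⟨y, hy, rfl⟩ := List.mem_map.1 hx
        exact fun h => hl ⟨y, hy, h⟩
      rw [avoids_iff.1 this]
      omega
  rw [← h1, ← h2]
  exact lineDet_move (h.map f) h3

end Relabel

end LongVirtual

namespace LongVirtual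

open Matrix LaurentPolynomial

/-! ### Non-zero-divisors of the coefficient ring -/

/-- The unit `t` of `ℤ[t, t⁻¹]`. -/
noncomputable def tUnit : (LaurentPolynomial ℤ)ˣ := sUnit ℤ

theorem tUnit_zpow (n : ℤ) : ((tUnit ^ n : (LaurentPolynomial ℤ)ˣ) : LaurentPolynomial ℤ) = T n := by
  induction n using Int.induction_on with
  | zero => simp
  | succ n ih => rw [_root_.zpow_add_one, Units.val_mul, ih, T_add]; rfl
  | pred n ih => rw [_root_.zpow_sub_one, Units.val_mul, ih, sub_eq_add_neg, T_add]; rfl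

/-- The homomorphism that sends `p` and `q` to `t`. -/
noncomputable def identify : CoeffRing →+* LaurentPolynomial ℤ :=
  Ideal.Quotient.lift relIdeal (eval₂ (RingHom.id (LaurentPolynomial ℤ)) tUnit) (by
    intro a ha
    rw [← RingHom.mem_ker]
    revert a
    rw [← SetLike.le_def, relIdeal, Ideal.span_le]
    have h : (eval₂ (RingHom.id (LaurentPolynomial ℤ)) tUnit) (pVar - qVar) = 0 := by
      rw [map_sub, pVar, qVar, eval₂_C, eval₂_T, tUnit_zpow]
      simp
    rintro x (rfl | rfl) <;> simp only [SetLike.mem_coe, RingHom.mem_ker, map_mul, h, mul_zero])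

theorem identify_toCoeffRing (a : LaurentPolynomial ℤ) (n : ℤ) :
    identify (toCoeffRing (C a * T n)) = a * T n := by
  change eval₂ (RingHom.id (LaurentPolynomial ℤ)) tUnit (C a * T n) = _
  rw [eval₂_C_mul_T, tUnit_zpow]
  rfl

/-- The homomorphism that sends `p` and `q` to `1`. -/
noncomputable def augment : CoeffRing →+* ℤ := (eval₂ (RingHom.id ℤ) 1).comp identify

theorem augment_toCoeffRing (m k n : ℤ) :
    augment (toCoeffRing (C (C m * T k) * T n)) = m := by
  rw [augment, RingHom.comp_apply, identify_toCoeffRing, map_mul, eval₂_C_mul_T, eval₂_T]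
  simp

theorem augment_pPow (n : ℤ) : augment (pPow n) = 1 := by
  have := augment_toCoeffRing 1 n 0
  simpa [pPow] using this

theorem augment_qPow (n : ℤ) : augment (qPow n) = 1 := by
  have := augment_toCoeffRing 1 0 n
  simpa [qPow] using this

theorem pPow_mul_sub (n : ℤ) : pPow n * (pPow 1 - qPow 1) = pPow 1 - qPow 1 := by
  have h := p_relation
  induction n using Int.induction_on with
  | zero => rw [pPow_zero, one_mul]
  | succ n ih => rw [← pPow_mul]; linear_combination pPow n * h + ih
  | pred n ih =>
    have h1 : pPow (-n - 1) * pPow 1 = pPow (-n) := by rw [pPow_mul]; simp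
    linear_combination ih - pPow (-n - 1) * h + (pPow 1 - qPow 1) * h1

theorem qPow_mul_sub (n : ℤ) : qPow n * (pPow 1 - qPow 1) = pPow 1 - qPow 1 := by
  have h := q_relation
  induction n using Int.induction_on with
  | zero => rw [qPow_zero, one_mul]
  | succ n ih => rw [← qPow_mul]; linear_combination qPow n * h + ih
  | pred n ih =>
    have h1 : qPow (-n - 1) * qPow 1 = qPow (-n) := by rw [qPow_mul]; simp
    linear_combination ih - qPow (-n - 1) * h + (pPow 1 - qPow 1) * h1

theorem dvd_pPow_sub (n : ℤ) : pPow 1 - qPow 1 ∣ pPow n - qPow n := by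
  induction n using Int.induction_on with
  | zero => simp [pPow_zero, qPow_zero]
  | succ n ih =>
    have : pPow (n + 1) - qPow (n + 1)
        = pPow 1 * (pPow n - qPow n) + (pPow 1 - qPow 1) * qPow n := by
      rw [← pPow_mul, ← qPow_mul]; ring
    rw [this]
    exact dvd_add (ih.mul_left _) (dvd_mul_right _ _)
  | pred n ih =>
    have hp : pPow (-1) * pPow 1 = 1 := by rw [pPow_mul]; exact pPow_zero
    have hq : qPow (-1) * qPow 1 = 1 := by rw [qPow_mul]; exact qPow_zero
    have : pPow (-n - 1) - qPow (-n - 1)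
        = pPow (-1) * (pPow (-n) - qPow (-n))
          + (pPow 1 - qPow 1) * (-(pPow (-1) * qPow (-1) * qPow (-n))) := by
      have h1 : pPow (-n - 1) = pPow (-n) * pPow (-1) := (pPow_mul _ _).symm
      have h2 : qPow (-n - 1) = qPow (-n) * qPow (-1) := (qPow_mul _ _).symm
      rw [h1, h2]
      linear_combination qPow (-1) * qPow (-n) * hp - pPow (-1) * qPow (-n) * hq
    rw [this]
    exact dvd_add (ih.mul_left _) (dvd_mul_right _ _)

/-- Modulo `p - q` every `q` may be replaced by `p`, and the result is determined by the image in
`ℤ[t, t⁻¹]`. -/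
theorem dvd_of_identify_eq_zero {c : CoeffRing} (hc : identify c = 0) :
    pPow 1 - qPow 1 ∣ c := by
  have key : ∀ x : PQRing,
      pPow 1 - qPow 1 ∣ toCoeffRing x - toCoeffRing (C (identify (toCoeffRing x))) := by
    intro x
    induction x using LaurentPolynomial.induction_on' with
    | add x y hx hy =>
      simp only [map_add]
      rw [add_sub_add_comm]
      exact dvd_add hx hy
    | C_mul_T n a =>
      rw [identify_toCoeffRing, map_mul, map_mul, map_mul, ← mul_sub]
      exact ((dvd_sub_comm).1 (dvd_pPow_sub n)).mul_left _
  obtain ⟨x, rfl⟩ := Ideal.Quotient.mk_surjective c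
  have := key x
  change identify (toCoeffRing x) = 0 at hc
  rwa [hc, map_zero, map_zero, sub_zero] at this

theorem mul_sub_eq_augment (x : CoeffRing) :
    x * (pPow 1 - qPow 1) = (augment x : CoeffRing) * (pPow 1 - qPow 1) := by
  obtain ⟨x, rfl⟩ := Ideal.Quotient.mk_surjective x
  change toCoeffRing x * _ = (augment (toCoeffRing x) : CoeffRing) * _
  induction x using LaurentPolynomial.induction_on' with
  | add x y hx hy => simp only [map_add, Int.cast_add, add_mul, hx, hy]
  | C_mul_T n a =>
    induction a using LaurentPolynomial.induction_on' with
    | add x y hx hy => simp only [map_add, Int.cast_add, add_mul, hx, hy]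
    | C_mul_T k m =>
      rw [augment_toCoeffRing, map_mul, map_mul, map_mul]
      have h1 := qPow_mul_sub n
      have h2 := pPow_mul_sub k
      simp only [pPow, qPow] at *
      rw [mul_assoc, h1, mul_assoc, h2]
      simp

/-- The image of `x` in the domain `ℤ[t, t⁻¹]` is not zero, so `c` maps to zero and is a multiple of
`p - q`. On such multiples `x` acts as its augmentation `1`, whence `c = c x = 0`. -/
theorem eq_zero_of_mul_eq_zero {c x : CoeffRing} (hx : augment x = 1) (h : c * x = 0) : c = 0 := by
  have h1 : identify c * identify x = 0 := by rw [← map_mul, h, map_zero]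
  have h2 : identify x ≠ 0 := by
    intro h0
    rw [augment, RingHom.comp_apply, h0, map_zero] at hx
    exact zero_ne_one hx
  obtain ⟨g, hg⟩ := dvd_of_identify_eq_zero ((mul_eq_zero.1 h1).resolve_right h2)
  have h3 := mul_sub_eq_augment x
  rw [hx, Int.cast_one, one_mul] at h3
  rw [hg] at h ⊢
  linear_combination h - g * h3

/-! ### The determinant of a product -/

namespace Block

variable {ι R : Type*} [CommRing R] [DecidableEq ι] [Fintype ι]

/-- The vector `v` expresses that the block `b` commutes with adding a constant to all its values.
After the incoming value has been added to the unknowns of `b`, its system no longer depends on that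
value and splits off. -/
theorem det_mul_of_stochastic {a b : Block ι R} {o : ι} {v : ι → R} (hv : v o = 0)
    (hk : b.k + b.d ⬝ᵥ v = 1) (hr : b.r + b.c *ᵥ v = v) (had : a.d ⬝ᵥ v = 0)
    (hac : a.c *ᵥ v = 0) (hbo : b.d o = 0) (hbc : ∀ i, b.c i o = 0)
    (hab : ∀ i, i ≠ o → a.Free i ∨ b.Free i) :
    ((a * b).mat o).det = (a.mat o).det * (1 - b.c).det := by
  have h1 : (a * b).mat o *ᵥ v = b.r - (1 - b.k) • Pi.single o 1 := by
    have : b.c *ᵥ v = v - b.r := by rw [eq_sub_iff_add_eq, add_comm, hr]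
    have h2 : b.d ⬝ᵥ v = 1 - b.k := by rw [← hk]; ring
    simp only [mat, obs, out, mul_k, mul_d, mul_r, mul_c, sub_mulVec, add_mulVec, one_mulVec,
      vecMulVec_mulVec, hac, this, add_dotProduct, smul_dotProduct, single_dotProduct, hv, had, h2]
    ext i
    simp
    ring
  -- The matrix is multiplied by `1 + v ⊗ a.out o`, which adds the incoming value to the unknowns in
  -- the support of `v`. Its determinant is `1` since `a.out o` vanishes on `v`.
  have h2 : (a * b).mat o - vecMulVec ((a * b).mat o *ᵥ v) (-a.out o)
      = a.mat o - b.c - vecMulVec (Pi.single o 1) b.d := by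
    rw [h1]
    ext i j
    simp [mat, obs, out, vecMulVec_apply]
    ring
  -- The unknowns of `a` and `b` are disjoint apart from `o`, so the products of `b.c` and `b.d`
  -- with the recorded matrix of `a` vanish.
  have h3 : (1 - b.c - vecMulVec (Pi.single o 1) b.d) * a.mat o
      = a.mat o - b.c - vecMulVec (Pi.single o 1) b.d := by
    have h4 : b.c * a.obs o = 0 := by
      ext i j
      rw [mul_apply]
      refine Finset.sum_eq_zero fun l _ => ?_
      by_cases hl : l = o
      · rw [hl, hbc, zero_mul]
      · rcases hab l hl with h | h
        · rw [h.obs_left hl, mul_zero]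
        · rw [h.c_right, zero_mul]
    have h5 : b.d ᵥ* a.obs o = 0 := by
      ext j
      refine Finset.sum_eq_zero fun l _ => ?_
      by_cases hl : l = o
      · rw [hl, hbo, zero_mul]
      · rcases hab l hl with h | h
        · exact mul_eq_zero_of_right _ (h.obs_left hl j)
        · rw [h.d, zero_mul]
    simp only [mat, mul_sub, sub_mul, mul_one, one_mul, h4, vecMulVec_mul, h5, vecMulVec_zero]
    abel
  have h6 := det_sub_vecMulVec_right (N := (a * b).mat o) (w := v) (v := -a.out o) rfl
  have h7 : -a.out o ⬝ᵥ v = 0 := by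
    simp [out, add_dotProduct, hv, had]
  rw [h7, sub_zero, one_mul, h2, ← h3, det_mul, det_sub_vecMulVec_right (w := Pi.single o 1)] at h6
  · rw [← h6]
    simp [hbo, mul_comm]
  · ext i
    simp [hbc, one_apply, Pi.single_apply]

end Block

section Product

variable {α R : Type*} [CommRing R] [DecidableEq α] (τ : α → Rˣ) (s : Rˣ)

theorem wordBlock_none (w : List (Passage α)) :
    (wordBlock τ s w).d none = 0 ∧ ∀ i, (wordBlock τ s w).c i none = 0 := by
  induction w with
  | nil => simp
  | cons x w ih =>
    have h : (passageBlock τ s x).d none = 0 ∧ ∀ i, (passageBlock τ s x).c i none = 0 := by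
      unfold passageBlock
      split <;> simp
    simp [ih, h, vecMulVec_apply]

/-- The number of overpasses. -/
def overCount (w : List (Passage α)) : Option α → ℕ
  | none => 0
  | some l => w.countP fun x => x.label = l ∧ x.role = .over

/-- The coefficients `τ` and `1 - τ` have sum `1`, and without virtual crossings nothing else scales
the value. Hence the constant value `1` is preserved, and each row counts its overpasses. -/
theorem wordBlock_stochastic [Fintype α] {v : Option α → R} {w : List (Passage α)}
    (hv : ∀ x ∈ w, v (some x.label) = 1) (hw : ∀ x ∈ w, x.role ≠ .virt) :
    (wordBlock τ s w).k + (wordBlock τ s w).d ⬝ᵥ v = 1 ∧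
      (wordBlock τ s w).r + (wordBlock τ s w).c *ᵥ v = fun i => (overCount w i : R) := by
  induction w with
  | nil =>
    refine ⟨by simp, ?_⟩
    ext i; cases i <;> simp [overCount]
  | cons x w ih =>
    obtain ⟨h1, h2⟩ := ih (fun y hy => hv y (List.mem_cons_of_mem _ hy))
      (fun y hy => hw y (List.mem_cons_of_mem _ hy))
    have hx : (passageBlock τ s x).k + (passageBlock τ s x).d ⬝ᵥ v = 1 := by
      have := hv x (by simp)
      rcases hr : x.role with _ | _ | _
      · simp [passageBlock_over τ s hr]
      · simp [passageBlock_under τ s hr, this]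
      · exact absurd hr (hw x (by simp))
    have hc : (passageBlock τ s x).c = 0 := by
      unfold passageBlock; split <;> rfl
    have hr : ∀ i, (overCount (x :: w) i : R) = overCount w i + (passageBlock τ s x).r i := by
      intro i
      rcases hr : x.role with _ | _ | _
      · cases i with
        | none => simp [overCount, passageBlock_over τ s hr]
        | some l =>
          by_cases hl : x.label = l
          · simp [overCount, passageBlock_over τ s hr, hr, hl]
          · simp [overCount, passageBlock_over τ s hr, hr, hl, Ne.symm hl]
      · cases i <;> simp [overCount, passageBlock_under τ s hr, hr]
      · exact absurd hr (hw x (by simp))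
    rw [wordBlock_cons]
    constructor
    · simp only [Block.mul_k, Block.mul_d, add_dotProduct, smul_dotProduct, smul_eq_mul]
      linear_combination (wordBlock τ s w).k * hx + h1
    · ext i
      have h3 := congrFun h2 i
      simp only [Block.mul_r, Block.mul_c, add_mulVec, vecMulVec_mulVec, Pi.add_apply,
        Pi.smul_apply, smul_eq_mul, MulOpposite.smul_eq_mul_unop, MulOpposite.unop_op, hr, hc,
        zero_mulVec, Pi.zero_apply] at h3 ⊢
      linear_combination (wordBlock τ s w).r i * hx + h3

theorem wordBlock_map {S : Type*} [CommRing S] (f : R →+* S) (w : List (Passage α)) :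
    (wordBlock (fun l => Units.map (f : R →* S) (τ l)) (Units.map (f : R →* S) s) w).c
        = (wordBlock τ s w).c.map f ∧
      (wordBlock (fun l => Units.map (f : R →* S) (τ l)) (Units.map (f : R →* S) s) w).d
        = f ∘ (wordBlock τ s w).d ∧
      (wordBlock (fun l => Units.map (f : R →* S) (τ l)) (Units.map (f : R →* S) s) w).r
        = f ∘ (wordBlock τ s w).r ∧
      (wordBlock (fun l => Units.map (f : R →* S) (τ l)) (Units.map (f : R →* S) s) w).k
        = f (wordBlock τ s w).k := by
  have hs : ∀ l i, f ((Pi.single l 1 : Option α → R) i) = (Pi.single l 1 : Option α → S) i := by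
    intro l i
    by_cases h : i = l
    · subst h; simp
    · simp [h]
  induction w with
  | nil =>
    refine ⟨?_, ?_, ?_, ?_⟩ <;> (try ext i) <;> simp
  | cons x w ih =>
    obtain ⟨h1, h2, h3, h4⟩ := ih
    simp only [wordBlock_cons, Block.mul_k, Block.mul_d, Block.mul_r, Block.mul_c, h1, h2, h3, h4]
    rcases hr : x.role with _ | _ | _
    · simp only [passageBlock_over _ _ hr]
      refine ⟨?_, ?_, ?_, ?_⟩ <;> (try ext i) <;> simp [hs]
    · simp only [passageBlock_under _ _ hr]
      refine ⟨?_, ?_, ?_, ?_⟩ <;> (try ext i) <;> simp [vecMulVec_apply, hs]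
    · simp only [passageBlock_virt _ _ hr]
      cases hl : x.ltr <;> refine ⟨?_, ?_, ?_, ?_⟩ <;> (try ext i) <;>
        simp

theorem wordBlock_of_classical {s' : Rˣ} {w : List (Passage α)} (hw : ∀ x ∈ w, x.role ≠ .virt) :
    wordBlock τ s w = wordBlock τ s' w := by
  induction w with
  | nil => rfl
  | cons x w ih =>
    rw [wordBlock_cons, wordBlock_cons, ih fun y hy => hw y (List.mem_cons_of_mem _ hy)]
    congr 1
    rcases hr : x.role with _ | _ | _
    · simp [passageBlock_over _ _ hr]
    · simp [passageBlock_under _ _ hr]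
    · exact absurd hr (hw x (by simp))

/-- With weights `1` the underpasses become invisible and no unknown enters the value. This is the
situation at `p = q = 1`. -/
theorem wordBlock_one (w : List (Passage α)) :
    (wordBlock (1 : α → Rˣ) s w).c = 0 ∧ (wordBlock (1 : α → Rˣ) s w).d = 0 := by
  induction w with
  | nil => exact ⟨rfl, rfl⟩
  | cons x w ih =>
    have h : (passageBlock (1 : α → Rˣ) s x).c = 0 ∧ (passageBlock (1 : α → Rˣ) s x).d = 0 := by
      unfold passageBlock
      split <;> simp
    simp [ih, h]

end Product

end LongVirtual

namespace LongVirtual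

open Matrix LaurentPolynomial

/-! ### Words in which every crossing is passed twice -/

section WellFormed

variable {α : Type*} [DecidableEq α]

/-- Every crossing is passed twice, and its two passages are partners. -/
def WellFormed (w : List (Passage α)) : Prop :=
  ∀ l, passagesAt w l = [] ∨ ∃ x, passagesAt w l = [x, x.partner]

theorem WellFormed.atMostTwice {w : List (Passage α)} (h : WellFormed w) : AtMostTwice w := by
  intro l
  rcases h l with h | ⟨x, h⟩ <;> simp [h]

theorem mem_passagesAt {w : List (Passage α)} {x : Passage α} {l : α} :
    x ∈ passagesAt w l ↔ x ∈ w ∧ x.label = l := by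
  simp [passagesAt]

theorem WellFormed.map {β : Type*} [DecidableEq β] {w : List (Passage α)} (h : WellFormed w)
    {f : α → β} (hf : ∀ x ∈ w, ∀ y ∈ w, f x.label = f y.label → x.label = y.label) :
    WellFormed (w.map (Passage.relabel f)) := by
  intro l
  by_cases hl : ∃ x ∈ w, f x.label = l
  · obtain ⟨x, hx, rfl⟩ := hl
    rw [passagesAt_relabel fun y hy h => hf y hy x hx h]
    rcases h x.label with h | ⟨y, h⟩
    · left; simp [h]
    · right; exact ⟨y.relabel f, by rw [h]; rfl⟩
  · left
    rw [← List.length_eq_zero_iff, ← avoids_iff]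
    intro x hx
    obtain ⟨y, hy, rfl⟩ := List.mem_map.1 hx
    exact fun h => hl ⟨y, hy, h⟩

theorem WellFormed.overCount_eq_one {w : List (Passage α)} (h : WellFormed w) {x : Passage α}
    (hx : x ∈ w) (hr : x.role ≠ .virt) : overCount w (some x.label) = 1 := by
  have h1 : overCount w (some x.label)
      = (passagesAt w x.label).countP fun y => decide (y.role = .over) := by
    rw [overCount, passagesAt, List.countP_filter]
    congr 1
    ext y
    simp [Bool.and_comm]
  have hm : x ∈ passagesAt w x.label := mem_passagesAt.2 ⟨hx, rfl⟩
  rw [h1]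
  rcases h x.label with h | ⟨y, h⟩
  · rw [h] at hm; simp at hm
  · rw [h] at hm ⊢
    simp only [List.mem_cons, List.not_mem_nil, or_false] at hm
    have hy : y.role ≠ .virt := by
      rcases hm with rfl | rfl
      · exact hr
      · intro hy; exact hr (by simp [hy, Role.swap])
    rcases hy' : y.role with _ | _ | _
    · simp [hy', Role.swap]
    · simp [hy', Role.swap]
    · exact absurd hy' hy

end WellFormed

theorem augment_weight {α : Type*} [DecidableEq α] (w : List (Passage α)) (l : α) :
    augment (weight w l) = 1 := by
  unfold weight
  cases h : (passagesAt w l).head? with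
  | none => simp
  | some x =>
    rcases x.isWeight with h | h
    · simp [h, augment_pPow]
    · simp [h, augment_qPow]

/-! ### The factor contributed by a classical word -/

section Product

variable {α : Type*} [DecidableEq α]

/-- The number of overpasses serves as the stochastic vector of `B`: it is `1` at the labels of `B`,
by well-formedness and the absence of virtual crossings, and `0` elsewhere. The second determinant
has no `s`, as `B` has no virtual crossings. -/
theorem lineDet_append [Fintype α] {A B : List (Passage α)}
    (hAB : ∀ x ∈ A, ∀ y ∈ B, x.label ≠ y.label) (hB : WellFormed B)
    (hcl : ∀ x ∈ B, x.role ≠ .virt) :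
    lineDet (A ++ B) = lineDet A
      * C (1 - (wordBlock (weight B) 1 B).c).det := by
  have hA' : ∀ x ∈ A, Avoids B x.label := fun x hx y hy h => hAB x hx y hy h.symm
  have hB' : ∀ y ∈ B, Avoids A y.label := fun y hy x hx h => hAB x hx y hy h
  have hwA : wordBlock (weightC (A ++ B)) (sUnit CoeffRing) A
      = wordBlock (weightC A) (sUnit CoeffRing) A := by
    refine wordBlock_congr fun x hx => ?_
    have := hA' x hx
    rw [avoids_iff, List.length_eq_zero_iff] at this
    simp [weightC, weight, passagesAt_append, this]
  have hwB : wordBlock (weightC (A ++ B)) (sUnit CoeffRing) B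
      = wordBlock (weightC B) (sUnit CoeffRing) B := by
    refine wordBlock_congr fun x hx => ?_
    rw [weightC, weight_append (hB' x hx), weightC]
  have hc : (wordBlock (weightC B) (sUnit CoeffRing) B).c
      = (wordBlock (weight B) 1 B).c.map (C : CoeffRing →+* LaurentPolynomial CoeffRing) := by
    rw [wordBlock_of_classical (weightC B) (sUnit CoeffRing) (s' := 1) hcl,
      ← (wordBlock_map (weight B) 1 C B).1, map_one]
    rfl
  have hv : ∀ i, (overCount B i : LaurentPolynomial CoeffRing) = 0 ∨
      (i ≠ none ∧ (wordBlock (weightC A) (sUnit CoeffRing) A).Free i) := by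
    intro i
    cases i with
    | none => left; simp [overCount]
    | some l =>
      by_cases hl : ∃ y ∈ B, y.label = l
      · obtain ⟨y, hy, rfl⟩ := hl
        exact Or.inr ⟨by simp, free_wordBlock _ _ (hB' y hy)⟩
      · left
        have : overCount B (some l) = 0 := by
          rw [overCount, List.countP_eq_zero]
          intro y hy
          simp only [decide_eq_true_eq, not_and]
          exact fun h => absurd ⟨y, hy, h⟩ hl
        rw [this, Nat.cast_zero]
  obtain ⟨hk, hr⟩ := wordBlock_stochastic (weightC B) (sUnit CoeffRing) (w := B)
    (v := fun i => (overCount B i : LaurentPolynomial CoeffRing))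
    (fun x hx => by rw [hB.overCount_eq_one hx (hcl x hx), Nat.cast_one]) hcl
  have hn := wordBlock_none (weightC B) (sUnit CoeffRing) B
  have key := Block.det_mul_of_stochastic (a := wordBlock (weightC A) (sUnit CoeffRing) A)
    (b := wordBlock (weightC B) (sUnit CoeffRing) B) (o := none)
    (v := fun i => (overCount B i : LaurentPolynomial CoeffRing)) (by simp [overCount]) hk hr
    (by
      refine Finset.sum_eq_zero fun i _ => ?_
      rcases hv i with h | ⟨-, h⟩
      · exact mul_eq_zero_of_right _ h
      · rw [h.d, zero_mul])
    (by
      funext j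
      refine Finset.sum_eq_zero fun i _ => ?_
      rcases hv i with h | ⟨-, h⟩
      · exact mul_eq_zero_of_right _ h
      · exact mul_eq_zero_of_left (h.c_right j) _)
    hn.1 hn.2 (by
      intro i hi
      cases i with
      | none => exact absurd rfl hi
      | some l =>
        by_cases hl : ∃ y ∈ B, y.label = l
        · obtain ⟨y, hy, rfl⟩ := hl
          exact Or.inl (free_wordBlock _ _ (hB' y hy))
        · exact Or.inr (free_wordBlock _ _ fun y hy h => hl ⟨y, hy, h⟩))
  rw [lineDet, wordDet, wordBlock_append, hwA, hwB, key, hc, lineDet, wordDet, RingHom.map_det]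
  congr 2
  rw [map_sub, map_one]
  rfl

theorem augment_det (B : List (Passage α)) [Fintype α] :
    augment (1 - (wordBlock (weight B) 1 B).c).det = 1 := by
  rw [RingHom.map_det]
  have h : augment.mapMatrix (1 - (wordBlock (weight B) 1 B).c)
      = 1 - (wordBlock (weight B) 1 B).c.map augment := by
    ext i j
    simp [one_apply, apply_ite]
  have h1 : (fun l => Units.map (augment : CoeffRing →* ℤ) (weight B l)) = (1 : α → ℤˣ) := by
    ext l
    simpa using augment_weight B l
  rw [h, ← (wordBlock_map (weight B) 1 augment B).1, h1, (wordBlock_one _ B).1]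
  simp

theorem zdet_append {A B : List (Passage α)} (hAB : ∀ x ∈ A, ∀ y ∈ B, x.label ≠ y.label)
    (hB : WellFormed B) (hcl : ∀ x ∈ B, x.role ≠ .virt) :
    ∃ d : CoeffRing, augment d = 1 ∧ zdet (A ++ B) = zdet A * C d := by
  let S : Finset α := ((A ++ B).map Passage.label).toFinset
  let f : α → Option S := fun l => if h : l ∈ S then some ⟨l, h⟩ else none
  have hf : ∀ x ∈ A ++ B, ∀ y ∈ A ++ B, f x.label = f y.label → x.label = y.label := by
    intro x hx y hy h
    have h1 : x.label ∈ S := List.mem_toFinset.2 (List.mem_map_of_mem hx)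
    have h2 : y.label ∈ S := List.mem_toFinset.2 (List.mem_map_of_mem hy)
    simpa [f, h1, h2] using h
  refine ⟨(1 - (wordBlock (weight (B.map (Passage.relabel f))) 1
    (B.map (Passage.relabel f))).c).det, augment_det _, ?_⟩
  rw [← lineDet_map hf, List.map_append, lineDet_append,
    lineDet_map (w := A) fun x hx y hy => hf x (List.mem_append_left _ hx) y
      (List.mem_append_left _ hy)]
  · intro x hx y hy h
    obtain ⟨x', hx', rfl⟩ := List.mem_map.1 hx
    obtain ⟨y', hy', rfl⟩ := List.mem_map.1 hy
    exact hAB x' hx' y' hy'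
      (hf x' (List.mem_append_left _ hx') y' (List.mem_append_right _ hy') h)
  · exact hB.map fun x hx y hy => hf x (List.mem_append_right _ hx) y
      (List.mem_append_right _ hy)
  · intro x hx
    obtain ⟨x', hx', rfl⟩ := List.mem_map.1 hx
    exact hcl x' hx'

end Product

end LongVirtual

namespace LongVirtual

open Matrix LaurentPolynomial

/-! ### Arcs and long arcs -/

section Arcs

variable {α : Type*} (w : List (Passage α))

theorem lastUnder_succ (init : Option ℕ) {g : ℕ} {x : Passage α} (h : w[g]? = some x) :
    lastUnder w init (g + 1) = if x.role = .under then some g else lastUnder w init g := by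
  rcases hr : x.role with _ | _ | _ <;> simp [lastUnder, h, hr]

/-- The change of the degree at a virtual crossing. -/
def Passage.step (x : Passage α) : ℤ := if x.role = .virt then (if x.ltr then 1 else -1) else 0

theorem degFrom_succ (init : ℤ) {g : ℕ} {x : Passage α} (h : w[g]? = some x) :
    degFrom w init (g + 1) = if x.role = .under then 0 else degFrom w init g + x.step := by
  rcases x with ⟨l, r, b⟩
  rcases r with _ | _ | _ <;> cases b <;> simp [degFrom, h, Passage.step, sub_eq_add_neg]

theorem lastUnder_arcOf (init : Option ℕ) (g : ℕ) :
    lastUnder w init (arcOf w g) = lastUnder w init g := by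
  induction g with
  | zero => rfl
  | succ g ih =>
    cases h : w[g]? with
    | none => simp [arcOf, h]
    | some x =>
      by_cases hr : x.role = .over
      · rw [lastUnder_succ w init h, if_neg (by simp [hr]), ← ih]
        simp [arcOf, h, hr]
      · rcases hr' : x.role with _ | _ | _
        · exact absurd hr' hr
        · simp [arcOf, h, hr']
        · simp [arcOf, h, hr']

theorem degFrom_arcOf (init : ℤ) (g : ℕ) :
    degFrom w init (arcOf w g) = degFrom w init g := by
  induction g with
  | zero => rfl
  | succ g ih =>
    cases h : w[g]? with
    | none => simp [arcOf, h]
    | some x =>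
      by_cases hr : x.role = .over
      · rw [degFrom_succ w init h, if_neg (by simp [hr]), ← ih]
        simp [arcOf, h, hr, Passage.step]
      · rcases hr' : x.role with _ | _ | _
        · exact absurd hr' hr
        · simp [arcOf, h, hr']
        · simp [arcOf, h, hr']

theorem lastUnder_init (init : Option ℕ) {g : ℕ} (hg : g ≤ w.length) :
    lastUnder w init g = (lastUnder w none g).or init := by
  induction g with
  | zero => simp [lastUnder]
  | succ g ih =>
    have h : w[g]? = some w[g] := List.getElem?_eq_getElem hg
    rw [lastUnder_succ w _ h, lastUnder_succ w _ h, ih (by omega)]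
    split_ifs <;> simp

theorem degFrom_init (init : ℤ) {g : ℕ} (hg : g ≤ w.length) :
    degFrom w init g = degFrom w 0 g + if lastUnder w none g = none then init else 0 := by
  induction g with
  | zero => simp [lastUnder, degFrom]
  | succ g ih =>
    have h : w[g]? = some w[g] := List.getElem?_eq_getElem hg
    rw [lastUnder_succ w _ h, degFrom_succ w _ h, degFrom_succ w _ h, ih (by omega)]
    split_ifs <;> simp_all
    ring

theorem lastUnder_spec {g u : ℕ} (hg : g ≤ w.length) (h : lastUnder w none g = some u) :
    u < g ∧ ∃ x, w[u]? = some x ∧ x.role = .under := by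
  induction g with
  | zero => simp [lastUnder] at h
  | succ g ih =>
    have hx : w[g]? = some w[g] := List.getElem?_eq_getElem hg
    rw [lastUnder_succ w _ hx] at h
    split_ifs at h with hr
    · obtain rfl : g = u := by simpa using h
      exact ⟨by omega, _, hx, hr⟩
    · obtain ⟨h1, h2⟩ := ih (by omega) h
      exact ⟨by omega, h2⟩

theorem lastUnder_ne_none {g u : ℕ} {x : Passage α} (hg : g ≤ w.length) (hu : u < g)
    (hx : w[u]? = some x) (hr : x.role = .under) : lastUnder w none g ≠ none := by
  induction g with
  | zero => omega
  | succ g ih =>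
    have h : w[g]? = some w[g] := List.getElem?_eq_getElem hg
    rw [lastUnder_succ w _ h]
    split_ifs with hr'
    · simp
    · refine ih (by omega) (lt_of_le_of_ne (by omega) ?_)
      rintro rfl
      rw [h] at hx
      obtain rfl := Option.some.inj hx
      exact hr' hr

theorem getElem?_crossing (v : Crossing w) : w[(v.1 : ℕ)]? = some w[v.1] :=
  List.getElem?_eq_getElem v.1.2

/-- The crossing that is named by an underpass. -/
def Crossing.mk' {w : List (Passage α)} {u : ℕ} {x : Passage α} (h : w[u]? = some x)
    (hr : x.role = .under) : Crossing w :=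
  ⟨⟨u, (List.getElem?_eq_some_iff.1 h).1⟩, by
    obtain ⟨_, rfl⟩ := List.getElem?_eq_some_iff.1 h; exact hr⟩

theorem longArcOf_eq {g : ℕ} (hg : g ≤ w.length) :
    longArcOf w g = (lastUnder w none g).or (lastUnder w none w.length) :=
  lastUnder_init w _ hg

theorem deg_eq {g : ℕ} (hg : g ≤ w.length) :
    deg w g = degFrom w 0 g
      + if lastUnder w none g = none then degFrom w 0 w.length else 0 :=
  degFrom_init w _ hg

theorem longArcOf_arcOf (g : ℕ) : longArcOf w (arcOf w g) = longArcOf w g :=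
  lastUnder_arcOf w _ g

theorem deg_arcOf (g : ℕ) : deg w (arcOf w g) = deg w g := degFrom_arcOf w _ g

theorem longArcOf_succ (v : Crossing w) : longArcOf w (v.1 + 1) = some (v.1 : ℕ) := by
  rw [longArcOf, lastUnder_succ w _ (getElem?_crossing w v), if_pos v.2]

theorem deg_succ (v : Crossing w) : deg w (v.1 + 1) = 0 := by
  rw [deg, degFrom_succ w _ (getElem?_crossing w v), if_pos v.2]

/-- The degree and the long arc of an edge depend only on its arc, so a sum over arcs that selects
the arc of one edge can be evaluated at that edge. -/
theorem sum_arcs {R : Type*} [CommRing R] {g : ℕ} (hg : g ≤ w.length) (j : ℕ) (x : R) :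
    ∑ a ∈ arcs w with longArcOf w a = some j,
        (C (if arcOf w g = a then x else 0) * T (deg w a) : LaurentPolynomial R)
      = if longArcOf w g = some j then C x * T (deg w g) else 0 := by
  have hm : arcOf w g ∈ arcs w :=
    Finset.mem_image_of_mem _ (Finset.mem_range.2 (by omega))
  have h1 : ∀ a, (C (if arcOf w g = a then x else 0) * T (deg w a) : LaurentPolynomial R)
      = if arcOf w g = a then C x * T (deg w a) else 0 := by
    intro a; split_ifs <;> simp
  simp only [h1]
  rw [Finset.sum_ite_eq]
  simp only [Finset.mem_filter, hm, true_and, longArcOf_arcOf, deg_arcOf]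

end Arcs

/-! ### The linear system in terms of the values behind the underpasses -/

section System

variable {α R : Type*} [CommRing R] [DecidableEq α] (τ : α → Rˣ) (w : List (Passage α))

/-- The coefficient at the value behind the underpass `u` of the value on edge `g`. -/
noncomputable def underCoeff (R : Type*) [CommRing R] (g u : ℕ) : LaurentPolynomial R :=
  if lastUnder w none g = some u then T (degFrom w 0 g) else 0

/-- The coefficient at the initial value of the value on edge `g`. -/
noncomputable def initCoeff (R : Type*) [CommRing R] (g : ℕ) : LaurentPolynomial R :=
  if lastUnder w none g = none then T (degFrom w 0 g) else 0

/-- An edge in front of all underpasses depends on the initial value. Replacing this by the final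
value joins the initial long arc to the final one and adds the final degree, as in the definition of
`deg`. -/
theorem underCoeff_add {g : ℕ} (hg : g ≤ w.length) (u : ℕ) :
    underCoeff w R g u + initCoeff w R g * underCoeff w R w.length u
      = if longArcOf w g = some u then T (deg w g) else 0 := by
  rw [longArcOf_eq w hg, deg_eq w hg, underCoeff, underCoeff, initCoeff]
  cases h : lastUnder w none g with
  | none =>
    by_cases hu : lastUnder w none w.length = some u <;>
      simp only [Option.none_or, reduceCtorEq, if_true, if_false, hu, zero_add, mul_zero, T_add]
  | some v => simp

/-- The value on edge `g`, as a linear form in the unknowns. -/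
noncomputable def edgeValue (τ : α → (LaurentPolynomial R)ˣ) (g : ℕ) :
    Option α → LaurentPolynomial R :=
  (wordBlock τ (sUnit R) (w.take g)).out none

theorem edgeValue_succ (τ : α → (LaurentPolynomial R)ˣ) {g : ℕ} {x : Passage α}
    (h : w[g]? = some x) :
    edgeValue w τ (g + 1) = (passageBlock τ (sUnit R) x).k • edgeValue w τ g
      + (passageBlock τ (sUnit R) x).d := by
  rw [edgeValue, edgeValue, List.take_add_one, h]
  simp only [Option.toList_some, wordBlock_append, wordBlock_cons, wordBlock_nil, mul_one]
  ext i
  simp [Block.out, add_assoc, mul_assoc]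

/-- Behind the last underpass, only virtual crossings act on the value, so it is the value there
times `s` to the current degree; before the first underpass the initial value plays this role. -/
theorem edgeValue_eq (τ : α → (LaurentPolynomial R)ˣ) {g : ℕ} (hg : g ≤ w.length) :
    edgeValue w τ g = ∑ u : Crossing w, underCoeff w R g u.1 • edgeValue w τ (u.1 + 1)
      + initCoeff w R g • Pi.single none 1 := by
  induction g with
  | zero =>
    have : edgeValue w τ 0 = Pi.single none 1 := by simp [edgeValue, Block.out]
    simp [this, underCoeff, initCoeff, lastUnder, degFrom]
  | succ g ih =>
    have h : w[g]? = some w[g] := List.getElem?_eq_getElem hg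
    have ih := ih (by omega)
    by_cases hr : w[g].role = .under
    · have h1 : ∀ u : Crossing w, underCoeff w R (g + 1) u.1
          = if u = Crossing.mk' h hr then 1 else 0 := by
        intro u
        rw [underCoeff, lastUnder_succ w _ h, degFrom_succ w _ h, if_pos hr, if_pos hr, T_zero]
        congr 1
        simp only [Option.some.injEq, Crossing.mk', Subtype.ext_iff, Fin.ext_iff, eq_comm]
      have h2 : initCoeff w R (g + 1) = 0 := by
        rw [initCoeff, lastUnder_succ w _ h, if_pos hr]; simp
      simp only [h1, h2, ite_smul, one_smul, zero_smul, Finset.sum_ite_eq', Finset.mem_univ,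
        if_true, add_zero]
      rfl
    · have hk : (passageBlock τ (sUnit R) w[g]).k = T w[g].step := by
        rcases hr' : w[g].role with _ | _ | _
        · simp [passageBlock_over _ _ hr', Passage.step, hr']
        · exact absurd hr' hr
        · rw [passageBlock_virt _ _ hr', Passage.step, if_pos hr']
          split_ifs <;> rfl
      have hd : (passageBlock τ (sUnit R) w[g]).d = 0 := by
        rcases hr' : w[g].role with _ | _ | _
        · simp [passageBlock_over _ _ hr']
        · exact absurd hr' hr
        · simp [passageBlock_virt _ _ hr']
      have h1 : ∀ u, underCoeff w R (g + 1) u = T w[g].step * underCoeff w R g u := by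
        intro u
        rw [underCoeff, lastUnder_succ w _ h, degFrom_succ w _ h, if_neg hr, if_neg hr, T_add,
          underCoeff]
        split_ifs
        · rw [mul_comm]
        · rw [mul_zero]
      have h2 : initCoeff w R (g + 1) = T w[g].step * initCoeff w R g := by
        rw [initCoeff, lastUnder_succ w _ h, degFrom_succ w _ h, if_neg hr, if_neg hr, T_add,
          initCoeff]
        split_ifs
        · rw [mul_comm]
        · rw [mul_zero]
      rw [edgeValue_succ w τ h, hk, hd, add_zero]
      simp only [h1, h2, mul_smul, ← Finset.smul_sum, ← smul_add]
      rw [← ih]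

/-- The edges whose values are recorded in a row of the system. -/
def recorded (i : Option α) : Finset ℕ :=
  match i with
  | none => {w.length}
  | some l => (Finset.range w.length).filter fun g =>
      ((w[g]?).map fun x => decide (x.role = .over ∧ x.label = l)) = some true

/-- An overpass at position `g` records the value of edge `g`, which ends there; the row `none`
records the last edge. The proof accumulates the records over prefixes. -/
theorem obs_eq (τ : α → (LaurentPolynomial R)ˣ) (i j : Option α) :
    (wordBlock τ (sUnit R) w).obs none i j = ∑ g ∈ recorded w i, edgeValue w τ g j := by
  have key : ∀ g ≤ w.length, ∀ i,
      (wordBlock τ (sUnit R) (w.take g)).r i * (Pi.single none 1 : Option α → _) j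
        + (wordBlock τ (sUnit R) (w.take g)).c i j
      = match i with
        | none => 0
        | some l => ∑ h ∈ (Finset.range g).filter (fun g =>
            ((w[g]?).map fun x => decide (x.role = .over ∧ x.label = l)) = some true),
              edgeValue w τ h j := by
    intro g hg i
    induction g with
    | zero => cases i <;> simp
    | succ g ih =>
      have h : w[g]? = some w[g] := List.getElem?_eq_getElem hg
      have ih := ih (by omega)
      have hc : (passageBlock τ (sUnit R) w[g]).c = 0 := by
        unfold passageBlock; split <;> rfl
      have h1 : (wordBlock τ (sUnit R) (w.take (g + 1))).r i
            * (Pi.single none 1 : Option α → _) j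
          + (wordBlock τ (sUnit R) (w.take (g + 1))).c i j
          = ((wordBlock τ (sUnit R) (w.take g)).r i * (Pi.single none 1 : Option α → _) j
            + (wordBlock τ (sUnit R) (w.take g)).c i j)
            + (passageBlock τ (sUnit R) w[g]).r i * edgeValue w τ g j := by
        rw [List.take_add_one, h]
        simp only [Option.toList_some, wordBlock_append, wordBlock_cons, wordBlock_nil, mul_one,
          Block.mul_r, Block.mul_c, hc, add_zero, Matrix.add_apply, vecMulVec_apply, Pi.add_apply,
          Pi.smul_apply, smul_eq_mul, edgeValue, Block.out, Matrix.zero_apply]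
        ring
      rw [h1, ih]
      cases i with
      | none =>
        have : (passageBlock τ (sUnit R) w[g]).r none = 0 := by
          unfold passageBlock; split <;> simp
        simp [this]
      | some l =>
        simp only [Finset.range_add_one, Finset.filter_insert, h, Option.map_some]
        by_cases hl : w[g].role = .over ∧ w[g].label = l
        · rw [if_pos (by simp [hl]), Finset.sum_insert (by simp)]
          simp [passageBlock_over _ _ hl.1, hl.2, add_comm]
        · rw [if_neg (by simp [hl])]
          have : (passageBlock τ (sUnit R) w[g]).r (some l) = 0 := by
            rcases hr' : w[g].role with _ | _ | _
            · have : l ≠ w[g].label := fun h => hl ⟨hr', h.symm⟩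
              simp [passageBlock_over _ _ hr', this]
            · simp [passageBlock_under _ _ hr']
            · simp [passageBlock_virt _ _ hr']
          simp [this]
  have h := key w.length le_rfl i
  rw [List.take_length] at h
  simp only [Block.obs, Matrix.add_apply, vecMulVec_apply]
  rw [h]
  have he : edgeValue w τ w.length = (wordBlock τ (sUnit R) w).out none := by
    rw [edgeValue, List.take_length]
  cases i with
  | none => simp [recorded, he]
  | some l => simp [recorded]

end System

end LongVirtual

namespace LongVirtual

open Matrix LaurentPolynomial

/-! ### The determinant of the passages is the determinant of the arcs -/

theorem Passage.partner_partner {α : Type*} (x : Passage α) : x.partner.partner = x := by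
  rcases x with ⟨l, r, b⟩
  cases r <;> simp [Passage.partner, Role.swap]

theorem Passage.weight_of_under {α : Type*} {x : Passage α} (h : x.role = .under) :
    (x.weight : CoeffRing) = qPow (if x.ltr then -1 else 1) ∧
      (x.partner.weight : CoeffRing) = pPow (if x.ltr then -1 else 1) := by
  rcases x with ⟨l, r, b⟩
  obtain rfl : r = .under := h
  cases b <;> exact ⟨rfl, rfl⟩

section Positions

variable {α : Type*} [DecidableEq α]

/-- The position of the other passage. -/
theorem WellFormed.exists_partner {w : List (Passage α)} (hw : WellFormed w) {g : ℕ}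
    {x : Passage α} (hx : w[g]? = some x) :
    ∃ g', g' ≠ g ∧ w[g']? = some x.partner ∧
      (∀ k y, w[k]? = some y → y.label = x.label → k = g ∨ k = g') ∧
      weight w x.label = if g < g' then x.weight else x.partner.weight := by
  have hm : x ∈ passagesAt w x.label := mem_passagesAt.2 ⟨List.mem_of_getElem? hx, rfl⟩
  rcases hw x.label with h | ⟨y, h⟩
  · rw [h] at hm; simp at hm
  have hwt : weight w x.label = y.weight := by simp [weight, h]
  rw [passagesAt, List.filter_eq_cons_iff] at h
  obtain ⟨l₁, l, rfl, h₁, hy, h⟩ := h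
  rw [List.filter_eq_cons_iff] at h
  obtain ⟨l₂, l₃, rfl, h₂, hy', h₃⟩ := h
  rw [List.filter_eq_nil_iff] at h₃
  simp only [decide_eq_true_eq] at h₁ h₂ h₃ hy hy'
  set w := l₁ ++ y :: (l₂ ++ y.partner :: l₃) with hwdef
  have e0 : w[l₁.length]? = some y := by simp [hwdef]
  have e1 : w[l₁.length + (l₂.length + 1)]? = some y.partner := by
    rw [hwdef, List.getElem?_append_right (by omega)]
    simp
  have hall : ∀ k z, w[k]? = some z → z.label = x.label →
      k = l₁.length ∨ k = l₁.length + (l₂.length + 1) := by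
    intro k z hk hz
    by_contra! hne
    rcases lt_or_ge k l₁.length with h | h
    · rw [hwdef, List.getElem?_append_left h] at hk
      exact h₁ z (List.mem_of_getElem? hk) hz
    · obtain ⟨m, rfl⟩ := Nat.exists_eq_add_of_le h
      rw [hwdef, List.getElem?_append_right h, Nat.add_sub_cancel_left] at hk
      obtain ⟨m, rfl⟩ : ∃ m', m = m' + 1 := Nat.exists_eq_succ_of_ne_zero (by omega)
      rw [List.getElem?_cons_succ] at hk
      rcases lt_or_ge m l₂.length with h' | h'
      · rw [List.getElem?_append_left h'] at hk
        exact h₂ z (List.mem_of_getElem? hk) hz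
      · obtain ⟨n, rfl⟩ := Nat.exists_eq_add_of_le h'
        rw [List.getElem?_append_right h', Nat.add_sub_cancel_left] at hk
        obtain ⟨n, rfl⟩ : ∃ n', n = n' + 1 := Nat.exists_eq_succ_of_ne_zero (by omega)
        rw [List.getElem?_cons_succ] at hk
        exact h₃ z (List.mem_of_getElem? hk) hz
  rcases hall g x hx rfl with rfl | rfl
  · obtain rfl : x = y := by rw [e0] at hx; exact (Option.some.inj hx).symm
    refine ⟨_, by omega, e1, hall, ?_⟩
    rw [hwt, if_pos (by omega)]
  · obtain rfl : x = y.partner := by rw [e1] at hx; exact (Option.some.inj hx).symm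
    refine ⟨_, by omega, ?_, fun k z hk hz => (hall k z hk hz).symm, ?_⟩
    · rw [e0, Passage.partner_partner]
    · rw [hwt, if_neg (by omega), Passage.partner_partner]

/-- The overpass of a crossing. -/
theorem WellFormed.exists_over {w : List (Passage α)} (hw : WellFormed w) (v : Crossing w) :
    ∃ o : Fin w.length, (∀ o', IsOverpassOf w v o' ↔ o' = o) ∧
      recorded w (some w[v.1].label) = {(o : ℕ)} ∧
      (weight w w[v.1].label : CoeffRing) = tPow w v := by
  obtain ⟨g, hne, hg, hall, hwt⟩ := hw.exists_partner (getElem?_crossing w v)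
  obtain ⟨hlt, hg'⟩ := List.getElem?_eq_some_iff.1 hg
  have hv := v.2
  have ho : ∀ o', IsOverpassOf w v o' ↔ o' = ⟨g, hlt⟩ := by
    intro o'
    constructor
    · rintro ⟨h1, h2⟩
      rcases hall o' _ (List.getElem?_eq_getElem o'.2) h1 with h | h
      · have : o' = v.1 := Fin.ext h
        rw [this, v.2] at h2
        exact absurd h2 (by simp)
      · exact Fin.ext h
    · rintro rfl
      have hg'' : w[(⟨g, hlt⟩ : Fin w.length)] = w[v.1].partner := hg'
      exact ⟨by rw [hg'']; rfl, by rw [hg'', Passage.partner_role, v.2]; rfl⟩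
  refine ⟨⟨g, hlt⟩, ho, ?_, ?_⟩
  · ext k
    simp only [recorded, Finset.mem_filter, Finset.mem_range, Finset.mem_singleton]
    constructor
    · rintro ⟨hk, h⟩
      simp only [List.getElem?_eq_getElem hk, Option.map_some, Option.some.injEq,
        decide_eq_true_eq] at h
      have := (ho ⟨k, hk⟩).1 ⟨h.2, h.1⟩
      exact congrArg Fin.val this
    · rintro rfl
      refine ⟨hlt, ?_⟩
      obtain ⟨h1, h2⟩ := (ho ⟨k, hlt⟩).2 rfl
      simp only [List.getElem?_eq_getElem hlt, Option.map_some, Option.some.injEq,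
        decide_eq_true_eq]
      exact ⟨h2, h1⟩
  · obtain ⟨hq, hp⟩ := Passage.weight_of_under v.2
    have : (∃ o, IsOverpassOf w v o ∧ o < v.1) ↔ g < v.1 := by
      simp only [ho, exists_eq_left]
      rfl
    rw [hwt, tPow]
    by_cases h : g < v.1
    · rw [if_neg (by omega), if_pos (this.2 h)]
      exact hp
    · have h' : (v.1 : ℕ) < g := by omega
      rw [if_pos h', if_neg fun hh => h (this.1 hh)]
      exact hq

end Positions

/-- Both sides are the determinant of the block matrix with rows `A B` and `E D`, computed by column
operations. The equations for `S` and `S'` take the place of inverses of `A` and `D`. -/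
theorem det_mul_eq_of_eliminate {m n R : Type*} [CommRing R] [Fintype m] [DecidableEq m]
    [Fintype n] [DecidableEq n] {A : Matrix m m R} {B : Matrix m n R} {E : Matrix n m R}
    {D : Matrix n n R} {S : Matrix m n R} {S' : Matrix n m R} (h : A * S + B = 0)
    (h' : E + D * S' = 0) : A.det * (E * S + D).det = (A + B * S').det * D.det := by
  have h1 : fromBlocks A B E D * fromBlocks 1 S 0 1 = fromBlocks A 0 E (E * S + D) := by
    rw [fromBlocks_multiply]
    simp [h]
  have h2 : fromBlocks A B E D * fromBlocks 1 0 S' 1 = fromBlocks (A + B * S') B 0 D := by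
    rw [fromBlocks_multiply]
    simp [h']
  have h1 := congrArg det h1
  have h2 := congrArg det h2
  rw [det_mul, det_fromBlocks_zero₂₁, det_one, det_one, mul_one, mul_one,
    det_fromBlocks_zero₁₂] at h1
  rw [det_mul, det_fromBlocks_zero₁₂, det_one, det_one, mul_one, mul_one,
    det_fromBlocks_zero₂₁] at h2
  rw [← h1, h2]

/-! ### Comparison of the two linear systems -/

section Bridge

variable {α : Type*} {w : List (Passage α)}

theorem zetaMatrix_apply {v : Crossing w} {o : Fin w.length}
    (ho : ∀ o', IsOverpassOf w v o' ↔ o' = o) (u : Crossing w) :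
    zetaMatrix w v u = (if v = u then 1 else 0)
      + (if longArcOf w o = some (u.1 : ℕ) then C (tPow w v - 1) * T (deg w o) else 0)
      + (if longArcOf w v.1 = some (u.1 : ℕ) then C (-tPow w v) * T (deg w v.1) else 0) := by
  have hi : ∀ a, incidence w v a = (if arcOf w (v.1 + 1) = a then 1 else 0)
      + (if arcOf w o = a then tPow w v - 1 else 0)
      + (if arcOf w v.1 = a then -tPow w v else 0) := by
    intro a
    have : (∃ o', IsOverpassOf w v o' ∧ arcOf w o' = a) ↔ arcOf w o = a := by
      simp only [ho, exists_eq_left]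
    rw [incidence]
    simp only [this]
  have hv := v.1.2
  unfold zetaMatrix
  simp only [hi, map_add, add_mul, Finset.sum_add_distrib]
  rw [sum_arcs w (by omega), sum_arcs w o.2.le, sum_arcs w (by omega), longArcOf_succ, deg_succ]
  congr 2
  rw [map_one, T_zero, mul_one]
  simp only [Option.some.injEq, Subtype.ext_iff, Fin.ext_iff]

/-- The joint system has as unknowns the values behind the underpasses and those on the overpasses,
together with the initial value. Eliminating the former leaves the system of `lineDet`, eliminating
the latter the matrix of `ζ`; both eliminations are unimodular. -/
theorem lineDet_eq_zetaOf [DecidableEq α] [Fintype α] (hw : WellFormed w) (hN : lastUnder w none w.length ≠ none) :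
    lineDet w = zetaOf w := by
  let τ := weightC w
  let t : Crossing w → LaurentPolynomial CoeffRing := fun v => τ w[v.1].label
  let A : Matrix (Crossing w) (Crossing w) (LaurentPolynomial CoeffRing) :=
    1 - of fun v u => t v * underCoeff w CoeffRing v.1 u.1
  let B : Matrix (Crossing w) (Option α) (LaurentPolynomial CoeffRing) := of fun v =>
    -(t v * initCoeff w CoeffRing v.1) • Pi.single none 1 - (1 - t v) • Pi.single (some w[v.1].label) 1
  let E : Matrix (Option α) (Crossing w) (LaurentPolynomial CoeffRing) := of fun i u =>
    -∑ g ∈ recorded w i, underCoeff w CoeffRing g u.1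
  let V : Matrix (Option α) (Option α) (LaurentPolynomial CoeffRing) :=
    vecMulVec (fun i => ∑ g ∈ recorded w i, initCoeff w CoeffRing g) (Pi.single none 1)
  let D := 1 - V
  let S : Matrix (Crossing w) (Option α) (LaurentPolynomial CoeffRing) := of fun v =>
    edgeValue w τ (v.1 + 1)
  let S' : Matrix (Option α) (Crossing w) (LaurentPolynomial CoeffRing) := of fun i u =>
    ∑ g ∈ recorded w i,
      (underCoeff w CoeffRing g u.1 + initCoeff w CoeffRing g * underCoeff w CoeffRing w.length u.1)
  have hA' : ∀ v u, A v u
      = (if v = u then 1 else 0) - t v * underCoeff w CoeffRing v.1 u.1 := fun v u => by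
    rw [← one_apply]; rfl
  have hB' : ∀ v, B v = -(t v * initCoeff w CoeffRing v.1) • Pi.single none 1
      - (1 - t v) • Pi.single (some w[v.1].label) 1 := fun _ => rfl
  have hle : ∀ i, ∀ g ∈ recorded w i, g ≤ w.length := by
    intro i g hg
    cases i with
    | none => simp [recorded] at hg; omega
    | some l => simp [recorded] at hg; omega
  -- As there is an underpass, the final value does not depend directly on the initial one. Without
  -- this, `D` would not have determinant `1`.
  have hinit : initCoeff w CoeffRing w.length = 0 := if_neg hN
  have hAS : A * S + B = 0 := by
    ext1 v
    intro j
    have h1 := edgeValue_succ w τ (getElem?_crossing w v)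
    rw [edgeValue_eq w τ v.1.2.le, passageBlock_under _ _ v.2] at h1
    have h2 := congrFun h1 j
    simp only [Pi.add_apply, Pi.smul_apply, Finset.sum_apply, smul_eq_mul] at h2
    have h3 : (A * S) v j = S v j - t v * ∑ u, underCoeff w CoeffRing v.1 u.1 * S u j := by
      simp only [Matrix.mul_apply, hA', sub_mul, ite_mul, one_mul, zero_mul,
        Finset.sum_sub_distrib, Finset.sum_ite_eq, Finset.mem_univ, if_true, mul_assoc,
        ← Finset.mul_sum]
    have h4 : S v j = edgeValue w τ (v.1 + 1) j := rfl
    rw [Matrix.add_apply, h3, h4, h2, hB']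
    simp only [Pi.sub_apply, Pi.smul_apply, smul_eq_mul, Matrix.zero_apply, S, of_apply, t]
    ring
  have hES : E * S + D = (wordBlock τ (sUnit CoeffRing) w).mat none := by
    ext1 i
    intro j
    have h2 : ∑ g ∈ recorded w i, edgeValue w τ g j
        = ∑ u, (∑ g ∈ recorded w i, underCoeff w CoeffRing g u.1) * S u j
          + (∑ g ∈ recorded w i, initCoeff w CoeffRing g) * (Pi.single none 1 : Option α → _) j := by
      simp only [Finset.sum_mul]
      rw [Finset.sum_comm, ← Finset.sum_add_distrib]
      refine Finset.sum_congr rfl fun g hg => ?_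
      rw [edgeValue_eq w τ (hle i g hg)]
      simp only [Pi.add_apply, Pi.smul_apply, Finset.sum_apply, smul_eq_mul, S, of_apply]
    rw [Block.mat, Matrix.sub_apply, obs_eq, h2]
    simp only [E, D, V, Matrix.sub_apply, Matrix.add_apply, Matrix.mul_apply,
      of_apply, vecMulVec_apply, neg_mul, Finset.sum_neg_distrib]
    ring
  have hnone : ∀ u, S' none u = underCoeff w CoeffRing w.length u.1 := by
    intro u
    simp only [S', of_apply, recorded, Finset.sum_singleton, hinit, zero_mul, add_zero]
  have hDS : E + D * S' = 0 := by
    ext1 i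
    intro u
    have : (V * S') i u
        = (∑ g ∈ recorded w i, initCoeff w CoeffRing g) * underCoeff w CoeffRing w.length u.1 := by
      simp only [V]
      rw [vecMulVec_mul, single_one_vecMul, vecMulVec_apply]
      exact congrArg _ (hnone u)
    have hD' : D * S' = S' - V * S' := by rw [Matrix.sub_mul, Matrix.one_mul]
    rw [hD', Matrix.add_apply, Matrix.sub_apply, this]
    simp only [Matrix.zero_apply, E, S', of_apply, Finset.sum_add_distrib, Finset.sum_mul]
    ring
  -- Row `v` now reads: the value leaving `v`, plus `t - 1` times the value on its overpass, minus
  -- `t` times the value entering `v`. These are the incidence coefficients.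
  have hABS : A + B * S' = zetaMatrix w := by
    ext1 v
    intro u
    obtain ⟨o, ho, hr, ht⟩ := hw.exists_over v
    have ht' : t v = C (tPow w v) := by rw [← ht]; rfl
    have h1 : S' (some w[v.1].label) u
        = if longArcOf w o = some (u.1 : ℕ) then T (deg w o) else 0 := by
      simp only [S', of_apply, hr, Finset.sum_singleton]
      exact underCoeff_add w o.2.le _
    have h2 : (B * S') v u = -(t v * initCoeff w CoeffRing v.1) * S' none u
        - (1 - t v) * S' (some w[v.1].label) u := by
      rw [Matrix.mul_apply_eq_vecMul]
      rw [hB', sub_vecMul, smul_vecMul, smul_vecMul, single_one_vecMul, single_one_vecMul]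
      rfl
    have h3 := underCoeff_add w (R := CoeffRing) (g := v.1) v.1.2.le u.1
    rw [zetaMatrix_apply ho, Matrix.add_apply, h2, h1, hnone, hA']
    have e1 : (if longArcOf w o = some (u.1 : ℕ) then C (tPow w v - 1) * T (deg w o)
          else (0 : LaurentPolynomial CoeffRing))
        = (t v - 1) * if longArcOf w o = some (u.1 : ℕ) then T (deg w o) else 0 := by
      rw [map_sub, map_one, ht']; split_ifs <;> simp only [mul_zero]
    have e2 : (if longArcOf w v.1 = some (u.1 : ℕ) then C (-tPow w v) * T (deg w v.1)
          else (0 : LaurentPolynomial CoeffRing))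
        = -t v * if longArcOf w v.1 = some (u.1 : ℕ) then T (deg w v.1) else 0 := by
      rw [map_neg, ht']; split_ifs <;> simp only [mul_zero]
    rw [e1, e2, ← h3]
    ring
  -- The value in front of an underpass involves only earlier underpasses, so `A` is unitriangular.
  have hA : A.det = 1 := by
    rw [det_of_isLowerTriangular A]
    · refine Finset.prod_eq_one fun v _ => ?_
      have : underCoeff w CoeffRing v.1 v.1 = 0 := if_neg fun h =>
        absurd (lastUnder_spec w v.1.2.le h).1 (lt_irrefl _)
      simp [hA', this]
    · intro v u h
      have hvu : v < u := h
      have : underCoeff w CoeffRing v.1 u.1 = 0 := if_neg fun h =>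
        absurd (lastUnder_spec w v.1.2.le h).1 (not_lt.2 (le_of_lt hvu))
      simp [hA', this, hvu.ne]
  have hD : D.det = 1 := by
    rw [det_one_sub_vecMulVec]
    simp [recorded, hinit]
  have := det_mul_eq_of_eliminate hAS hDS
  rw [hA, hD, hES, hABS, one_mul, mul_one] at this
  exact this

end Bridge

end LongVirtual

namespace LongVirtual

open Matrix LaurentPolynomial

/-! ### The degree -/

section Degree

variable {R : Type*} [CommRing R]

theorem degree_le_iff {f : LaurentPolynomial R} {n : ℤ} :
    f.degree ≤ (n : WithBot ℤ) ↔ ∀ k, n < k → f.coeff k = 0 := by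
  rw [LaurentPolynomial.degree, Finset.max_le_iff]
  simp only [Finsupp.mem_support_iff, WithBot.coe_le_coe]
  refine forall_congr' fun k => ?_
  rw [← not_lt, not_imp_not]

theorem degree_mul_le {f g : LaurentPolynomial R} {m n : ℤ} (hf : f.degree ≤ (m : WithBot ℤ))
    (hg : g.degree ≤ (n : WithBot ℤ)) : (f * g).degree ≤ ((m + n : ℤ) : WithBot ℤ) := by
  rw [LaurentPolynomial.degree, Finset.max_le_iff] at *
  intro k hk
  obtain ⟨a, ha, b, hb, rfl⟩ := Finset.mem_add.1 (AddMonoidAlgebra.support_coeff_mul_subset f g hk)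
  have h1 := WithBot.coe_le_coe.1 (hf a ha)
  have h2 := WithBot.coe_le_coe.1 (hg b hb)
  exact WithBot.coe_le_coe.2 (add_le_add h1 h2)

theorem degree_add_le {f g : LaurentPolynomial R} {n : ℤ} (hf : f.degree ≤ (n : WithBot ℤ))
    (hg : g.degree ≤ (n : WithBot ℤ)) : (f + g).degree ≤ (n : WithBot ℤ) := by
  rw [degree_le_iff] at *
  intro k hk
  rw [AddMonoidAlgebra.coeff_add, Finsupp.add_apply, hf k hk, hg k hk, add_zero]

theorem degree_sum_le {ι : Type*} {s : Finset ι} {f : ι → LaurentPolynomial R} {n : ℤ}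
    (h : ∀ i ∈ s, (f i).degree ≤ (n : WithBot ℤ)) :
    (∑ i ∈ s, f i).degree ≤ (n : WithBot ℤ) := by
  classical
  induction s using Finset.induction_on with
  | empty => simp
  | insert a s ha ih =>
    rw [Finset.sum_insert ha]
    exact degree_add_le (h a (by simp)) (ih fun i hi => h i (by simp [hi]))

theorem degree_prod_le {ι : Type*} {s : Finset ι} {f : ι → LaurentPolynomial R} {b : ι → ℤ}
    (h : ∀ i ∈ s, (f i).degree ≤ (b i : WithBot ℤ)) :
    (∏ i ∈ s, f i).degree ≤ ((∑ i ∈ s, b i : ℤ) : WithBot ℤ) := by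
  classical
  induction s using Finset.induction_on with
  | empty => simpa using degree_C_le (1 : R)
  | insert a s ha ih =>
    rw [Finset.prod_insert ha, Finset.sum_insert ha]
    exact degree_mul_le (h a (by simp)) (ih fun i hi => h i (by simp [hi]))

theorem degree_neg (f : LaurentPolynomial R) : (-f).degree = f.degree := by
  rw [LaurentPolynomial.degree, LaurentPolynomial.degree, AddMonoidAlgebra.coeff_neg,
    Finsupp.support_neg]

theorem degree_det_le {ι : Type*} [Fintype ι] [DecidableEq ι]
    {M : Matrix ι ι (LaurentPolynomial R)} {b : ι → ℤ}
    (h : ∀ i j, (M i j).degree ≤ (b j : WithBot ℤ)) :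
    M.det.degree ≤ ((∑ j, b j : ℤ) : WithBot ℤ) := by
  rw [det_apply]
  refine degree_sum_le fun σ _ => ?_
  have := degree_prod_le (s := Finset.univ) (f := fun i => M (σ i) i) fun i _ => h (σ i) i
  rcases Int.units_eq_one_or (Equiv.Perm.sign σ) with h | h <;> rw [h]
  · simpa using this
  · simpa [degree_neg] using this

end Degree

section Bound

variable {α : Type*} (w : List (Passage α))

/-- The passages through virtual crossings from the left to the right. -/
def virtUp : Finset ℕ :=
  (Finset.range w.length).filter fun h => (w[h]?).any fun x => x.role = .virt && x.ltr

theorem mem_virtUp {h : ℕ} : h ∈ virtUp w ↔ ∃ x, w[h]? = some x ∧ x.role = .virt ∧ x.ltr := by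
  simp only [virtUp, Finset.mem_filter, Finset.mem_range]
  constructor
  · rintro ⟨h1, h2⟩
    rw [List.getElem?_eq_getElem h1] at h2 ⊢
    exact ⟨_, rfl, by simpa using h2⟩
  · rintro ⟨x, h1, h2⟩
    exact ⟨(List.getElem?_eq_some_iff.1 h1).1, by simpa [h1] using h2⟩

/-- Only left-to-right virtual passages since the last underpass can raise the degree. A passage `h`
is counted through edge `h`, which ends at it. -/
theorem degFrom_le {g : ℕ} (hg : g ≤ w.length) :
    degFrom w 0 g
      ≤ ((virtUp w).filter fun h => h < g ∧ lastUnder w none h = lastUnder w none g).card := by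
  induction g with
  | zero => simp [degFrom]
  | succ g ih =>
    have h : w[g]? = some w[g] := List.getElem?_eq_getElem hg
    have ih := ih (by omega)
    rw [degFrom_succ w _ h, lastUnder_succ w _ h]
    by_cases hr : w[g].role = .under
    · rw [if_pos hr]; positivity
    · rw [if_neg hr, if_neg hr]
      set s := (virtUp w).filter fun h => h < g ∧ lastUnder w none h = lastUnder w none g
      set t := (virtUp w).filter fun h => h < g + 1 ∧ lastUnder w none h = lastUnder w none g
      have hst : s ⊆ t := fun k hk => by
        simp only [s, t, Finset.mem_filter] at hk ⊢
        exact ⟨hk.1, by omega, hk.2.2⟩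
      by_cases hv : w[g].role = .virt ∧ w[g].ltr
      · have hi : insert g s ⊆ t := Finset.insert_subset
          (by simp only [t, Finset.mem_filter]
              exact ⟨(mem_virtUp w).2 ⟨_, h, hv⟩, by omega, trivial⟩) hst
        have hc := Finset.card_le_card hi
        rw [Finset.card_insert_of_notMem (by simp [s])] at hc
        rw [Passage.step, if_pos hv.1, if_pos hv.2]
        omega
      · have hc := Finset.card_le_card hst
        have : w[g].step ≤ 0 := by
          unfold Passage.step
          split_ifs with h1 h2
          · exact absurd ⟨h1, h2⟩ hv
          · omega
          · omega
        omega

theorem deg_le {g : ℕ} (hg : g ≤ w.length) {j : ℕ} (hj : longArcOf w g = some j) :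
    deg w g ≤ ((virtUp w).filter fun h => longArcOf w h = some j).card := by
  have hlt : ∀ h ∈ virtUp w, h ≤ w.length := fun h hh => by
    simp only [virtUp, Finset.mem_filter, Finset.mem_range] at hh
    omega
  have h1 := degFrom_le w hg
  have h2 := degFrom_le w (g := w.length) le_rfl
  rw [deg_eq w hg]
  rw [longArcOf_eq w hg] at hj
  cases hl : lastUnder w none g with
  | some u =>
    rw [hl] at hj h1
    obtain rfl : u = j := by simpa using hj
    rw [if_neg (by simp), add_zero]
    refine h1.trans (Nat.cast_le.2 (Finset.card_le_card fun h hh => ?_))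
    simp only [Finset.mem_filter] at hh ⊢
    rw [longArcOf_eq w (hlt h hh.1), hh.2.2]
    exact ⟨hh.1, rfl⟩
  | none =>
    rw [hl] at hj h1
    have hj : lastUnder w none w.length = some j := by simpa using hj
    rw [if_pos rfl]
    rw [hj] at h2
    -- On the united long arc the final piece contributes its total degree to the initial one. The
    -- passages on the two pieces are distinguished by their last underpass, so none is counted
    -- twice.
    refine (add_le_add h1 h2).trans ?_
    rw [← Nat.cast_add, ← Finset.card_union_of_disjoint]
    · refine Nat.cast_le.2 (Finset.card_le_card fun h hh => ?_)
      simp only [Finset.mem_union, Finset.mem_filter] at hh ⊢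
      rcases hh with hh | hh
      · rw [longArcOf_eq w (hlt h hh.1), hh.2.2]
        exact ⟨hh.1, hj⟩
      · rw [longArcOf_eq w (hlt h hh.1), hh.2.2]
        exact ⟨hh.1, rfl⟩
    · rw [Finset.disjoint_left]
      intro h hh hh'
      simp only [Finset.mem_filter] at hh hh'
      rw [hh.2.2] at hh'
      simp at hh'

theorem arcOf_le (g : ℕ) : arcOf w g ≤ g := by
  induction g with
  | zero => exact le_rfl
  | succ g ih =>
    rw [arcOf]
    split
    · omega
    · exact le_rfl

/-- Each term of the determinant takes one entry from every column, and a virtual passage belongs to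
only one long arc. The bounds for the columns thus add up to at most the number of all left-to-right
virtual passages. -/
theorem degree_zetaOf_le : (zetaOf w).degree ≤ (((virtUp w).card : ℤ) : WithBot ℤ) := by
  have h : ∀ v j, (zetaMatrix w v j).degree
      ≤ ((((virtUp w).filter fun h => longArcOf w h = some (j.1 : ℕ)).card : ℤ) :
        WithBot ℤ) := by
    intro v j
    refine degree_sum_le fun a ha => ?_
    simp only [arcs, Finset.mem_filter, Finset.mem_image, Finset.mem_range] at ha
    obtain ⟨⟨g, hg, rfl⟩, hj⟩ := ha
    have := arcOf_le w g
    exact (degree_C_mul_T_le _ _).trans (WithBot.coe_le_coe.2 (deg_le w (by omega) hj))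
  refine (degree_det_le h).trans (WithBot.coe_le_coe.2 ?_)
  rw [← Nat.cast_sum, ← Finset.card_biUnion]
  · exact Nat.cast_le.2 (Finset.card_le_card
      (Finset.biUnion_subset.2 fun _ _ => Finset.filter_subset _ _))
  · intro i _ j _ hij
    change Disjoint _ _
    rw [Finset.disjoint_left]
    intro h hh hh'
    simp only [Finset.mem_filter] at hh hh'
    rw [hh.2] at hh'
    exact hij (Subtype.ext (Fin.ext (Option.some.inj hh'.2)))

variable [DecidableEq α]

/-- The value is never renewed, and closing up leaves the equation that the initial value equals
itself times a power of `s`. Here the determinant may differ from `ζ`, which is the empty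
determinant `1`. -/
theorem lineDet_of_no_under [Fintype α] {w : List (Passage α)}
    (h : lastUnder w none w.length = none) : lineDet w = 1 - T (degFrom w 0 w.length) := by
  have hE : IsEmpty (Crossing w) :=
    ⟨fun v => lastUnder_ne_none w le_rfl v.1.2 (getElem?_crossing w v) v.2 h⟩
  have hle : ∀ i, ∀ g ∈ recorded w i, g ≤ w.length := by
    intro i g hg
    cases i with
    | none => simp [recorded] at hg; omega
    | some l => simp [recorded] at hg; omega
  have : (wordBlock (weightC w) (sUnit CoeffRing) w).mat none
      = 1 - vecMulVec (fun i => ∑ g ∈ recorded w i, initCoeff w CoeffRing g)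
        (Pi.single none 1) := by
    ext1 i
    intro j
    rw [Block.mat, Matrix.sub_apply, Matrix.sub_apply, obs_eq, vecMulVec_apply, Finset.sum_mul]
    congr 1
    refine Finset.sum_congr rfl fun g hg => ?_
    rw [edgeValue_eq w _ (hle i g hg), Fintype.sum_empty, zero_add]
    rfl
  rw [lineDet, wordDet, this, det_one_sub_vecMulVec]
  simp [recorded, initCoeff, h]

theorem degree_lineDet_le [Fintype α] {w : List (Passage α)} (hw : WellFormed w) :
    (lineDet w).degree ≤ (((virtUp w).card : ℤ) : WithBot ℤ) := by
  by_cases h : lastUnder w none w.length = none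
  · rw [lineDet_of_no_under h, sub_eq_add_neg]
    refine degree_add_le ?_ ?_
    · rw [← map_one C]
      exact (degree_C_le _).trans (WithBot.coe_le_coe.2 (by positivity))
    · rw [degree_neg]
      refine (degree_T_le _).trans (WithBot.coe_le_coe.2 ?_)
      exact (degFrom_le w le_rfl).trans
        (Nat.cast_le.2 (Finset.card_le_card (Finset.filter_subset _ _)))
  · rw [lineDet_eq_zetaOf hw h]
    exact degree_zetaOf_le w

end Bound

/-! ### Invariance of arcs and determinants under renaming -/

section Relabel

variable {α β : Type*} (w : List (Passage α)) (f : α → β)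

theorem getElem?_relabel_role (g : ℕ) :
    ((w.map (Passage.relabel f))[g]?).map Passage.role = (w[g]?).map Passage.role := by
  rw [List.getElem?_map, Option.map_map]
  rfl

theorem arcOf_relabel (g : ℕ) : arcOf (w.map (Passage.relabel f)) g = arcOf w g := by
  induction g with
  | zero => rfl
  | succ g ih => rw [arcOf, arcOf, getElem?_relabel_role, ih]

theorem lastUnder_relabel (init : Option ℕ) (g : ℕ) :
    lastUnder (w.map (Passage.relabel f)) init g = lastUnder w init g := by
  induction g with
  | zero => rfl
  | succ g ih => rw [lastUnder, lastUnder, getElem?_relabel_role, ih]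

theorem degFrom_relabel (init : ℤ) (g : ℕ) :
    degFrom (w.map (Passage.relabel f)) init g = degFrom w init g := by
  induction g with
  | zero => rfl
  | succ g ih =>
    cases h : w[g]? with
    | none => simp [degFrom, h, ih]
    | some x =>
      have h' : (w.map (Passage.relabel f))[g]? = some (x.relabel f) := by simp [h]
      rw [degFrom_succ _ _ h, degFrom_succ _ _ h', ih]
      rfl

theorem longArcOf_relabel (g : ℕ) :
    longArcOf (w.map (Passage.relabel f)) g = longArcOf w g := by
  rw [longArcOf, longArcOf, lastUnder_relabel, lastUnder_relabel, List.length_map]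

theorem deg_relabel (g : ℕ) : deg (w.map (Passage.relabel f)) g = deg w g := by
  rw [deg, deg, degFrom_relabel, degFrom_relabel, List.length_map]

theorem arcs_relabel : arcs (w.map (Passage.relabel f)) = arcs w := by
  ext a
  simp [arcs, arcOf_relabel]

theorem virtUp_relabel : virtUp (w.map (Passage.relabel f)) = virtUp w := by
  ext h
  simp only [mem_virtUp, List.getElem?_map, Option.map_eq_some_iff]
  constructor
  · rintro ⟨_, ⟨x, hx, rfl⟩, h⟩
    exact ⟨x, hx, h⟩
  · rintro ⟨x, hx, h⟩
    exact ⟨_, ⟨x, hx, rfl⟩, h⟩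

/-- The positions after a change of labels. -/
def relabelPosition : Fin (w.map (Passage.relabel f)).length ≃ Fin w.length :=
  finCongr (by simp)

theorem getElem_relabel (i : Fin (w.map (Passage.relabel f)).length) :
    (w.map (Passage.relabel f))[i] = (w[relabelPosition w f i]).relabel f := by
  simp [relabelPosition]

/-- The crossings after a change of labels. -/
def relabelCrossing : Crossing (w.map (Passage.relabel f)) ≃ Crossing w :=
  (relabelPosition w f).subtypeEquiv fun i => by rw [getElem_relabel]; rfl

variable {w f}

theorem isOverpassOf_relabel
    (hf : ∀ x ∈ w, ∀ y ∈ w, f x.label = f y.label → x.label = y.label)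
    (v : Crossing (w.map (Passage.relabel f))) (o : Fin (w.map (Passage.relabel f)).length) :
    IsOverpassOf _ v o ↔ IsOverpassOf w (relabelCrossing w f v) (relabelPosition w f o) := by
  unfold IsOverpassOf
  rw [getElem_relabel, getElem_relabel]
  exact and_congr_left' ⟨fun h => hf _ (List.getElem_mem _) _ (List.getElem_mem _) h,
    fun h => congrArg f h⟩

theorem tPow_relabel (hf : ∀ x ∈ w, ∀ y ∈ w, f x.label = f y.label → x.label = y.label)
    (v : Crossing (w.map (Passage.relabel f))) :
    tPow _ v = tPow w (relabelCrossing w f v) := by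
  have h1 : sgn _ v = sgn w (relabelCrossing w f v) := by
    unfold sgn
    rw [getElem_relabel]
    rfl
  have h2 : (∃ o, IsOverpassOf _ v o ∧ o < v.1)
      ↔ ∃ o, IsOverpassOf w (relabelCrossing w f v) o ∧ o < (relabelCrossing w f v).1 :=
    (relabelPosition w f).exists_congr fun o => and_congr (isOverpassOf_relabel hf v o) Iff.rfl
  rw [tPow, tPow, h1]
  classical exact if_congr h2 rfl rfl

theorem incidence_relabel (hf : ∀ x ∈ w, ∀ y ∈ w, f x.label = f y.label → x.label = y.label)
    (v : Crossing (w.map (Passage.relabel f))) (a : ℕ) :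
    incidence _ v a = incidence w (relabelCrossing w f v) a := by
  have h2 : (∃ o, IsOverpassOf _ v o ∧ arcOf (w.map (Passage.relabel f)) o = a)
      ↔ ∃ o, IsOverpassOf w (relabelCrossing w f v) o ∧ arcOf w o = a :=
    (relabelPosition w f).exists_congr fun o => and_congr (isOverpassOf_relabel hf v o) (by
      rw [arcOf_relabel]; rfl)
  rw [incidence, incidence, tPow_relabel hf, arcOf_relabel, arcOf_relabel]
  classical exact congrArg₂ _ (congrArg₂ _ rfl (if_congr h2 rfl rfl)) rfl

theorem zetaOf_relabel (hf : ∀ x ∈ w, ∀ y ∈ w, f x.label = f y.label → x.label = y.label) :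
    zetaOf (w.map (Passage.relabel f)) = zetaOf w := by
  have : zetaMatrix (w.map (Passage.relabel f))
      = (zetaMatrix w).submatrix (relabelCrossing w f) (relabelCrossing w f) := by
    ext1 v
    intro j
    simp only [submatrix_apply, zetaMatrix, arcs_relabel, longArcOf_relabel, deg_relabel,
      incidence_relabel hf]
    rfl
  rw [zetaOf, zetaOf, this, det_submatrix_equiv_self]

variable [DecidableEq α] [DecidableEq β]

theorem WellFormed.of_map {f : α → β} (hf : Function.Injective f)
    (h : WellFormed (w.map (Passage.relabel f))) : WellFormed w := by
  intro l
  have hl := h (f l)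
  rw [passagesAt_relabel fun _ _ h => hf h] at hl
  refine hl.imp (fun h => List.map_eq_nil_iff.1 h) ?_
  rintro ⟨x, hx⟩
  obtain ⟨y, t, h1, rfl, h2⟩ := List.map_eq_cons_iff.1 hx
  obtain ⟨z, t, rfl, h3, h4⟩ := List.map_eq_cons_iff.1 h2
  obtain rfl := List.map_eq_nil_iff.1 h4
  refine ⟨y, ?_⟩
  rw [h1]
  rcases y with ⟨a, r, b⟩
  rcases z with ⟨a', r', b'⟩
  simp only [Passage.relabel, Passage.partner, Passage.mk.injEq] at h3 ⊢
  rw [hf h3.1, h3.2.1, h3.2.2]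

theorem map_val_restrictLabels (w : List (Passage α)) :
    (restrictLabels w).map (Passage.relabel Subtype.val) = w := by
  have := map_restrictLabels w id
  rwa [show Passage.relabel id = (id : Passage α → Passage α) from rfl, List.map_id] at this

theorem WellFormed.restrictLabels {w : List (Passage α)} (hw : WellFormed w) :
    WellFormed (restrictLabels w) := by
  rw [← map_val_restrictLabels w] at hw
  exact hw.of_map Subtype.val_injective

theorem degree_zdet_le {w : List (Passage α)} (hw : WellFormed w) :
    (zdet w).degree ≤ (((virtUp w).card : ℤ) : WithBot ℤ) := by
  have := degree_lineDet_le hw.restrictLabels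
  rwa [← virtUp_relabel (restrictLabels w) Subtype.val, map_val_restrictLabels] at this

theorem zdet_eq_zetaOf {w : List (Passage α)} (hw : WellFormed w)
    (h : lastUnder w none w.length ≠ none) : zdet w = zetaOf w := by
  have h1 := map_val_restrictLabels w
  have h2 : lastUnder (LongVirtual.restrictLabels w) none (LongVirtual.restrictLabels w).length
      ≠ none := by
    rw [← lastUnder_relabel _ Subtype.val, h1]
    simpa [LongVirtual.restrictLabels] using h
  rw [zdet, lineDet_eq_zetaOf hw.restrictLabels h2,
    ← zetaOf_relabel (f := Subtype.val) fun _ _ _ _ h => Subtype.val_injective h, h1]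

end Relabel

end LongVirtual

/-! ### The passages of a long virtual diagram -/

namespace LongVirtualDiagram

open LongVirtual LaurentPolynomial

section Passage

variable (D : LongVirtualDiagram)

open Classical in
/-- The passage at a parameter. -/
noncomputable def passage (t : ℝ) : Passage ℂ :=
  ⟨D.curve t, D.role t, decide (∃ u, u ≠ t ∧ D.curve u = D.curve t ∧
    cross (deriv D.curve u) (deriv D.curve t) < 0)⟩

/-- The parameters at which the curve passes through a crossing, in increasing order. -/
noncomputable def sortedTimes : List ℝ := D.finite_passageTimes.toFinset.sort (· ≤ ·)

theorem word_eq : D.word = D.sortedTimes.map D.passage := rfl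

variable {D}

theorem mem_sortedTimes {t : ℝ} : t ∈ D.sortedTimes ↔ t ∈ D.passageTimes := by
  simp [sortedTimes]

theorem eq_or_eq_of_curve_eq {a b c : ℝ} (hab : a ≠ b) (h : D.curve a = D.curve b)
    (hc : D.curve c = D.curve b) : c = a ∨ c = b := by
  rcases D.double c a b (hc.trans h.symm) h with h | h | h
  exacts [Or.inl h, absurd h hab, Or.inr h]

theorem passage_ltr {a b : ℝ} (hab : a ≠ b) (h : D.curve a = D.curve b) :
    (D.passage b).ltr = true ↔ cross (deriv D.curve a) (deriv D.curve b) < 0 := by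
  simp only [passage, decide_eq_true_eq]
  constructor
  · rintro ⟨u, hu, hu', hc⟩
    rcases eq_or_eq_of_curve_eq hab h hu' with rfl | rfl
    · exact hc
    · exact absurd rfl hu
  · exact fun hc => ⟨a, hab, h, hc⟩

theorem passage_partner {a b : ℝ} (hab : a ≠ b) (h : D.curve a = D.curve b) :
    D.passage b = (D.passage a).partner := by
  have h1 := passage_ltr hab h
  have h2 := passage_ltr hab.symm h.symm
  have h3 := D.transverse a b hab h
  have h4 : cross (deriv D.curve b) (deriv D.curve a)
      = -cross (deriv D.curve a) (deriv D.curve b) := by unfold cross; ring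
  have h5 : (D.passage b).ltr = !(D.passage a).ltr := by
    rw [Bool.eq_iff_iff, h1, Bool.not_eq_true', ← Bool.not_eq_true, h2, h4]
    constructor
    · intro h; linarith
    · intro h; exact lt_of_le_of_ne (by linarith) h3
  have h6 : (D.passage b).label = (D.passage a).label := h.symm
  have h7 : (D.passage b).role = (D.passage a).role.swap := D.role_swap a b hab h
  rw [Passage.partner, ← h5, ← h6, ← h7]

theorem wellFormed_word (D : LongVirtualDiagram) : WellFormed D.word := by
  intro z
  have hp : passagesAt D.word z
      = (D.sortedTimes.filter fun t => D.curve t = z).map D.passage := by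
    rw [word_eq, passagesAt, List.filter_map]
    rfl
  rw [hp]
  by_cases hz : ∃ t ∈ D.passageTimes, D.curve t = z
  · right
    obtain ⟨t, ⟨u, hut, hu⟩, rfl⟩ := hz
    have hnd : (D.sortedTimes.filter fun s => D.curve s = D.curve t).Nodup :=
      (Finset.sort_nodup _ _).filter _
    have hperm : (D.sortedTimes.filter fun s => D.curve s = D.curve t).Perm [u, t] := by
      refine (List.perm_ext_iff_of_nodup hnd (by simp [hut])).2 fun s => ?_
      simp only [List.mem_filter, mem_sortedTimes, decide_eq_true_eq, List.mem_cons,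
        List.not_mem_nil, or_false]
      constructor
      · exact fun h => eq_or_eq_of_curve_eq hut hu h.2
      · rintro (rfl | rfl)
        · exact ⟨⟨t, hut.symm, hu.symm⟩, hu⟩
        · exact ⟨⟨u, hut, hu⟩, rfl⟩
    rcases List.perm_pair.1 hperm with h | h
    · rw [h]; exact ⟨_, by rw [List.map_cons, List.map_cons, passage_partner hut hu]; rfl⟩
    · rw [h]; exact ⟨_, by
        rw [List.map_cons, List.map_cons, passage_partner hut.symm hu.symm]; rfl⟩
  · left
    rw [List.map_eq_nil_iff, List.filter_eq_nil_iff]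
    intro t ht
    simp only [decide_eq_true_eq]
    exact fun h => hz ⟨t, mem_sortedTimes.1 ht, h⟩

theorem finite_virtualCrossings (D : LongVirtualDiagram) : D.virtualCrossings.Finite := by
  refine (D.finite_passageTimes.image D.curve).subset ?_
  rintro z ⟨a, b, hab, ha, hb, -⟩
  exact ⟨a, ⟨b, hab.symm, hb.trans ha.symm⟩, ha⟩

/-- The two passages through a virtual crossing have opposite directions, so each crossing has at
most one passage from left to right. -/
theorem card_virtUp_le (D : LongVirtualDiagram) : (virtUp D.word).card ≤ D.virtualNumber := by
  let f : ℕ → ℂ := fun h => ((D.word[h]?).map Passage.label).getD 0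
  have hinj : Set.InjOn f (virtUp D.word) := by
    intro h hh k hk hfk
    obtain ⟨x, hx, -, hxl⟩ := (mem_virtUp _).1 hh
    obtain ⟨y, hy, -, hyl⟩ := (mem_virtUp _).1 hk
    have hxy : y.label = x.label := by simpa [f, hx, hy] using hfk.symm
    obtain ⟨g, -, hg, hall, -⟩ := D.wellFormed_word.exists_partner hx
    rcases hall k y hy hxy with rfl | rfl
    · rfl
    · rw [hg] at hy
      obtain rfl := Option.some.inj hy
      simp [hxl] at hyl
  rw [← Finset.card_image_of_injOn hinj, virtualNumber, ← Set.ncard_coe_finset]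
  refine Set.ncard_le_ncard ?_ D.finite_virtualCrossings
  intro z hz
  obtain ⟨h, hh, rfl⟩ := Finset.mem_image.1 (Finset.mem_coe.1 hz)
  obtain ⟨x, hx, hr, -⟩ := (mem_virtUp _).1 hh
  have hm := List.mem_of_getElem? hx
  rw [word_eq, List.mem_map] at hm
  obtain ⟨t, ht, rfl⟩ := hm
  obtain ⟨u, hut, hu⟩ := mem_sortedTimes.1 ht
  have hf : f h = D.curve t := by simp [f, hx, passage]
  rw [hf]
  exact ⟨t, u, hut.symm, rfl, hu, hr⟩

theorem role_ne_virt_of_isClassical (h : D.IsClassical) {x : Passage ℂ} (hx : x ∈ D.word) :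
    x.role ≠ .virt := by
  rw [word_eq, List.mem_map] at hx
  obtain ⟨t, ht, rfl⟩ := hx
  obtain ⟨u, hut, hu⟩ := mem_sortedTimes.1 ht
  intro hr
  have : D.curve t ∈ D.virtualCrossings := ⟨t, u, hut.symm, rfl, hu, hr⟩
  rw [h] at this
  exact this

theorem abs_le_radius {a b : ℝ} (hab : a ≠ b) (h : D.curve a = D.curve b) : |a| ≤ D.radius :=
  abs_le_of_crossing D.curve_eq hab h

end Passage

/-! ### The passages of a product -/

section Product

variable (D K : LongVirtualDiagram)

theorem passage_mul_left {t : ℝ} (ht : t ∈ D.passageTimes) :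
    t ∈ (D * K).passageTimes ∧ (D * K).passage t = D.passage t := by
  obtain ⟨u, hut, hu⟩ := ht
  have h1 := le_of_abs_le (abs_le_radius hut hu)
  have h2 := le_of_abs_le (abs_le_radius hut.symm hu.symm)
  have e1 : (D * K).curve u = D.curve u := prodCurve_left D K (by linarith)
  have e2 : (D * K).curve t = D.curve t := prodCurve_left D K (by linarith)
  have e3 : (D * K).role t = D.role t := if_pos (by linarith)
  have hu' : (D * K).curve u = (D * K).curve t := by rw [e1, e2, hu]
  have d1 : deriv (D * K).curve u = deriv D.curve u := deriv_prodCurve_left D K (by linarith)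
  have d2 : deriv (D * K).curve t = deriv D.curve t := deriv_prodCurve_left D K (by linarith)
  have hl : ((D * K).passage t).ltr = (D.passage t).ltr := by
    rw [Bool.eq_iff_iff, passage_ltr hut hu', passage_ltr hut hu, d1, d2]
  refine ⟨⟨u, hut, hu'⟩, ?_⟩
  have h6 : ((D * K).passage t).label = (D.passage t).label := e2
  have h7 : ((D * K).passage t).role = (D.passage t).role := e3
  cases h : (D * K).passage t
  cases h' : D.passage t
  simp_all

theorem passage_mul_right {t : ℝ} (ht : t ∈ K.passageTimes) :
    t + shift D K ∈ (D * K).passageTimes ∧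
      (D * K).passage (t + shift D K)
        = (K.passage t).relabel (fun z => z + (shift D K : ℂ)) := by
  obtain ⟨u, hut, hu⟩ := ht
  have hs : shift D K = D.radius + K.radius + 2 := rfl
  have h1 := neg_le_of_abs_le (abs_le_radius hut hu)
  have h2 := neg_le_of_abs_le (abs_le_radius hut.symm hu.symm)
  have e1 : (D * K).curve (u + shift D K) = K.curve u + shift D K := by
    have := prodCurve_right D K (t := u + shift D K) (by linarith)
    rwa [add_sub_cancel_right] at this
  have e2 : (D * K).curve (t + shift D K) = K.curve t + shift D K := by
    have := prodCurve_right D K (t := t + shift D K) (by linarith)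
    rwa [add_sub_cancel_right] at this
  have e3 : (D * K).role (t + shift D K) = K.role t := by
    have : (D * K).role (t + shift D K) = K.role (t + shift D K - shift D K) :=
      if_neg (by linarith)
    rwa [add_sub_cancel_right] at this
  have hu' : (D * K).curve (u + shift D K) = (D * K).curve (t + shift D K) := by rw [e1, e2, hu]
  have d1 : deriv (D * K).curve (u + shift D K) = deriv K.curve u := by
    have := deriv_prodCurve_right D K (t := u + shift D K) (by linarith)
    rwa [add_sub_cancel_right] at this
  have d2 : deriv (D * K).curve (t + shift D K) = deriv K.curve t := by
    have := deriv_prodCurve_right D K (t := t + shift D K) (by linarith)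
    rwa [add_sub_cancel_right] at this
  have hut' : u + shift D K ≠ t + shift D K := by simpa using hut
  have hl : ((D * K).passage (t + shift D K)).ltr = (K.passage t).ltr := by
    rw [Bool.eq_iff_iff, passage_ltr hut' hu', passage_ltr hut hu, d1, d2]
  refine ⟨⟨_, hut', hu'⟩, ?_⟩
  have h6 : ((D * K).passage (t + shift D K)).label = (K.passage t).label + shift D K := e2
  have h7 : ((D * K).passage (t + shift D K)).role = (K.passage t).role := e3
  rw [Passage.relabel, ← h6, ← h7, ← hl]

theorem mem_passageTimes_mul {t : ℝ} (ht : t ∈ (D * K).passageTimes) :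
    t ∈ D.passageTimes ∨ t - shift D K ∈ K.passageTimes := by
  obtain ⟨u, hut, hu⟩ := ht
  change prodCurve D K u = prodCurve D K t at hu
  rcases prodCurve_separated D K hu with h | h
  · rw [prodCurve_left D K h.1, prodCurve_left D K h.2] at hu
    exact Or.inl ⟨u, hut, hu⟩
  · rw [prodCurve_right D K h.1, prodCurve_right D K h.2] at hu
    exact Or.inr ⟨u - shift D K, by simpa using hut, add_right_cancel hu⟩

theorem sortedTimes_mul :
    (D * K).sortedTimes = D.sortedTimes ++ K.sortedTimes.map (· + shift D K) := by
  have hs : shift D K = D.radius + K.radius + 2 := rfl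
  have hD : ∀ t ∈ D.sortedTimes, t ≤ D.radius := by
    intro t ht
    obtain ⟨u, hut, hu⟩ := mem_sortedTimes.1 ht
    exact le_of_abs_le (abs_le_radius hut.symm hu.symm)
  -- The crossings of the two factors occupy disjoint ranges of the parameter, so concatenating the
  -- sorted lists gives a sorted list.
  have hK : ∀ t ∈ K.sortedTimes.map (· + shift D K), D.radius + 2 ≤ t := by
    intro t ht
    obtain ⟨s, hs', rfl⟩ := List.mem_map.1 ht
    obtain ⟨u, hut, hu⟩ := mem_sortedTimes.1 hs'
    have := neg_le_of_abs_le (abs_le_radius hut.symm hu.symm)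
    linarith
  have hnd : (D.sortedTimes ++ K.sortedTimes.map (· + shift D K)).Nodup := by
    refine List.Nodup.append (Finset.sort_nodup _ _)
      ((Finset.sort_nodup _ _).map (add_left_injective _)) ?_
    intro t h1 h2
    have := hD t h1
    have := hK t h2
    linarith
  have hp : (D.sortedTimes ++ K.sortedTimes.map (· + shift D K)).Pairwise (· ≤ ·) := by
    refine List.pairwise_append.2 ⟨Finset.pairwise_sort _ _, ?_, fun a ha b hb => ?_⟩
    · refine List.Pairwise.map _ (fun a b h => ?_) (Finset.pairwise_sort _ _)
      simpa using h
    · have := hD a ha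
      have := hK b hb
      linarith
  rw [← (List.toFinset_sort (· ≤ ·) hnd).2 hp, sortedTimes]
  congr 1
  ext t
  simp only [Set.Finite.mem_toFinset, List.mem_toFinset, List.mem_append, List.mem_map,
    mem_sortedTimes]
  constructor
  · intro ht
    exact (mem_passageTimes_mul D K ht).imp id fun h => ⟨_, h, by ring⟩
  · rintro (h | ⟨s, h, rfl⟩)
    · exact (passage_mul_left D K h).1
    · exact (passage_mul_right D K h).1

theorem word_mul : (D * K).word
    = D.word ++ K.word.map (Passage.relabel fun z => z + (shift D K : ℂ)) := by
  rw [word_eq, sortedTimes_mul, List.map_append, word_eq, word_eq, List.map_map, List.map_map]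
  congr 1
  · exact List.map_congr_left fun t ht => (passage_mul_left D K (mem_sortedTimes.1 ht)).2
  · exact List.map_congr_left fun t ht => (passage_mul_right D K (mem_sortedTimes.1 ht)).2

variable {K}

theorem virtualNumber_mul_le (hK : K.IsClassical) :
    (D * K).virtualNumber ≤ D.virtualNumber := by
  refine Set.ncard_le_ncard ?_ D.finite_virtualCrossings
  rintro z ⟨a, b, hab, ha, hb, hr⟩
  have h : prodCurve D K a = prodCurve D K b := ha.trans hb.symm
  change prodCurve D K a = z at ha
  change prodCurve D K b = z at hb
  change prodRole D K a = _ at hr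
  rcases prodCurve_separated D K h with h' | h'
  · rw [prodCurve_left D K h'.1] at ha h
    rw [prodCurve_left D K h'.2] at hb h
    have := le_of_abs_le (abs_le_radius hab h)
    rw [prodRole, if_pos (by linarith)] at hr
    exact ⟨a, b, hab, ha, hb, hr⟩
  · rw [prodCurve_right D K h'.1, prodCurve_right D K h'.2] at h
    have h := add_right_cancel h
    have hab' : a - shift D K ≠ b - shift D K := by simpa using hab
    have := neg_le_of_abs_le (abs_le_radius hab' h)
    have hs : shift D K = D.radius + K.radius + 2 := rfl
    rw [prodRole, if_neg (by linarith)] at hr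
    have : K.curve (a - shift D K) ∈ K.virtualCrossings := ⟨_, _, hab', rfl, h.symm, hr⟩
    rw [hK] at this
    exact absurd this (Set.notMem_empty _)

theorem zdet_mul (hK : K.IsClassical) :
    ∃ d : CoeffRing, augment d = 1 ∧ zdet (D * K).word = zdet D.word * C d := by
  have hinj : Function.Injective fun z : ℂ => z + (shift D K : ℂ) := add_left_injective _
  have hw := (D * K).wellFormed_word
  have hB := K.wellFormed_word.map (f := fun z : ℂ => z + (shift D K : ℂ)) fun x _ y _ h => hinj h
  rw [word_mul] at hw ⊢
  refine zdet_append (fun x hx y hy h => ?_) hB fun x hx => ?_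
  · have h1 := hw.atMostTwice x.label
    have hx : x ∈ passagesAt D.word x.label := mem_passagesAt.2 ⟨hx, rfl⟩
    have hy : y ∈ passagesAt (K.word.map (Passage.relabel fun z => z + (shift D K : ℂ))) x.label :=
      mem_passagesAt.2 ⟨hy, h.symm⟩
    rw [passagesAt_append, List.length_append] at h1
    rcases D.wellFormed_word x.label with h2 | ⟨x', h2⟩
    · rw [h2] at hx; simp at hx
    rcases hB x.label with h3 | ⟨y', h3⟩
    · rw [h3] at hy; simp at hy
    rw [h2, h3] at h1
    simp at h1
  · obtain ⟨y, hy, rfl⟩ := List.mem_map.1 hx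
    exact role_ne_virt_of_isClassical (x := y) hK hy

end Product

/-! ### Minimality -/

/-- A step multiplies the determinant by a unit of `T`, which neither shifts the exponents of `s`
nor kills a coefficient. -/
theorem Equivalent.coeff_ne_zero_iff {D D' : LongVirtualDiagram} (h : Equivalent D D') (n : ℤ) :
    (zdet D.word).coeff n ≠ 0 ↔ (zdet D'.word).coeff n ≠ 0 := by
  have hC : ∀ (u : CoeffRing) (f : LaurentPolynomial CoeffRing),
      (C u * f).coeff n = u * f.coeff n := by
    intro u f
    rw [← LaurentPolynomial.smul_eq_C_mul, AddMonoidAlgebra.coeff_smul_apply, smul_eq_mul]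
  induction h with
  | rel D D' h =>
    obtain ⟨φ, h⟩ := h
    obtain ⟨u, hu⟩ := zdet_move h D.wellFormed_word.atMostTwice
    rw [hu, hC, not_iff_not, Units.mul_right_eq_zero]
  | refl => exact Iff.rfl
  | symm _ _ _ ih => exact ih.symm
  | trans _ _ _ _ _ ih ih' => exact ih.trans ih'

theorem le_virtualNumber_of_coeff_ne_zero {D : LongVirtualDiagram} {n : ℕ}
    (h : (zdet D.word).coeff n ≠ 0) : n ≤ D.virtualNumber := by
  by_contra! hn
  refine h (degree_le_iff.1 (degree_zdet_le D.wellFormed_word) n ?_)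
  exact_mod_cast lt_of_le_of_lt D.card_virtUp_le hn

theorem coeff_zdet_ne_zero {D : LongVirtualDiagram}
    (hD : D.zeta.degree = ((D.virtualNumber : ℤ) : WithBot ℤ)) (hpos : 0 < D.virtualNumber) :
    (zdet D.word).coeff (D.virtualNumber : ℤ) ≠ 0 := by
  -- Without underpasses `ζ` is the empty determinant `1`, whose degree is not positive, contrary to
  -- the number of virtual crossings. So `ζ` and the invariant determinant agree here.
  have hu : lastUnder D.word none D.word.length ≠ none := by
    intro h
    have hE : IsEmpty (Crossing D.word) :=
      ⟨fun v => lastUnder_ne_none _ le_rfl v.1.2 (getElem?_crossing _ v) v.2 h⟩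
    have h1 : D.zeta = C 1 := by rw [zeta, zetaOf, Matrix.det_isEmpty, map_one]
    have h2 := degree_C_le (1 : CoeffRing)
    rw [← h1, hD] at h2
    have h3 : (D.virtualNumber : ℤ) ≤ 0 := WithBot.coe_le_coe.1 h2
    omega
  rw [zdet_eq_zetaOf D.wellFormed_word hu]
  exact Finsupp.mem_support_iff.1 (Finset.mem_of_max hD)

theorem isMinimal_mul {D K : LongVirtualDiagram} (hK : K.IsClassical)
    (hD : D.zeta.degree = ((D.virtualNumber : ℤ) : WithBot ℤ)) :
    (D * K).IsMinimal := by
  intro D' hD'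
  refine (virtualNumber_mul_le D hK).trans ?_
  rcases Nat.eq_zero_or_pos D.virtualNumber with h0 | hpos
  · rw [h0]; exact Nat.zero_le _
  obtain ⟨d, hd, hz⟩ := zdet_mul D hK
  refine le_virtualNumber_of_coeff_ne_zero ((hD'.coeff_ne_zero_iff _).1 fun h => ?_)
  -- The coefficient for the product is that of `D` times `d`, and `d` is not a zero divisor since
  -- its augmentation is `1`.
  refine coeff_zdet_ne_zero hD hpos (eq_zero_of_mul_eq_zero hd ?_)
  rw [hz, mul_comm, ← LaurentPolynomial.smul_eq_C_mul, AddMonoidAlgebra.coeff_smul_apply,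
    smul_eq_mul, mul_comm] at h
  exact h

end LongVirtualDiagram

theorem theorem4 (D K : LongVirtualDiagram) (hK : K.IsClassical)
    (hD : D.zeta.degree = ((D.virtualNumber : ℤ) : WithBot ℤ)) :
    (D * K).IsMinimal :=
  LongVirtualDiagram.isMinimal_mul hK hD
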